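/- Fix integers $n\ge 2$, $d\ge 0$ and let $H$ be a (possibly unbounded) self-adjoint Hamiltonian of a system on the lattice $\Lambda=[n]^d$ such that $Z_T=\operatorname{tr}e^{-H/T}<\infty$ for all $T>0$. Put $\rho_T=e^{-H/T}/Z_T$, $u(T)=\operatorname{tr}(H\rho_T)/n^d$ and $c(T)=\frac{\mathrm d u}{\mathrm d T}(T)$ (the specific heat capacity), and let $\rho_0$ be the maximally mixed state on the ground space of $H$. Let $k,\Delta>0$ and $\nu\ge 0$ be such that $$c(T)\le k\,T^{-\nu}e^{-\Delta/T}\qquad\text{for all } 0<T\le 1/\log n ,$$ let $0<\delta\le 1$, and suppose that $n$ is large enough that $\nu\,\delta\le\Delta\log n$. Put $$\eta:=\frac{2k}{\Delta}\Bigl(\frac{\log n}{\delta}\Bigr)^{\nu-1}n^{\,d-\Delta/\delta}.$$ (1) For every $0<T\le\delta/\log n$, $\ \|\rho_T-\rho_0\|_1\le\eta$. (2) Suppose moreover that $H$ is an $r$-local spin Hamiltonian of interaction strength $J$: the Hilbert space is $(\mathbb C^q)^{\otimes\Lambda}$ with $q\ge 1$, and $H=\sum_{i\in\Lambda}h_i$,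 where $h_i$ acts only on the sites at Manhattan distance at most $r$ from $i$ and $\|h_i\|\le J$. Then for every $0<\varepsilon\le n$ there is a projected entangled pair operator (PEPO) $\pi$ on the nearest-neighbour graph of $\Lambda$, of bond dimension at most $(n/\varepsilon)^{C\log n}$, with $$\|\pi-\rho_0\|_1\le\varepsilon+\eta .$$ Here the constant $C$ depends only on $d,q,r,J,\delta$, and not on $n$, $\varepsilon$, $H$, $k$, $\Delta$, $\nu$. A PEPO of bond dimension $D$ is an operator given by a tensor at each site, with two physical indices in $\{1,\dots,q\}$ and one index in $\{1,\dots,D\}$ for each lattice edge at the site, where the two indices belonging to each edge are contracted. -/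

import Mathlib

open scoped ENNReal

namespace ThermalLattice

noncomputable section

section Thermal

variable {E : Type*} [NormedAddCommGroup E] [InnerProductSpace ℂ E] [CompleteSpace E]

/-- The eigenspace `{x ∈ dom H | H x = lam x}` of a (possibly unbounded) operator `H`. -/
def eigenspace (H : E →ₗ.[ℂ] E) (lam : ℝ) : Submodule ℂ E :=
  (LinearMap.ker (H.toFun - (lam : ℂ) • H.domain.subtype)).map H.domain.subtype

/-- The degeneracy of the energy `lam`; it is zero when `lam` is not an eigenvalue. -/
def degeneracy (H : E →ₗ.[ℂ] E) (lam : ℝ) : ℕ := Module.finrank ℂ (eigenspace H lam)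

/-- The orthogonal projection onto (the closure of) the eigenspace of `lam`. The eigenspaces
of a self-adjoint operator are closed, so the closure changes nothing there. -/
def spectralProj (H : E →ₗ.[ℂ] E) (lam : ℝ) : E →L[ℂ] E :=
  (eigenspace H lam).topologicalClosure.starProjection

/-- The partition function `tr e^{-H/T}`. All sums over `lam : ℝ` are sums over the eigenvalues
of `H`, since the terms at all other reals vanish. -/
def partitionFn (H : E →ₗ.[ℂ] E) (T : ℝ) : ℝ :=
  ∑' lam : ℝ, (degeneracy H lam : ℝ) * Real.exp (-lam / T)

/-- `H` is a self-adjoint, possibly unbounded, Hamiltonian with `tr e^{-H/T} < ∞` for all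
`T > 0`, that is, the thermal states exist. Finiteness of the trace means exactly that the
spectrum is pure point (the eigenvectors are total), that all energies have finite degeneracy,
and that the sum defining the partition function converges. -/
structure IsThermalHamiltonian (H : E →ₗ.[ℂ] E) : Prop where
  selfAdjoint : IsSelfAdjoint H
  total : (⨆ lam : ℝ, eigenspace H lam).topologicalClosure = ⊤
  finite : ∀ lam : ℝ, FiniteDimensional ℂ (eigenspace H lam)
  summable : ∀ T : ℝ, 0 < T →
    Summable fun lam : ℝ => (degeneracy H lam : ℝ) * Real.exp (-lam / T)

/-- The thermal state `ρ_T = e^{-H/T} / Z_T`, where `e^{-H/T} = ∑ e^{-lam/T} P_lam`. -/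
def thermalState (H : E →ₗ.[ℂ] E) (T : ℝ) : E →L[ℂ] E :=
  ∑' lam : ℝ, ((Real.exp (-lam / T) / partitionFn H T : ℝ) : ℂ) • spectralProj H lam

/-- The mean energy `tr (H ρ_T)`. -/
def meanEnergy (H : E →ₗ.[ℂ] E) (T : ℝ) : ℝ :=
  (∑' lam : ℝ, lam * ((degeneracy H lam : ℝ) * Real.exp (-lam / T))) / partitionFn H T

/-- The specific heat capacity `c(T) = du/dT` of a system with `N` sites, where
`u(T) = tr (H ρ_T) / N` is the energy density. -/
def specificHeat (N : ℕ) (H : E →ₗ.[ℂ] E) (T : ℝ) : ℝ :=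
  deriv (fun t => meanEnergy H t / N) T

/-- The ground state energy: the least eigenvalue. -/
def groundEnergy (H : E →ₗ.[ℂ] E) : ℝ := sInf {lam : ℝ | eigenspace H lam ≠ ⊥}

/-- The maximally mixed state on the ground space of `H`. -/
def groundState (H : E →ₗ.[ℂ] E) : E →L[ℂ] E :=
  ((degeneracy H (groundEnergy H) : ℂ)⁻¹) • spectralProj H (groundEnergy H)

/-- The trace norm `‖A‖₁ = tr |A|` with `|A| = (A† A)^{1/2}`, as an extended nonnegative real.
The trace of the positive operator `|A|` is written as the supremum of its partial traces
`∑ ⟨v_i, |A| v_i⟩` over finite orthonormal families, which does not involve a choice of basis. -/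
def traceNorm (A : E →L[ℂ] E) : ℝ≥0∞ :=
  ⨆ (m : ℕ) (v : Fin m → E) (_ : Orthonormal ℂ v),
    ∑ i, ENNReal.ofReal (inner ℂ (v i) (CFC.abs A (v i))).re

end Thermal

section Lattice

/-- The sites of the cubic lattice `[n]^d`. -/
abbrev Site (d n : ℕ) : Type := Fin d → Fin n

/-- The Manhattan distance of the lattice. -/
def manhattan {d n : ℕ} (i j : Site d n) : ℕ := ∑ a, Nat.dist (i a) (j a)

/-- The ball of radius `r` about `i` in the Manhattan distance. -/
def ball {d n : ℕ} (r : ℕ) (i : Site d n) : Set (Site d n) := {j | manhattan i j ≤ r}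

/-- The nearest-neighbour graph of the lattice. -/
def latticeGraph (d n : ℕ) : SimpleGraph (Site d n) where
  Adj i j := manhattan i j = 1
  symm := ⟨fun i j h => by
    rw [← h]; exact Finset.sum_congr rfl fun a _ => Nat.dist_comm _ _⟩
  loopless := ⟨fun i h => by simp [manhattan] at h⟩

/-- Operators on `(ℂ^q)^{⊗ [n]^d}`, as matrices in the product basis. -/
abbrev SpinMatrix (d n q : ℕ) : Type := Matrix (Site d n → Fin q) (Site d n → Fin q) ℂ

/-- The Hilbert space `(ℂ^q)^{⊗ [n]^d}`. -/
abbrev SpinSpace (d n q : ℕ) : Type := EuclideanSpace ℂ (Site d n → Fin q)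

/-- The operator on the Hilbert space given by a matrix. -/
def toOp {d n q : ℕ} (M : SpinMatrix d n q) : SpinSpace d n q →L[ℂ] SpinSpace d n q :=
  Matrix.toEuclideanCLM (n := Site d n → Fin q) (𝕜 := ℂ) M

/-- The same operator as an everywhere defined partial operator. -/
def toHam {d n q : ℕ} (M : SpinMatrix d n q) : SpinSpace d n q →ₗ.[ℂ] SpinSpace d n q :=
  (toOp M : SpinSpace d n q →ₗ[ℂ] SpinSpace d n q).toPMap ⊤

open scoped Classical in
/-- `M` acts only on the sites of `S`: it is `B ⊗ 1` for some `B` acting on the sites of `S`. -/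
def ActsOn {d n q : ℕ} (S : Set (Site d n)) (M : SpinMatrix d n q) : Prop :=
  ∃ B : Matrix (S → Fin q) (S → Fin q) ℂ, ∀ s t : Site d n → Fin q,
    M s t = if ∀ i, i ∉ S → s i = t i then B (fun i => s i) (fun i => t i) else 0

open scoped Classical in
/-- The projected entangled pair operator with local tensors `A`: site `i` carries a tensor with
one index in `Fin D` for each lattice edge at `i`, and two physical indices; the indices on the
two ends of every edge are contracted. -/
def pepo {d n q D : ℕ}
    (A : (i : Site d n) → ((latticeGraph d n).incidenceSet i → Fin D) →
      Matrix (Fin q) (Fin q) ℂ) : SpinMatrix d n q :=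
  fun s t => ∑ b : (latticeGraph d n).edgeSet → Fin D,
    ∏ i, A i (fun e => b ⟨e.1, (latticeGraph d n).incidenceSet_subset i e.2⟩) (s i) (t i)

/-- `M` is a projected entangled pair operator of bond dimension `D`. -/
def IsPEPO {d n q : ℕ} (D : ℕ) (M : SpinMatrix d n q) : Prop :=
  ∃ A : (i : Site d n) → ((latticeGraph d n).incidenceSet i → Fin D) →
    Matrix (Fin q) (Fin q) ℂ, M = pepo A

end Lattice

/-- The error `(2k/Δ) (log n / δ)^{ν-1} n^{d - Δ/δ}`. -/
def etaErr (d n : ℕ) (k Δ ν δ : ℝ) : ℝ :=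
  2 * k / Δ * (Real.log n / δ) ^ (ν - 1) * (n : ℝ) ^ ((d : ℝ) - Δ / δ)

end

end ThermalLattice

open ThermalLattice

/-! Low temperature states. Let `g` be the ground state degeneracy and `Z` the partition function
with energies measured from the ground energy. The positive part of `ρ_T - ρ₀` lives on the excited
levels and the negative part on the ground space, each of trace `1 - g / Z`, so the distance is at
most `2 (1 - g / Z) ≤ 2 log (Z / g)`. If `G(t)` is the mean excess energy, then `log Z + G(t) (1 / t
- 1 / T₀)` has derivative `G'(t) (1 / t - 1 / T₀)`, tends to `log g` as `t → 0`, and equals `log Z`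
at `T₀ = δ / log n`. The specific heat bound controls this derivative by that of an explicit
function whose value at `T₀` is half of `etaErr`. This is `log_boltzmannMoment_le`; smaller
temperatures follow because `Z` decreases with the inverse temperature.

Projected entangled pairs. It remains to approximate `exp (-H / T₀)` in trace norm within `ε Z`.
Write it as the `m`-th power of `exp (∑ a i)` with `m` of order `log n` and small terms `a i`.
Möbius inversion gives `exp (∑ a i) = ∑_S f(S)`, where `f` factorizes over the connected components
of `S` and `‖f(S)‖ ≤ (e^t - 1)^|S|` (`norm_clusterTerm_le`). Keep only the sets whose components
have at most `L` points.

The error must be relative to the partition function of the whole power, so operator norm bounds do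
not suffice. Inclusion-exclusion over the large components turns the truncated sum into `∑_U ± f(U)
exp (∑_{i ∉ nbhd U} a i)`, with all components of `U` large (`sum_smallComponents`). A Hölder
inequality from the three lines theorem (`norm_trace_prod_exp_le`) bounds every word in the expanded
power by operator norms of the `f(U)` times a partition function. Deleting the terms near `U` costs
only an exponential in `|U|` (`trace_exp_le`), which the smallness of `f(U)` absorbs. Counting
connected sets then bounds the relative error by `exp (m n^d 2^{-L}) - 1`
(`norm_trace_truncatedExp_pow_sub_le`).

The truncated sum is a tensor network: a site stores the one small cluster whose neighbourhood
covers it, together with both configurations there, and the edges check that neighbours store the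
same cluster (`sum_smallComponents_apply`). The number of local states is exponential in `L`, which
is of order `log (n / ε)`; the `m`-fold product gives bond dimension `(n / ε)^{C log n}`. -/

namespace ThermalLattice

/-! ### Partition function, its moments and their zero temperature limits. -/

section Boltzmann

open Filter Topology

/-- The moments `∑ w(l) (l - e₀)^m e^{-b (l - e₀)}` of the Boltzmann weights. -/
noncomputable def boltzmannMoment (w : ℝ → ℝ) (e₀ : ℝ) (m : ℕ) (b : ℝ) : ℝ :=
  ∑' l : ℝ, w l * (l - e₀) ^ m * Real.exp (-(b * (l - e₀)))

variable {w : ℝ → ℝ} {e₀ : ℝ}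

/-- Half of the exponential decay absorbs the power, by `y ^ m / m! ≤ e ^ y` at `y = b x / 2`. All
moments at `b` are thereby dominated by the partition sum at `b / 2`. -/
theorem pow_mul_exp_le {b x : ℝ} (hb : 0 < b) (hx : 0 ≤ x) (m : ℕ) :
    x ^ m * Real.exp (-(b * x)) ≤ m.factorial * (2 / b) ^ m * Real.exp (-(b / 2 * x)) := by
  have h := Real.pow_div_factorial_le_exp (b / 2 * x) (by positivity) m
  rw [div_le_iff₀ (by positivity)] at h
  have h2 : x ^ m = (2 / b) ^ m * (b / 2 * x) ^ m := by
    rw [← mul_pow]; congr 1; field_simp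
  have h3 : Real.exp (-(b / 2 * x)) = Real.exp (b / 2 * x) * Real.exp (-(b * x)) := by
    rw [← Real.exp_add]; congr 1; ring
  rw [h2, h3]
  have : 0 ≤ (2 / b) ^ m * Real.exp (-(b * x)) := by positivity
  nlinarith [mul_le_mul_of_nonneg_left h this]

theorem boltzmann_term_nonneg (hw : ∀ l, 0 ≤ w l) (hs : ∀ l, w l ≠ 0 → e₀ ≤ l) (m : ℕ)
    (b l : ℝ) : 0 ≤ w l * (l - e₀) ^ m * Real.exp (-(b * (l - e₀))) := by
  by_cases h : w l = 0
  · simp [h]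
  · have := sub_nonneg.2 (hs l h)
    have := hw l
    positivity

theorem summable_boltzmann (hw : ∀ l, 0 ≤ w l) (hs : ∀ l, w l ≠ 0 → e₀ ≤ l)
    (hsum : ∀ b : ℝ, 0 < b → Summable fun l : ℝ => w l * Real.exp (-(b * (l - e₀))))
    (m : ℕ) {b : ℝ} (hb : 0 < b) :
    Summable fun l : ℝ => w l * (l - e₀) ^ m * Real.exp (-(b * (l - e₀))) := by
  refine Summable.of_nonneg_of_le (boltzmann_term_nonneg hw hs m b) (fun l => ?_)
    ((hsum (b / 2) (by positivity)).mul_left (m.factorial * (2 / b) ^ m))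
  by_cases h : w l = 0
  · simp [h]
  · have := mul_le_mul_of_nonneg_left (pow_mul_exp_le hb (sub_nonneg.2 (hs l h)) m) (hw l)
    linarith

theorem hasDerivAt_boltzmannMoment (hw : ∀ l, 0 ≤ w l) (hs : ∀ l, w l ≠ 0 → e₀ ≤ l)
    (hsum : ∀ b : ℝ, 0 < b → Summable fun l : ℝ => w l * Real.exp (-(b * (l - e₀))))
    (m : ℕ) {b : ℝ} (hb : 0 < b) :
    HasDerivAt (boltzmannMoment w e₀ m) (-boltzmannMoment w e₀ (m + 1) b) b := by
  -- On `(b / 2, ∞)` the derivatives of the terms are dominated by their values at `b / 2`, which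
  -- are summable; this permits termwise differentiation.
  have hmem : b ∈ Set.Ioi (b / 2) := by simp [hb]
  have := hasDerivAt_tsum_of_isPreconnected
    (g := fun (l b : ℝ) => w l * (l - e₀) ^ m * Real.exp (-(b * (l - e₀))))
    (g' := fun (l b : ℝ) => -(w l * (l - e₀) ^ (m + 1) * Real.exp (-(b * (l - e₀)))))
    (summable_boltzmann hw hs hsum (m + 1) (half_pos hb)) isOpen_Ioi isPreconnected_Ioi
    (fun l y _ => ?_) (fun l y hy => ?_) hmem (summable_boltzmann hw hs hsum m hb) hmem
  · rw [tsum_neg] at this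
    exact this
  · have h1 : HasDerivAt (fun y : ℝ => -(y * (l - e₀))) (-(l - e₀)) y := by
      exact ((hasDerivAt_id y).mul_const (l - e₀)).fun_neg.congr_deriv (by ring)
    exact (h1.exp.const_mul (w l * (l - e₀) ^ m)).congr_deriv (by ring)
  · rw [norm_neg, Real.norm_of_nonneg (boltzmann_term_nonneg hw hs _ _ _)]
    by_cases h : w l = 0
    · simp [h]
    · have h0 := sub_nonneg.2 (hs l h)
      have h1 := hw l
      have hy' : b / 2 ≤ y := le_of_lt hy
      gcongr

theorem boltzmannMoment_nonneg (hw : ∀ l, 0 ≤ w l) (hs : ∀ l, w l ≠ 0 → e₀ ≤ l) (m : ℕ)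
    (b : ℝ) : 0 ≤ boltzmannMoment w e₀ m b :=
  tsum_nonneg (boltzmann_term_nonneg hw hs m b)

theorem le_boltzmannMoment_zero (hw : ∀ l, 0 ≤ w l) (hs : ∀ l, w l ≠ 0 → e₀ ≤ l)
    (hsum : ∀ b : ℝ, 0 < b → Summable fun l : ℝ => w l * Real.exp (-(b * (l - e₀))))
    {b : ℝ} (hb : 0 < b) : w e₀ ≤ boltzmannMoment w e₀ 0 b := by
  have := (summable_boltzmann hw hs hsum 0 hb).le_tsum e₀
    (fun l _ => boltzmann_term_nonneg hw hs 0 b l)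
  simpa [boltzmannMoment] using this

theorem boltzmannMoment_zero_anti (hw : ∀ l, 0 ≤ w l) (hs : ∀ l, w l ≠ 0 → e₀ ≤ l)
    (hsum : ∀ b : ℝ, 0 < b → Summable fun l : ℝ => w l * Real.exp (-(b * (l - e₀))))
    {a b : ℝ} (ha : 0 < a) (hab : a ≤ b) :
    boltzmannMoment w e₀ 0 b ≤ boltzmannMoment w e₀ 0 a := by
  refine Summable.tsum_le_tsum (fun l => ?_) (summable_boltzmann hw hs hsum 0 (ha.trans_le hab))
    (summable_boltzmann hw hs hsum 0 ha)
  by_cases h : w l = 0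
  · simp [h]
  · have h0 := sub_nonneg.2 (hs l h)
    have h1 := hw l
    gcongr

/-- Only the level `e₀` survives as `b → ∞`; for `b ≥ 1` the terms are dominated by those at `b =
1`. -/
theorem tendsto_boltzmannMoment_zero (hw : ∀ l, 0 ≤ w l) (hs : ∀ l, w l ≠ 0 → e₀ ≤ l)
    (hsum : ∀ b : ℝ, 0 < b → Summable fun l : ℝ => w l * Real.exp (-(b * (l - e₀)))) :
    Tendsto (boltzmannMoment w e₀ 0) atTop (𝓝 (w e₀)) := by
  have h := tendsto_tsum_of_dominated_convergence (𝓕 := atTop)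
    (f := fun (b l : ℝ) => w l * (l - e₀) ^ 0 * Real.exp (-(b * (l - e₀))))
    (g := fun l => if l = e₀ then w e₀ else 0)
    (hsum 1 one_pos) (fun l => ?_) ?_
  · rw [tsum_ite_eq] at h
    exact h
  · by_cases h : w l = 0
    · have : (if l = e₀ then w e₀ else 0) = 0 := by split_ifs with h1 <;> simp_all
      simp [h, this]
    · split_ifs with h1
      · simp [h1]
      · have h0 : 0 < l - e₀ := sub_pos.2 (lt_of_le_of_ne (hs l h) (Ne.symm h1))
        have : Tendsto (fun b : ℝ => Real.exp (-(b * (l - e₀)))) atTop (𝓝 0) :=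
          Real.tendsto_exp_neg_atTop_nhds_zero.comp (tendsto_id.atTop_mul_const h0)
        have := this.const_mul (w l * (l - e₀) ^ 0)
        rwa [mul_zero] at this
  · filter_upwards [eventually_ge_atTop 1] with b hb l
    rw [Real.norm_of_nonneg (boltzmann_term_nonneg hw hs _ _ _)]
    by_cases h : w l = 0
    · simp [h]
    · have h0 := sub_nonneg.2 (hs l h)
      have h1 := hw l
      rw [pow_zero, mul_one]
      gcongr

/-- The boundary term of the integration by parts vanishes at zero temperature. With `x = b (l -
e₀)`, the factor `x e^{-x}` tends to zero off the ground level, is zero on it, and is at most `2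
e^{-x/2}`. -/
theorem tendsto_mul_boltzmannMoment_one (hw : ∀ l, 0 ≤ w l) (hs : ∀ l, w l ≠ 0 → e₀ ≤ l)
    (hsum : ∀ b : ℝ, 0 < b → Summable fun l : ℝ => w l * Real.exp (-(b * (l - e₀)))) :
    Tendsto (fun b => b * boltzmannMoment w e₀ 1 b) atTop (𝓝 0) := by
  have h := tendsto_tsum_of_dominated_convergence (𝓕 := atTop)
    (f := fun (b l : ℝ) => b * (w l * (l - e₀) ^ 1 * Real.exp (-(b * (l - e₀)))))
    (g := fun l => 0) ((hsum (1 / 2) (by norm_num)).mul_left 2) (fun l => ?_) ?_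
  · simpa [boltzmannMoment, tsum_mul_left] using h
  · by_cases h : w l = 0
    · simp [h]
    · rcases (sub_nonneg.2 (hs l h)).eq_or_lt with h0 | h0
      · simp [← h0]
      · have := (Real.tendsto_pow_mul_exp_neg_atTop_nhds_zero 1).comp
          (tendsto_id.atTop_mul_const h0)
        have := this.const_mul (w l)
        rw [mul_zero] at this
        refine this.congr fun b => ?_
        simp only [Function.comp, id, pow_one]
        ring
  · filter_upwards [eventually_ge_atTop 1] with b hb l
    have hb0 : 0 ≤ b := by linarith
    rw [Real.norm_of_nonneg (mul_nonneg hb0 (boltzmann_term_nonneg hw hs _ _ _))]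
    by_cases h : w l = 0
    · simp [h]
    · have h0 := sub_nonneg.2 (hs l h)
      have h1 := hw l
      have h2 := pow_mul_exp_le (x := b * (l - e₀)) one_pos (by positivity) 1
      have h3 : Real.exp (-(1 / 2 * (b * (l - e₀)))) ≤ Real.exp (-(1 / 2 * (l - e₀))) := by
        apply Real.exp_le_exp.2
        nlinarith
      rw [Nat.factorial_one, Nat.cast_one, one_mul, pow_one, pow_one, div_one, one_mul] at h2
      have h4 := mul_le_mul_of_nonneg_left (h2.trans (mul_le_mul_of_nonneg_left h3 two_pos.le)) h1
      rw [pow_one]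
      linarith

end Boltzmann

/-! ### From a specific heat bound to a bound on the partition function. -/

section Comparison

open Filter Topology

/-- The differentiated function equals `c` at `t = T₀` and serves as an explicit upper primitive, so
no integral with the weight `t ^ (-ν)` has to be evaluated. -/
theorem hasDerivAt_comparison {c a T₀ t : ℝ} (hT : 0 < T₀) (ht : 0 < t) :
    HasDerivAt (fun t : ℝ => c * (T₀ / t) ^ a * Real.exp (-(a * (T₀ / t - 1))))
      (c * a * (T₀ / t) ^ (a - 1) * (T₀ / t - 1) * Real.exp (-(a * (T₀ / t - 1))) * (T₀ / t ^ 2))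
      t := by
  have hx : 0 < T₀ / t := div_pos hT ht
  have h0 : HasDerivAt (fun t : ℝ => T₀ / t) (-(T₀ / t ^ 2)) t := by
    have := (hasDerivAt_inv ht.ne').const_mul T₀
    simpa [div_eq_mul_inv] using this
  have h1 := (h0.rpow_const (p := a) (Or.inl hx.ne')).const_mul c
  have h2 : HasDerivAt (fun t : ℝ => Real.exp (-(a * (T₀ / t - 1)))) _ t :=
    ((h0.sub_const 1).const_mul a).fun_neg.exp
  refine (h1.mul h2).congr_deriv ?_
  have : (T₀ / t) ^ a = (T₀ / t) ^ (a - 1) * (T₀ / t) := by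
    rw [Real.rpow_sub_one hx.ne', div_mul_cancel₀ _ hx.ne']
  rw [this]
  ring

/-- With `x = T₀ / t ≥ 1` the two sides are a common nonnegative factor times `x ^ ν` and `x ^ (Δ /
T₀ + 1)`. -/
theorem comparison_le {K Δ ν T₀ t : ℝ} (hK : 0 ≤ K) (hΔ : 0 < Δ) (hT : 0 < T₀)
    (ht : 0 < t) (htT : t ≤ T₀) (hν : ν ≤ Δ / T₀ + 1) :
    K * t ^ (-ν) * Real.exp (-Δ / t) * (1 / t - 1 / T₀) ≤
      (K / Δ * T₀ ^ (1 - ν) * Real.exp (-(Δ / T₀))) * (Δ / T₀) * (T₀ / t) ^ (Δ / T₀ - 1) *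
        (T₀ / t - 1) * Real.exp (-(Δ / T₀ * (T₀ / t - 1))) * (T₀ / t ^ 2) := by
  obtain ⟨x, hx, rfl⟩ : ∃ x : ℝ, 1 ≤ x ∧ t = T₀ / x :=
    ⟨T₀ / t, (one_le_div ht).2 htT, by field_simp⟩
  have hx0 : 0 < x := by linarith
  have e1 : T₀ / (T₀ / x) = x := by field_simp
  have e2 : (T₀ / x) ^ (-ν) = T₀ ^ (-ν) * x ^ ν := by
    rw [Real.div_rpow hT.le hx0.le, Real.rpow_neg hx0.le, div_inv_eq_mul]
  have e3 : Real.exp (-(Δ / T₀)) * Real.exp (-(Δ / T₀ * (x - 1))) = Real.exp (-Δ / (T₀ / x)) := by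
    rw [← Real.exp_add]; congr 1; field_simp; ring
  have e4 : x ^ ν ≤ x ^ (Δ / T₀ - 1) * x ^ 2 := by
    rw [← Real.rpow_natCast x 2, ← Real.rpow_add hx0]
    exact Real.rpow_le_rpow_of_exponent_le hx (by push_cast; linarith)
  have e5 : T₀ ^ (1 - ν) = T₀ ^ (-ν) * T₀ := by
    rw [← Real.rpow_add_one hT.ne']; congr 1; ring
  rw [e1, e2, e5]
  have lhs : K * (T₀ ^ (-ν) * x ^ ν) * Real.exp (-Δ / (T₀ / x)) * (1 / (T₀ / x) - 1 / T₀) =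
      (K * T₀ ^ (-ν) * Real.exp (-Δ / (T₀ / x)) * (x - 1) / T₀) * x ^ ν := by
    field_simp
  have rhs : (K / Δ * (T₀ ^ (-ν) * T₀) * Real.exp (-(Δ / T₀))) * (Δ / T₀) * x ^ (Δ / T₀ - 1) *
        (x - 1) * Real.exp (-(Δ / T₀ * (x - 1))) * (T₀ / (T₀ / x) ^ 2) =
      (K * T₀ ^ (-ν) * Real.exp (-Δ / (T₀ / x)) * (x - 1) / T₀) * (x ^ (Δ / T₀ - 1) * x ^ 2) := by
    rw [← e3]; field_simp
  rw [lhs, rhs]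
  have := sub_nonneg.2 hx
  gcongr

/-- Integrating a bound on the derivative of the mean energy twice: the excess of the partition
function over the ground state degeneracy. -/
theorem log_boltzmannMoment_le {w : ℝ → ℝ} {e₀ : ℝ} (hw : ∀ l, 0 ≤ w l)
    (hs : ∀ l, w l ≠ 0 → e₀ ≤ l)
    (hsum : ∀ b : ℝ, 0 < b → Summable fun l : ℝ => w l * Real.exp (-(b * (l - e₀))))
    (h0 : 0 < w e₀) {K Δ ν T₀ : ℝ} (hK : 0 ≤ K) (hΔ : 0 < Δ) (hT : 0 < T₀)
    (hν : ν ≤ Δ / T₀ + 1)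
    (hder : ∀ t : ℝ, 0 < t → t ≤ T₀ →
      deriv (fun t => boltzmannMoment w e₀ 1 (1 / t) / boltzmannMoment w e₀ 0 (1 / t)) t
        ≤ K * t ^ (-ν) * Real.exp (-Δ / t)) :
    Real.log (boltzmannMoment w e₀ 0 (1 / T₀) / w e₀) ≤
      K / Δ * T₀ ^ (1 - ν) * Real.exp (-(Δ / T₀)) := by
  set c := K / Δ * T₀ ^ (1 - ν) * Real.exp (-(Δ / T₀)) with hc
  have hc0 : 0 ≤ c := by positivity
  set Z := boltzmannMoment w e₀ with hZ
  have Zpos : ∀ b : ℝ, 0 < b → 0 < Z 0 b := fun b hb =>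
    h0.trans_le (le_boltzmannMoment_zero hw hs hsum hb)
  have hinv : ∀ t : ℝ, 0 < t → HasDerivAt (fun t : ℝ => 1 / t) (-(1 / t ^ 2)) t := fun t ht => by
    simpa [one_div] using hasDerivAt_inv ht.ne'
  have dZ : ∀ m, ∀ t : ℝ, 0 < t → HasDerivAt (fun t => Z m (1 / t))
      (-Z (m + 1) (1 / t) * -(1 / t ^ 2)) t := fun m t ht =>
    (hasDerivAt_boltzmannMoment hw hs hsum m (one_div_pos.2 ht)).comp t (hinv t ht)
  set G : ℝ → ℝ := fun t => Z 1 (1 / t) / Z 0 (1 / t) with hG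
  have dG : ∀ t : ℝ, 0 < t → HasDerivAt G (deriv G t) t := fun t ht =>
    ((dZ 1 t ht).div (dZ 0 t ht) (Zpos _ (one_div_pos.2 ht)).ne').differentiableAt.hasDerivAt
  have dL : ∀ t : ℝ, 0 < t → HasDerivAt (fun t => Real.log (Z 0 (1 / t))) (G t / t ^ 2) t := by
    intro t ht
    convert (dZ 0 t ht).log (Zpos _ (one_div_pos.2 ht)).ne' using 1
    simp only [hG, zero_add]
    ring
  set Ψ : ℝ → ℝ := fun t => c * (T₀ / t) ^ (Δ / T₀) * Real.exp (-(Δ / T₀ * (T₀ / t - 1))) with hΨ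
  -- The two terms `G t / t ^ 2` cancel in the derivative of the first two summands, leaving `G' (1
  -- / t - 1 / T₀)`; subtracting the comparison function makes `F` antitone.
  set F : ℝ → ℝ := fun t => Real.log (Z 0 (1 / t)) + G t * (1 / t - 1 / T₀) - Ψ t with hF
  have dF : ∀ t : ℝ, 0 < t → HasDerivAt F (G t / t ^ 2 +
      (deriv G t * (1 / t - 1 / T₀) + G t * (-(1 / t ^ 2))) -
      c * (Δ / T₀) * (T₀ / t) ^ (Δ / T₀ - 1) * (T₀ / t - 1) *
        Real.exp (-(Δ / T₀ * (T₀ / t - 1))) * (T₀ / t ^ 2)) t := fun t ht =>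
    ((dL t ht).add ((dG t ht).mul ((hinv t ht).sub_const _))).sub (hasDerivAt_comparison hT ht)
  have anti : AntitoneOn F (Set.Ioc 0 T₀) := by
    refine antitoneOn_of_deriv_nonpos (convex_Ioc 0 T₀)
      (fun t ht => (dF t ht.1).continuousAt.continuousWithinAt) ?_ ?_
    · intro t ht
      rw [interior_Ioc] at ht
      exact (dF t ht.1).differentiableAt.differentiableWithinAt
    · intro t ht
      rw [interior_Ioc] at ht
      rw [(dF t ht.1).deriv]
      have h1 := comparison_le hK hΔ hT ht.1 ht.2.le hν
      have h2 := mul_le_mul_of_nonneg_right (hder t ht.1 ht.2.le)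
        (sub_nonneg.2 (one_div_le_one_div_of_le ht.1 ht.2.le))
      rw [← hc] at h1
      have h3 : G t / t ^ 2 = G t * (1 / t ^ 2) := by ring
      rw [h3]
      linarith
  have lim : Tendsto (fun b => Real.log (Z 0 b) + b * Z 1 b / Z 0 b) atTop
      (𝓝 (Real.log (w e₀) + 0 / w e₀)) :=
    ((tendsto_boltzmannMoment_zero hw hs hsum).log h0.ne').add
      ((tendsto_mul_boltzmannMoment_one hw hs hsum).div
        (tendsto_boltzmannMoment_zero hw hs hsum) h0.ne')
  have hle : F T₀ ≤ Real.log (w e₀) + 0 / w e₀ := by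
    refine ge_of_tendsto lim ?_
    filter_upwards [eventually_ge_atTop (1 / T₀), eventually_gt_atTop 0] with b hb hb0
    have ht : (1 / b) ∈ Set.Ioc 0 T₀ :=
      ⟨one_div_pos.2 hb0, by rw [one_div_le hb0 hT]; exact hb⟩
    refine (anti ht ⟨hT, le_rfl⟩ ht.2).trans ?_
    -- `F (1 / b)` differs from the convergent quantity in `lim` by `-Ψ` and `-G / T₀`, both
    -- nonpositive, so neither needs a limit of its own.
    have hψ : 0 ≤ Ψ (1 / b) := by
      have := ht.1
      positivity
    have hg : 0 ≤ Z 1 b / Z 0 b * (1 / T₀) := by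
      have := boltzmannMoment_nonneg hw hs 1 b
      have := Zpos b hb0
      positivity
    simp only [hF, hG, one_div_one_div]
    have : b * Z 1 b / Z 0 b = Z 1 b / Z 0 b * b := by ring
    rw [this]
    nlinarith
  rw [Real.log_div (Zpos _ (one_div_pos.2 hT)).ne' h0.ne']
  have : F T₀ = Real.log (Z 0 (1 / T₀)) - c := by
    simp [hF, hΨ, div_self hT.ne']
  linarith [show (0:ℝ) / w e₀ = 0 by simp]

end Comparison

end ThermalLattice

namespace ThermalLattice

/-! ### Eigenspaces and functions of a thermal Hamiltonian. -/

section Spectral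

variable {E : Type*} [NormedAddCommGroup E] [InnerProductSpace ℂ E] [CompleteSpace E]
  {H : E →ₗ.[ℂ] E}

omit [CompleteSpace E] in
theorem mem_eigenspace {lam : ℝ} {x : E} :
    x ∈ eigenspace H lam ↔ ∃ hx : x ∈ H.domain, H ⟨x, hx⟩ = (lam : ℂ) • x := by
  simp only [eigenspace, Submodule.mem_map, LinearMap.mem_ker, LinearMap.sub_apply,
    LinearMap.smul_apply, Submodule.subtype_apply, sub_eq_zero]
  constructor
  · rintro ⟨y, hy, rfl⟩
    exact ⟨y.2, hy⟩
  · rintro ⟨hx, h⟩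
    exact ⟨⟨x, hx⟩, h, rfl⟩

theorem inner_eq_zero_of_mem_eigenspace (hH : IsSelfAdjoint H) {a b : ℝ} (hab : a ≠ b) {x y : E}
    (hx : x ∈ eigenspace H a) (hy : y ∈ eigenspace H b) : inner ℂ x y = 0 := by
  obtain ⟨hx1, hx2⟩ := mem_eigenspace.1 hx
  obtain ⟨hy1, hy2⟩ := mem_eigenspace.1 hy
  have h : H.IsFormalAdjoint H := by
    have := LinearPMap.adjoint_isFormalAdjoint (T := H) hH.dense_domain
    rwa [LinearPMap.isSelfAdjoint_def.1 hH] at this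
  have := h ⟨x, hx1⟩ ⟨y, hy1⟩
  rw [hx2, hy2, inner_smul_left, inner_smul_right, Complex.conj_ofReal] at this
  have h2 : ((a : ℂ) - b) * inner ℂ x y = 0 := by
    rw [sub_mul]; exact sub_eq_zero.2 this
  rcases mul_eq_zero.1 h2 with h3 | h3
  · exact absurd (by exact_mod_cast sub_eq_zero.1 h3) hab
  · exact h3

theorem IsThermalHamiltonian.topologicalClosure_eigenspace (hH : IsThermalHamiltonian H)
    (lam : ℝ) : (eigenspace H lam).topologicalClosure = eigenspace H lam := by
  have := hH.finite lam
  exact (Submodule.closed_of_finiteDimensional _).submodule_topologicalClosure_eq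

theorem IsThermalHamiltonian.spectralProj_mem (hH : IsThermalHamiltonian H) (lam : ℝ) (x : E) :
    spectralProj H lam x ∈ eigenspace H lam := by
  rw [← hH.topologicalClosure_eigenspace]
  exact Submodule.starProjection_apply_mem _ x

theorem IsThermalHamiltonian.spectralProj_eq_self (hH : IsThermalHamiltonian H) {lam : ℝ} {x : E}
    (hx : x ∈ eigenspace H lam) : spectralProj H lam x = x := by
  rw [← hH.topologicalClosure_eigenspace] at hx
  exact Submodule.starProjection_eq_self_iff.2 hx

theorem IsThermalHamiltonian.spectralProj_eq_zero (hH : IsThermalHamiltonian H) {a b : ℝ}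
    (hab : a ≠ b) {x : E} (hx : x ∈ eigenspace H b) : spectralProj H a x = 0 := by
  refine (Submodule.starProjection_apply_eq_zero_iff _).2 ?_
  rw [hH.topologicalClosure_eigenspace, Submodule.mem_orthogonal]
  exact fun u hu => inner_eq_zero_of_mem_eigenspace hH.selfAdjoint hab hu hx

theorem IsThermalHamiltonian.spectralProj_mul (hH : IsThermalHamiltonian H) (a b : ℝ) :
    spectralProj H a * spectralProj H b = if a = b then spectralProj H a else 0 := by
  ext x
  split_ifs with h
  · subst h
    exact hH.spectralProj_eq_self (hH.spectralProj_mem a x)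
  · exact hH.spectralProj_eq_zero h (hH.spectralProj_mem b x)

theorem inner_spectralProj (lam : ℝ) (x : E) :
    inner ℂ x (spectralProj H lam x) = ((‖spectralProj H lam x‖ ^ 2 : ℝ) : ℂ) := by
  have h : spectralProj H lam (spectralProj H lam x) = spectralProj H lam x :=
    Submodule.starProjection_eq_self_iff.2 (Submodule.starProjection_apply_mem _ x)
  have h2 : inner ℂ x (spectralProj H lam (spectralProj H lam x)) =
      inner ℂ (spectralProj H lam x) (spectralProj H lam x) :=
    ((Submodule.inner_starProjection_left_eq_right _ _ _)).symm
  rw [h] at h2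
  rw [h2, inner_self_eq_norm_sq_to_K]
  norm_cast

theorem norm_spectralProj_le_one (lam : ℝ) : ‖spectralProj H lam‖ ≤ 1 :=
  Submodule.starProjection_norm_le _

theorem isPositive_spectralProj (lam : ℝ) : (spectralProj H lam).IsPositive :=
  ContinuousLinearMap.IsPositive.of_isStarProjection isStarProjection_starProjection

theorem IsThermalHamiltonian.degeneracy_eq_zero_iff (hH : IsThermalHamiltonian H) {lam : ℝ} :
    degeneracy H lam = 0 ↔ eigenspace H lam = ⊥ := by
  have := hH.finite lam
  exact Submodule.finrank_eq_zero

/-- Crude, but it makes the degeneracy-weighted sum of coefficients dominate the spectral series in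
operator norm; it also kills the terms off the spectrum. -/
theorem IsThermalHamiltonian.norm_spectralProj_le (hH : IsThermalHamiltonian H) (lam : ℝ) :
    ‖spectralProj H lam‖ ≤ degeneracy H lam := by
  by_cases h : degeneracy H lam = 0
  · have : spectralProj H lam = 0 := by
      ext x
      have := hH.spectralProj_mem lam x
      rw [hH.degeneracy_eq_zero_iff.1 h] at this
      simpa using this
    simp [this]
  · exact (norm_spectralProj_le_one lam).trans
      (by exact_mod_cast Nat.one_le_iff_ne_zero.2 h)

/-- Bessel's inequality for the trace of a spectral projection. -/
theorem IsThermalHamiltonian.sum_norm_spectralProj_le (hH : IsThermalHamiltonian H) (lam : ℝ)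
    {m : ℕ} {v : Fin m → E} (hv : Orthonormal ℂ v) :
    ∑ i, ‖spectralProj H lam (v i)‖ ^ 2 ≤ degeneracy H lam := by
  have := hH.finite lam
  let b := stdOrthonormalBasis ℂ (eigenspace H lam)
  have h1 : ∀ x : E, ‖spectralProj H lam x‖ ^ 2 = ∑ j, ‖inner ℂ x (b j : E)‖ ^ 2 := by
    intro x
    have hp := hH.spectralProj_mem lam x
    have h2 := b.sum_sq_norm_inner_right ⟨_, hp⟩
    rw [Submodule.coe_norm] at h2
    rw [← h2]
    refine Finset.sum_congr rfl fun j _ => ?_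
    congr 1
    rw [Submodule.coe_inner, ← inner_conj_symm x, RCLike.norm_conj]
    congr 1
    have h3 : inner ℂ (spectralProj H lam (b j : E)) x =
        inner ℂ ((b j : E)) (spectralProj H lam x) :=
      Submodule.inner_starProjection_left_eq_right _ _ _
    rw [hH.spectralProj_eq_self (b j).2] at h3
    exact h3.symm
  simp_rw [h1]
  rw [Finset.sum_comm]
  calc ∑ j, ∑ i, ‖inner ℂ (v i) (b j : E)‖ ^ 2 ≤ ∑ j, ‖(b j : E)‖ ^ 2 :=
        Finset.sum_le_sum fun j _ => hv.sum_inner_products_le _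
    _ = degeneracy H lam := by
        have : ∀ j, ‖(b j : E)‖ = 1 := fun j => by
          rw [← Submodule.coe_norm]; exact b.orthonormal.1 j
        simp [this, degeneracy]

/-- A combination `∑ a(lam) P_lam` of the spectral projections. -/
noncomputable def spectralSum (H : E →ₗ.[ℂ] E) (a : ℝ → ℝ) : E →L[ℂ] E :=
  ∑' lam : ℝ, ((a lam : ℝ) : ℂ) • spectralProj H lam

variable {a : ℝ → ℝ}

theorem IsThermalHamiltonian.summable_spectralSum (hH : IsThermalHamiltonian H)
    (ha : ∀ l, 0 ≤ a l) (hs : Summable fun l => a l * degeneracy H l) :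
    Summable fun lam : ℝ => ((a lam : ℝ) : ℂ) • spectralProj H lam := by
  refine Summable.of_norm_bounded hs fun l => ?_
  rw [norm_smul, Complex.norm_real, Real.norm_of_nonneg (ha l)]
  exact mul_le_mul_of_nonneg_left (hH.norm_spectralProj_le l) (ha l)

theorem IsThermalHamiltonian.hasSum_inner_spectralSum (hH : IsThermalHamiltonian H)
    (ha : ∀ l, 0 ≤ a l) (hs : Summable fun l => a l * degeneracy H l) (x : E) :
    HasSum (fun l => ((a l * ‖spectralProj H l x‖ ^ 2 : ℝ) : ℂ))
      (inner ℂ x (spectralSum H a x)) := by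
  have h1 := (hH.summable_spectralSum ha hs).hasSum
  have h2 := (innerSL ℂ x).hasSum ((ContinuousLinearMap.apply ℂ E x).hasSum h1)
  have h3 : ∀ l, ((a l * ‖spectralProj H l x‖ ^ 2 : ℝ) : ℂ) =
      inner ℂ x (((a l : ℝ) : ℂ) • spectralProj H l x) := fun l => by
    rw [inner_smul_right, inner_spectralProj, Complex.ofReal_mul]
  rw [funext h3]
  exact h2

theorem IsThermalHamiltonian.hasSum_re_inner_spectralSum (hH : IsThermalHamiltonian H)
    (ha : ∀ l, 0 ≤ a l) (hs : Summable fun l => a l * degeneracy H l) (x : E) :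
    HasSum (fun l => a l * ‖spectralProj H l x‖ ^ 2) (inner ℂ x (spectralSum H a x)).re :=
  Complex.hasSum_re (hH.hasSum_inner_spectralSum ha hs x)

theorem IsThermalHamiltonian.isPositive_spectralSum (hH : IsThermalHamiltonian H)
    (ha : ∀ l, 0 ≤ a l) (hs : Summable fun l => a l * degeneracy H l) :
    (spectralSum H a).IsPositive := by
  rw [ContinuousLinearMap.isPositive_iff_complex]
  intro x
  have h1 := hH.hasSum_inner_spectralSum ha hs x
  have h2 := hH.hasSum_re_inner_spectralSum ha hs x
  have h3 := h1.unique (Complex.hasSum_ofReal.2 h2)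
  have h4 : 0 ≤ (inner ℂ x (spectralSum H a x)).re :=
    h2.nonneg fun l => mul_nonneg (ha l) (sq_nonneg _)
  rw [← inner_conj_symm, h3]
  simpa using h4

/-- Bessel's inequality applied level by level, after interchanging the finite sum with the spectral
series. -/
theorem IsThermalHamiltonian.sum_inner_spectralSum_le (hH : IsThermalHamiltonian H)
    (ha : ∀ l, 0 ≤ a l) (hs : Summable fun l => a l * degeneracy H l)
    {m : ℕ} {v : Fin m → E} (hv : Orthonormal ℂ v) :
    ∑ i, (inner ℂ (v i) (spectralSum H a (v i))).re ≤ ∑' l, a l * degeneracy H l := by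
  have h := hasSum_sum (s := Finset.univ) fun i (_ : i ∈ Finset.univ) =>
    hH.hasSum_re_inner_spectralSum ha hs (v i)
  rw [← h.tsum_eq]
  refine h.summable.tsum_le_tsum (fun l => ?_) hs
  rw [← Finset.mul_sum]
  exact mul_le_mul_of_nonneg_left (hH.sum_norm_spectralProj_le l hv) (ha l)

theorem IsThermalHamiltonian.spectralSum_mul_spectralProj (hH : IsThermalHamiltonian H)
    (ha : ∀ l, 0 ≤ a l) (hs : Summable fun l => a l * degeneracy H l) (b : ℝ) :
    spectralSum H a * spectralProj H b = (a b : ℂ) • spectralProj H b := by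
  rw [spectralSum, ← (hH.summable_spectralSum ha hs).tsum_mul_right]
  rw [tsum_eq_single b]
  · rw [smul_mul_assoc, hH.spectralProj_mul, if_pos rfl]
  · intro l hl
    rw [smul_mul_assoc, hH.spectralProj_mul, if_neg hl, smul_zero]

theorem IsThermalHamiltonian.spectralProj_mul_spectralSum (hH : IsThermalHamiltonian H)
    (ha : ∀ l, 0 ≤ a l) (hs : Summable fun l => a l * degeneracy H l) (b : ℝ) :
    spectralProj H b * spectralSum H a = (a b : ℂ) • spectralProj H b := by
  rw [spectralSum, ← (hH.summable_spectralSum ha hs).tsum_mul_left]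
  rw [tsum_eq_single b]
  · rw [mul_smul_comm, hH.spectralProj_mul, if_pos rfl]
  · intro l hl
    rw [mul_smul_comm, hH.spectralProj_mul, if_neg (Ne.symm hl), smul_zero]

end Spectral

/-! ### Trace norm estimates from an explicit absolute value. -/

section TraceNorm

variable {E : Type*} [NormedAddCommGroup E] [InnerProductSpace ℂ E] [CompleteSpace E]

/-- Orthogonality removes the cross terms, so `(Q + R)² = (Q - R)²`, and the positive square root is
unique. -/
theorem abs_sub_of_mul_eq_zero {Q R : E →L[ℂ] E} (hQ : Q.IsPositive) (hR : R.IsPositive)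
    (h1 : Q * R = 0) (h2 : R * Q = 0) : CFC.abs (Q - R) = Q + R := by
  have hQs : star Q = Q := hQ.isSelfAdjoint
  have hRs : star R = R := hR.isSelfAdjoint
  refine CFC.sqrt_unique ?_ ((ContinuousLinearMap.nonneg_iff_isPositive _).2 (hQ.add hR))
  rw [star_sub, hQs, hRs]
  simp only [add_mul, mul_add, sub_mul, mul_sub, h1, h2]
  abel

theorem traceNorm_le_of_abs_eq {A Q R : E →L[ℂ] E} (h : CFC.abs A = Q + R) {c c' : ℝ}
    (hQ : ∀ (m : ℕ) (v : Fin m → E), Orthonormal ℂ v → ∑ i, (inner ℂ (v i) (Q (v i))).re ≤ c)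
    (hR : ∀ (m : ℕ) (v : Fin m → E), Orthonormal ℂ v → ∑ i, (inner ℂ (v i) (R (v i))).re ≤ c') :
    traceNorm A ≤ ENNReal.ofReal (c + c') := by
  refine iSup_le fun m => iSup_le fun v => iSup_le fun hv => ?_
  have hpos : (CFC.abs A).IsPositive :=
    (ContinuousLinearMap.nonneg_iff_isPositive _).1 (CFC.abs_nonneg A)
  have hnn : ∀ i ∈ Finset.univ, 0 ≤ (inner ℂ (v i) (CFC.abs A (v i))).re :=
    fun i _ => hpos.re_inner_nonneg_right (v i)
  rw [← ENNReal.ofReal_sum_of_nonneg hnn]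
  refine ENNReal.ofReal_le_ofReal ?_
  rw [h]
  simp only [add_apply, inner_add_right, Complex.add_re,
    Finset.sum_add_distrib]
  exact add_le_add (hQ m v hv) (hR m v hv)

theorem abs_eq_of_mul_self_eq {A P : E →L[ℂ] E} (hP : P.IsPositive) (h : P * P = star A * A) :
    CFC.abs A = P :=
  CFC.sqrt_unique h ((ContinuousLinearMap.nonneg_iff_isPositive _).2 hP)

theorem traceNorm_le_of_mul_self_eq {A P : E →L[ℂ] E} (hP : P.IsPositive)
    (h : P * P = star A * A) {c : ℝ}
    (hc : ∀ (m : ℕ) (v : Fin m → E), Orthonormal ℂ v → ∑ i, (inner ℂ (v i) (P (v i))).re ≤ c) :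
    traceNorm A ≤ ENNReal.ofReal c := by
  have := traceNorm_le_of_abs_eq (Q := P) (R := 0) (c := c) (c' := 0)
    (by rw [abs_eq_of_mul_self_eq hP h, add_zero]) hc (fun m v hv => by simp)
  rwa [add_zero] at this

theorem le_traceNorm_of_mul_self_eq {A P : E →L[ℂ] E} (hP : P.IsPositive)
    (h : P * P = star A * A) {m : ℕ} {v : Fin m → E} (hv : Orthonormal ℂ v) :
    ENNReal.ofReal (∑ i, (inner ℂ (v i) (P (v i))).re) ≤ traceNorm A := by
  refine le_trans ?_ (le_iSup_of_le m (le_iSup_of_le v (le_iSup_of_le hv le_rfl)))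
  have hnn : ∀ i ∈ Finset.univ, 0 ≤ (inner ℂ (v i) (P (v i))).re :=
    fun i _ => hP.re_inner_nonneg_right (v i)
  rw [abs_eq_of_mul_self_eq hP h, ENNReal.ofReal_sum_of_nonneg hnn]

end TraceNorm

/-! ### Distance between thermal states and the ground state. -/

section GroundState

variable {E : Type*} [NormedAddCommGroup E] [InnerProductSpace ℂ E] [CompleteSpace E]
  {H : E →ₗ.[ℂ] E}

/-- At `T = 1` every eigenvalue up to `c` contributes at least `e^{-c}` to a convergent sum. This is
what makes the infimum defining the ground energy attained. -/
theorem IsThermalHamiltonian.finite_eigenvalues_le (hH : IsThermalHamiltonian H) (c : ℝ) :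
    {lam : ℝ | eigenspace H lam ≠ ⊥ ∧ lam ≤ c}.Finite := by
  have h := (hH.summable 1 one_pos).tendsto_cofinite_zero.eventually
    (gt_mem_nhds (Real.exp_pos (-c)))
  refine (Filter.eventually_cofinite.1 h).subset ?_
  rintro l ⟨h1, h2⟩
  have h3 : 1 ≤ degeneracy H l :=
    Nat.one_le_iff_ne_zero.2 fun h => h1 (hH.degeneracy_eq_zero_iff.1 h)
  have h4 : (1 : ℝ) ≤ degeneracy H l := by exact_mod_cast h3
  have h5 : Real.exp (-c) ≤ Real.exp (-l / 1) := Real.exp_le_exp.2 (by linarith)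
  simp only [Set.mem_ofPred_eq, not_lt]
  nlinarith [Real.exp_pos (-l / 1)]

theorem IsThermalHamiltonian.exists_eigenspace_ne_bot [Nontrivial E]
    (hH : IsThermalHamiltonian H) : ∃ lam, eigenspace H lam ≠ ⊥ := by
  by_contra! h
  have := hH.total
  simp only [h, iSup_bot] at this
  rw [IsClosed.submodule_topologicalClosure_eq (by simp)] at this
  exact bot_ne_top this

theorem IsThermalHamiltonian.isLeast_groundEnergy [Nontrivial E] (hH : IsThermalHamiltonian H) :
    IsLeast {lam : ℝ | eigenspace H lam ≠ ⊥} (groundEnergy H) := by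
  obtain ⟨c, hc⟩ := hH.exists_eigenspace_ne_bot
  have hfin := hH.finite_eigenvalues_le c
  obtain ⟨l, hl, hmin⟩ := hfin.exists_minimal ⟨c, hc, le_rfl⟩
  have hle : IsLeast {lam : ℝ | eigenspace H lam ≠ ⊥} l := by
    refine ⟨hl.1, fun x hx => ?_⟩
    by_contra! hxl
    exact absurd (hmin ⟨hx, hxl.le.trans hl.2⟩ hxl.le) (not_le.2 hxl)
  rw [groundEnergy, hle.csInf_eq]
  exact hle

variable [Nontrivial E] (hH : IsThermalHamiltonian H)
include hH

theorem IsThermalHamiltonian.degeneracy_groundEnergy_pos : 0 < degeneracy H (groundEnergy H) :=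
  Nat.pos_of_ne_zero fun h => hH.isLeast_groundEnergy.1 (hH.degeneracy_eq_zero_iff.1 h)

theorem IsThermalHamiltonian.groundEnergy_le {l : ℝ} (h : (degeneracy H l : ℝ) ≠ 0) :
    groundEnergy H ≤ l :=
  hH.isLeast_groundEnergy.2 fun h1 => h (by exact_mod_cast hH.degeneracy_eq_zero_iff.2 h1)

omit [Nontrivial E] in
theorem IsThermalHamiltonian.summable_shifted {b : ℝ} (hb : 0 < b) :
    Summable fun l : ℝ => (degeneracy H l : ℝ) * Real.exp (-(b * (l - groundEnergy H))) := by
  refine ((hH.summable (1 / b) (one_div_pos.2 hb)).mul_right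
    (Real.exp (b * groundEnergy H))).congr fun l => ?_
  rw [mul_assoc, ← Real.exp_add]
  congr 2
  field_simp
  ring

omit [CompleteSpace E] [Nontrivial E] hH in
theorem partitionFn_eq {T : ℝ} :
    partitionFn H T = Real.exp (-groundEnergy H / T) *
      boltzmannMoment (fun l => degeneracy H l) (groundEnergy H) 0 (1 / T) := by
  rw [partitionFn, boltzmannMoment, ← tsum_mul_left]
  refine tsum_congr fun l => ?_
  rw [pow_zero, mul_one, mul_left_comm, ← Real.exp_add]
  congr 2
  ring

theorem IsThermalHamiltonian.boltzmannMoment_zero_pos {b : ℝ} (hb : 0 < b) :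
    0 < boltzmannMoment (fun l => degeneracy H l) (groundEnergy H) 0 b :=
  lt_of_lt_of_le (by exact_mod_cast hH.degeneracy_groundEnergy_pos)
    (le_boltzmannMoment_zero (fun _ => Nat.cast_nonneg _) (fun _ => hH.groundEnergy_le)
      (fun _ => hH.summable_shifted) hb)

theorem IsThermalHamiltonian.partitionFn_pos {T : ℝ} (hT : 0 < T) : 0 < partitionFn H T := by
  rw [partitionFn_eq]
  exact mul_pos (Real.exp_pos _) (hH.boltzmannMoment_zero_pos (one_div_pos.2 hT))

/-- The common factor `e^{-e₀/T}` cancels in the quotient; the additive ground energy then drops out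
of the specific heat. -/
theorem IsThermalHamiltonian.meanEnergy_eq {T : ℝ} (hT : 0 < T) :
    meanEnergy H T = groundEnergy H +
      boltzmannMoment (fun l => degeneracy H l) (groundEnergy H) 1 (1 / T) /
      boltzmannMoment (fun l => degeneracy H l) (groundEnergy H) 0 (1 / T) := by
  have hb : 0 < 1 / T := one_div_pos.2 hT
  have h0 := summable_boltzmann (w := fun l => degeneracy H l) (fun _ => Nat.cast_nonneg _)
    (fun _ => hH.groundEnergy_le) (fun _ => hH.summable_shifted) 0 hb
  have h1 := summable_boltzmann (w := fun l => degeneracy H l) (fun _ => Nat.cast_nonneg _)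
    (fun _ => hH.groundEnergy_le) (fun _ => hH.summable_shifted) 1 hb
  have hnum : ∑' l : ℝ, l * ((degeneracy H l : ℝ) * Real.exp (-l / T)) =
      Real.exp (-groundEnergy H / T) *
        (groundEnergy H * boltzmannMoment (fun l => degeneracy H l) (groundEnergy H) 0 (1 / T) +
        boltzmannMoment (fun l => degeneracy H l) (groundEnergy H) 1 (1 / T)) := by
    rw [boltzmannMoment, boltzmannMoment, ← tsum_mul_left,
      ← (h0.mul_left _).tsum_add h1, ← tsum_mul_left]
    refine tsum_congr fun l => ?_
    have : Real.exp (-l / T) = Real.exp (-groundEnergy H / T) *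
        Real.exp (-(1 / T * (l - groundEnergy H))) := by
      rw [← Real.exp_add]; congr 1; ring
    rw [this]
    ring
  have hZ := hH.boltzmannMoment_zero_pos hb
  rw [meanEnergy, hnum, partitionFn_eq, mul_div_mul_left _ _ (Real.exp_pos _).ne', add_div,
    mul_div_cancel_right₀ _ hZ.ne']

/-- The distance of a thermal state from the ground state is twice the weight of the excited
states. -/
theorem IsThermalHamiltonian.traceNorm_thermalState_sub_le {T : ℝ} (hT : 0 < T) :
    traceNorm (thermalState H T - groundState H) ≤
      ENNReal.ofReal (2 * (1 - degeneracy H (groundEnergy H) /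
        boltzmannMoment (fun l => degeneracy H l) (groundEnergy H) 0 (1 / T))) := by
  set e := groundEnergy H with he
  set g : ℝ := ((degeneracy H e : ℕ) : ℝ) with hg
  set Z := boltzmannMoment (fun l => degeneracy H l) e 0 (1 / T) with hZ
  have hg0 : 0 < g := Nat.cast_pos.2 hH.degeneracy_groundEnergy_pos
  have hZ0 : 0 < Z := hH.boltzmannMoment_zero_pos (one_div_pos.2 hT)
  have hgZ : g ≤ Z := le_boltzmannMoment_zero (w := fun l => (degeneracy H l : ℝ))
    (fun _ => Nat.cast_nonneg _) (fun _ => hH.groundEnergy_le)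
      (fun _ => hH.summable_shifted) (one_div_pos.2 hT)
  set p : ℝ → ℝ := fun l => Real.exp (-l / T) / partitionFn H T with hp
  have hpe : p e = 1 / Z := by
    rw [hp]
    simp only
    rw [partitionFn_eq, ← he, ← hZ]
    field_simp
  have hp0 : ∀ l, 0 ≤ p l := fun l => div_nonneg (Real.exp_pos _).le (hH.partitionFn_pos hT).le
  have hps : HasSum (fun l => p l * degeneracy H l) 1 := by
    have := (hH.summable T hT).hasSum.div_const (partitionFn H T)
    rw [← partitionFn, div_self (hH.partitionFn_pos hT).ne'] at this
    rw [show (fun l => p l * degeneracy H l) = fun l => (degeneracy H l : ℝ) * Real.exp (-l / T) /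
      partitionFn H T from funext fun l => by simp only [hp]; ring]
    exact this
  -- The Boltzmann probabilities of the excited levels alone; their total weight is `1 - g / Z`.
  set a : ℝ → ℝ := Function.update p e 0 with ha
  have ha0 : ∀ l, 0 ≤ a l := fun l => by
    by_cases h : l = e
    · simp [ha, h]
    · simp [ha, h, hp0 l]
  have has : HasSum (fun l => a l * degeneracy H l) (1 - g / Z) := by
    have := hps.update e 0
    rw [show (fun l => a l * degeneracy H l) =
      Function.update (fun l => p l * (degeneracy H l : ℝ)) e 0 from funext fun l => by
        by_cases h : l = e
        · simp [ha, h]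
        · simp [ha, h], show 1 - g / Z = 0 - p e * degeneracy H e + 1 by rw [hpe]; ring]
    exact this
  have hrho : thermalState H T = spectralSum H a + ((p e : ℝ) : ℂ) • spectralProj H e := by
    have h1 := (hH.summable_spectralSum hp0 hps.summable).hasSum
    have h2 := h1.update e 0
    have h3 : spectralSum H a = 0 - ((p e : ℝ) : ℂ) • spectralProj H e + thermalState H T := by
      rw [spectralSum, show (fun l => ((a l : ℝ) : ℂ) • spectralProj H l) =
        Function.update (fun l => ((p l : ℝ) : ℂ) • spectralProj H l) e 0 from funext fun l => by
          by_cases h : l = e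
          · simp [ha, h]
          · simp [ha, h]]
      exact h2.tsum_eq
    rw [h3]
    abel
  -- A difference of two positive operators with orthogonal supports. The second has trace `g (1 / g
  -- - 1 / Z)`, again `1 - g / Z`.
  have hdiff : thermalState H T - groundState H =
      spectralSum H a - ((1 / g - 1 / Z : ℝ) : ℂ) • spectralProj H e := by
    rw [hrho, groundState, hpe, ← he]
    push_cast
    rw [sub_smul, one_div (g : ℂ)]
    simp only [hg, Complex.ofReal_natCast]
    abel
  have hc : 0 ≤ 1 / g - 1 / Z := sub_nonneg.2 (one_div_le_one_div_of_le hg0 hgZ)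
  have habs : CFC.abs (thermalState H T - groundState H) =
      spectralSum H a + ((1 / g - 1 / Z : ℝ) : ℂ) • spectralProj H e := by
    rw [hdiff]
    refine abs_sub_of_mul_eq_zero (hH.isPositive_spectralSum ha0 has.summable)
      ((isPositive_spectralProj e).smul_of_nonneg (by exact_mod_cast hc)) ?_ ?_
    · rw [mul_smul_comm, hH.spectralSum_mul_spectralProj ha0 has.summable]
      simp [ha]
    · rw [smul_mul_assoc, hH.spectralProj_mul_spectralSum ha0 has.summable]
      simp [ha]
  have := traceNorm_le_of_abs_eq habs (c := 1 - g / Z) (c' := 1 - g / Z) ?_ ?_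
  · rwa [two_mul]
  · intro m v hv
    rw [← has.tsum_eq]
    exact hH.sum_inner_spectralSum_le ha0 has.summable hv
  · intro m v hv
    have h1 : ∀ i, (inner ℂ (v i) ((((1 / g - 1 / Z : ℝ) : ℂ) • spectralProj H e) (v i))).re =
        (1 / g - 1 / Z) * ‖spectralProj H e (v i)‖ ^ 2 := by
      intro i
      rw [smul_apply, inner_smul_right, inner_spectralProj,
        ← Complex.ofReal_mul, Complex.ofReal_re]
    simp_rw [h1]
    rw [← Finset.mul_sum]
    have h2 := mul_le_mul_of_nonneg_left (hH.sum_norm_spectralProj_le e hv) hc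
    refine h2.trans (le_of_eq ?_)
    rw [← hg]
    field_simp

/-- The thermal states at low temperature approximate the ground state, given a bound on the
specific heat capacity. -/
theorem IsThermalHamiltonian.traceNorm_thermalState_sub_le_etaErr {d n : ℕ} {k Δ ν δ : ℝ}
    (hn : 2 ≤ n) (hk : 0 < k) (hΔ : 0 < Δ) (hδ : 0 < δ) (hδ1 : δ ≤ 1)
    (hc : ∀ T : ℝ, 0 < T → T ≤ 1 / Real.log n →
      specificHeat (n ^ d) H T ≤ k * T ^ (-ν) * Real.exp (-Δ / T))
    (hν : ν * δ ≤ Δ * Real.log n) {T : ℝ} (hT : 0 < T) (hT1 : T ≤ δ / Real.log n) :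
    traceNorm (thermalState H T - groundState H) ≤ ENNReal.ofReal (etaErr d n k Δ ν δ) := by
  refine (hH.traceNorm_thermalState_sub_le hT).trans (ENNReal.ofReal_le_ofReal ?_)
  have hn1 : (1 : ℝ) < n := by exact_mod_cast hn
  have hn0 : (0 : ℝ) < n := by linarith
  have hlog : 0 < Real.log n := Real.log_pos hn1
  set T₀ := δ / Real.log n with hT₀
  have hT₀0 : 0 < T₀ := div_pos hδ hlog
  set e := groundEnergy H with he
  set Z := boltzmannMoment (fun l => degeneracy H l) e with hZ
  set g : ℝ := ((degeneracy H e : ℕ) : ℝ) with hg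
  have hg0 : 0 < g := Nat.cast_pos.2 hH.degeneracy_groundEnergy_pos
  have hZ0 : ∀ b, 0 < b → 0 < Z 0 b := fun b hb => hH.boltzmannMoment_zero_pos hb
  have hN : (0 : ℝ) < (n : ℝ) ^ d := by positivity
  have key := log_boltzmannMoment_le (w := fun l => (degeneracy H l : ℝ)) (e₀ := e)
    (K := k * (n : ℝ) ^ d) (Δ := Δ) (ν := ν) (T₀ := T₀)
    (fun _ => Nat.cast_nonneg _) (fun _ => hH.groundEnergy_le)
    (fun _ => hH.summable_shifted) hg0 (by positivity) hΔ hT₀0 ?_ ?_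
  · have h1 : g / Z 0 (1 / T₀) ≤ g / Z 0 (1 / T) :=
      div_le_div_of_nonneg_left hg0.le (hZ0 _ (one_div_pos.2 hT))
        (boltzmannMoment_zero_anti (fun _ => Nat.cast_nonneg _) (fun _ => hH.groundEnergy_le)
          (fun _ => hH.summable_shifted) (one_div_pos.2 hT₀0) (one_div_le_one_div_of_le hT hT1))
    -- The excited weight `1 - g / Z` is at most `log (Z / g)`, the quantity bounded by `key`.
    have h2 := Real.one_sub_inv_le_log_of_pos (div_pos (hZ0 _ (one_div_pos.2 hT₀0)) hg0)
    rw [inv_div] at h2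
    have h3 : etaErr d n k Δ ν δ =
        2 * (k * (n : ℝ) ^ d / Δ * T₀ ^ (1 - ν) * Real.exp (-(Δ / T₀))) := by
      rw [etaErr, Real.rpow_sub hn0, Real.rpow_natCast]
      have e1 : (Real.log n / δ) ^ (ν - 1) = T₀ ^ (1 - ν) := by
        rw [hT₀, ← inv_div, Real.inv_rpow (div_pos hδ hlog).le, ← Real.rpow_neg
          (div_pos hδ hlog).le]
        congr 1
        ring
      have e2 : Real.exp (-(Δ / T₀)) = ((n : ℝ) ^ (Δ / δ))⁻¹ := by
        rw [Real.exp_neg, Real.rpow_def_of_pos hn0, hT₀]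
        congr 2
        field_simp
      rw [e1, e2]
      ring
    rw [h3]
    linarith
  · rw [hT₀]
    have : ν ≤ Δ / (δ / Real.log n) := by
      rw [div_div_eq_mul_div, le_div_iff₀ hδ]
      exact hν
    linarith
  · intro t ht htT
    -- Since `δ ≤ 1`, the interval up to `T₀` lies inside the range of the specific heat bound.
    have h1 := hc t ht (htT.trans (div_le_div_of_nonneg_right hδ1 hlog.le))
    rw [specificHeat] at h1
    have h2 : (fun t => meanEnergy H t / ((n ^ d : ℕ) : ℝ)) =ᶠ[nhds t]
        fun t => (e + Z 1 (1 / t) / Z 0 (1 / t)) / ((n ^ d : ℕ) : ℝ) := by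
      filter_upwards [lt_mem_nhds ht] with s hs
      rw [hH.meanEnergy_eq hs]
    rw [h2.deriv_eq, deriv_div_const, deriv_const_add, div_le_iff₀ (by positivity)] at h1
    push_cast at h1
    linarith

end GroundState

end ThermalLattice

namespace ThermalLattice

/-! ### Trace inequalities for Hermitian matrices and their exponentials. -/

section MatrixTrace

open scoped Matrix Matrix.Norms.L2Operator ComplexOrder
open NormedSpace (exp)

variable {ι : Type*} [Fintype ι] [DecidableEq ι]

theorem exists_diagonalization {A : Matrix ι ι ℂ} (hA : A.IsHermitian) :
    ∃ (U : Matrix ι ι ℂ) (a : ι → ℝ), U ∈ Matrix.unitaryGroup ι ℂ ∧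
      A = U * Matrix.diagonal (fun i => (a i : ℂ)) * Uᴴ := by
  refine ⟨hA.eigenvectorUnitary, hA.eigenvalues, hA.eigenvectorUnitary.2, ?_⟩
  have := hA.spectral_theorem
  rwa [Unitary.conjStarAlgAut_apply] at this

theorem conjTranspose_mul_self_of_mem_unitary {U : Matrix ι ι ℂ}
    (hU : U ∈ Matrix.unitaryGroup ι ℂ) : Uᴴ * U = 1 := hU.1

theorem mul_conjTranspose_self_of_mem_unitary {U : Matrix ι ι ℂ}
    (hU : U ∈ Matrix.unitaryGroup ι ℂ) : U * Uᴴ = 1 := hU.2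

theorem exp_unitary_conj {U : Matrix ι ι ℂ} (hU : U ∈ Matrix.unitaryGroup ι ℂ)
    (A : Matrix ι ι ℂ) : exp (U * A * Uᴴ) = U * exp A * Uᴴ := by
  have h : Uᴴ = U⁻¹ := (Matrix.inv_eq_left_inv hU.1).symm
  rw [h]
  exact Matrix.exp_conj U A ⟨⟨U, Uᴴ, hU.2, hU.1⟩, rfl⟩

theorem norm_apply_le (M : Matrix ι ι ℂ) (u : EuclideanSpace ℂ ι) :
    ‖inner ℂ u (Matrix.toEuclideanCLM (n := ι) (𝕜 := ℂ) M u)‖ ≤ ‖M‖ * ‖u‖ ^ 2 := by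
  refine (norm_inner_le_norm _ _).trans ?_
  have := (Matrix.toEuclideanCLM (n := ι) (𝕜 := ℂ) M).le_opNorm u
  rw [← Matrix.cstar_norm_def] at this
  nlinarith [norm_nonneg u]

theorem inner_toEuclideanCLM_eq (M : Matrix ι ι ℂ) (u : EuclideanSpace ℂ ι) :
    inner ℂ u (Matrix.toEuclideanCLM (n := ι) (𝕜 := ℂ) M u) = star u.ofLp ⬝ᵥ (M *ᵥ u.ofLp) := by
  rw [EuclideanSpace.inner_eq_star_dotProduct, Matrix.ofLp_toEuclideanCLM, dotProduct_comm]

theorem norm_diag_le (M : Matrix ι ι ℂ) (i : ι) : ‖M i i‖ ≤ ‖M‖ := by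
  have := norm_apply_le M (EuclideanSpace.single i 1)
  rw [inner_toEuclideanCLM_eq] at this
  simpa using this

/-- Cyclicity turns the trace into a sum of quadratic forms of `B` at the conjugated rows of `S`,
whose squared norms add up to the trace of `Sᴴ * S`. -/
theorem norm_trace_mul_conjTranspose_mul_self_le (B S : Matrix ι ι ℂ) :
    ‖(B * (Sᴴ * S)).trace‖ ≤ ‖B‖ * (Sᴴ * S).trace.re := by
  have h1 : (B * (Sᴴ * S)).trace = ∑ i, inner ℂ (WithLp.toLp 2 fun j => star (S i j))
      (Matrix.toEuclideanCLM (n := ι) (𝕜 := ℂ) B (WithLp.toLp 2 fun j => star (S i j))) := by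
    rw [← mul_assoc, Matrix.trace_mul_comm, Matrix.trace]
    refine Finset.sum_congr rfl fun i _ => ?_
    rw [inner_toEuclideanCLM_eq]
    simp [Matrix.mul_apply, dotProduct, Matrix.mulVec]
  have h2 : (Sᴴ * S).trace.re = ∑ i, ‖(WithLp.toLp 2 fun j => star (S i j) :
      EuclideanSpace ℂ ι)‖ ^ 2 := by
    rw [Matrix.trace_mul_comm, Matrix.trace, Complex.re_sum]
    refine Finset.sum_congr rfl fun i _ => ?_
    rw [EuclideanSpace.norm_sq_eq, Matrix.diag_apply, Matrix.mul_apply, Complex.re_sum]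
    refine Finset.sum_congr rfl fun j _ => ?_
    simp only [Matrix.conjTranspose_apply, Complex.star_def, Complex.mul_conj,
      Complex.normSq_eq_norm_sq, Complex.ofReal_re, RCLike.norm_conj]
  rw [h1, h2, Finset.mul_sum]
  exact (norm_sum_le _ _).trans (Finset.sum_le_sum fun i _ => norm_apply_le _ _)

open scoped MatrixOrder in
theorem norm_trace_mul_posSemidef_le (B : Matrix ι ι ℂ) {P : Matrix ι ι ℂ} (hP : P.PosSemidef) :
    ‖(B * P).trace‖ ≤ ‖B‖ * P.trace.re := by
  obtain ⟨S, rfl⟩ := CStarAlgebra.nonneg_iff_eq_star_mul_self.mp hP.nonneg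
  exact norm_trace_mul_conjTranspose_mul_self_le B S

theorem posSemidef_exp {K : Matrix ι ι ℂ} (hK : K.IsHermitian) : (exp K).PosSemidef := by
  obtain ⟨U, a, hU, rfl⟩ := exists_diagonalization hK
  rw [exp_unitary_conj hU, Matrix.exp_diagonal]
  refine Matrix.PosSemidef.mul_mul_conjTranspose_same (Matrix.PosSemidef.diagonal fun i => ?_) U
  rw [Pi.coe_exp, ← Complex.exp_eq_exp_ℂ, ← Complex.ofReal_exp]
  exact Complex.zero_le_real.2 (Real.exp_pos _).le

/-! ### Monotonicity of the partition function -/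

/-- Jensen's inequality: the numbers `‖U j i‖ ^ 2` are probabilities with which the eigenvalues
average to the diagonal entry. The tangent line of the exponential at that average suffices. -/
theorem exp_diag_le {C : Matrix ι ι ℂ} (hC : C.IsHermitian) (j : ι) :
    Real.exp (C j j).re ≤ (exp C j j).re := by
  obtain ⟨U, a, hU, hUa⟩ := exists_diagonalization hC
  set c := (C j j).re with hc
  have h1 : C = U * Matrix.diagonal (fun i => (a i : ℂ)) * Uᴴ := hUa
  have h2 : exp C = U * Matrix.diagonal (fun i => (Real.exp (a i) : ℂ)) * Uᴴ := by
    rw [h1, exp_unitary_conj hU, Matrix.exp_diagonal]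
    congr 3
    ext i
    rw [Pi.coe_exp, ← Complex.exp_eq_exp_ℂ, Complex.ofReal_exp]
  have entry : ∀ f : ι → ℝ, ((U * Matrix.diagonal (fun i => (f i : ℂ)) * Uᴴ) j j).re =
      ∑ i, f i * ‖U j i‖ ^ 2 := by
    intro f
    rw [Matrix.mul_apply, Complex.re_sum]
    refine Finset.sum_congr rfl fun i _ => ?_
    rw [Matrix.mul_diagonal, Matrix.conjTranspose_apply]
    have : U j i * (f i : ℂ) * star (U j i) = ((f i * ‖U j i‖ ^ 2 : ℝ) : ℂ) := by
      rw [mul_right_comm]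
      simp only [Complex.star_def, Complex.mul_conj, Complex.normSq_eq_norm_sq]
      push_cast
      ring
    rw [this, Complex.ofReal_re]
  have hone : ∑ i, ‖U j i‖ ^ 2 = 1 := by
    have := entry fun _ => 1
    simp only [Complex.ofReal_one, one_mul] at this
    rw [← this, Matrix.diagonal_one, mul_one, mul_conjTranspose_self_of_mem_unitary hU]
    simp
  have hcs : c = ∑ i, a i * ‖U j i‖ ^ 2 := by rw [← entry, ← h1]
  rw [h2, entry]
  calc Real.exp c = ∑ i, Real.exp c * (1 + (a i - c)) * ‖U j i‖ ^ 2 := by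
        simp_rw [mul_assoc, ← Finset.mul_sum, add_mul, sub_mul, one_mul, Finset.sum_add_distrib,
          Finset.sum_sub_distrib, ← Finset.mul_sum, ← hcs, hone]
        ring
    _ ≤ ∑ i, Real.exp (a i) * ‖U j i‖ ^ 2 := by
        refine Finset.sum_le_sum fun i _ => mul_le_mul_of_nonneg_right ?_ (sq_nonneg _)
        have := mul_le_mul_of_nonneg_left (Real.add_one_le_exp (a i - c)) (Real.exp_pos c).le
        rw [← Real.exp_add, add_sub_cancel] at this
        linarith

/-- In an eigenbasis of `A` the diagonal entries of `A + B` are at least `a j - ‖B‖`; `exp_diag_le`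
compares them with the diagonal of `exp (A + B)`. No commutation is needed, so interaction terms can
be deleted at a controlled cost. -/
theorem trace_exp_le {A B : Matrix ι ι ℂ} (hA : A.IsHermitian) (hB : B.IsHermitian) :
    (exp A).trace.re ≤ Real.exp ‖B‖ * (exp (A + B)).trace.re := by
  obtain ⟨U, a, hU, hUa⟩ := exists_diagonalization hA
  have hconj : ∀ M : Matrix ι ι ℂ, (Uᴴ * M * U).trace = M.trace := fun M => by
    rw [Matrix.trace_mul_comm, ← mul_assoc, mul_conjTranspose_self_of_mem_unitary hU, one_mul]
  have hUs : Uᴴ ∈ Matrix.unitaryGroup ι ℂ := Unitary.star_mem hU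
  have hexp : ∀ M : Matrix ι ι ℂ, Uᴴ * exp M * U = exp (Uᴴ * M * U) := fun M => by
    have := exp_unitary_conj hUs M
    rw [Matrix.conjTranspose_conjTranspose] at this
    exact this.symm
  have hAd : Uᴴ * A * U = Matrix.diagonal (fun i => (a i : ℂ)) := by
    rw [hUa, mul_assoc, mul_assoc, conjTranspose_mul_self_of_mem_unitary hU, mul_one, ← mul_assoc,
      conjTranspose_mul_self_of_mem_unitary hU, one_mul]
  rw [← hconj (exp A), ← hconj (exp (A + B)), hexp, hexp, hAd, Matrix.exp_diagonal]
  rw [Matrix.trace, Matrix.trace, Complex.re_sum, Complex.re_sum, Finset.mul_sum]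
  refine Finset.sum_le_sum fun j _ => ?_
  have hH : (Uᴴ * (A + B) * U).IsHermitian := by
    have := Matrix.isHermitian_conjTranspose_mul_mul U (hA.add hB)
    exact this
  have h1 := exp_diag_le hH j
  have hn : ‖Uᴴ * B * U‖ = ‖B‖ := by
    rw [mul_assoc]
    rw [show Uᴴ * (B * U) = ((⟨Uᴴ, hUs⟩ : Matrix.unitaryGroup ι ℂ) : Matrix ι ι ℂ) *
      (B * ((⟨U, hU⟩ : Matrix.unitaryGroup ι ℂ) : Matrix ι ι ℂ)) from rfl]
    rw [CStarRing.norm_coe_unitary_mul, CStarRing.norm_mul_coe_unitary]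
  have h2 : a j - ‖B‖ ≤ ((Uᴴ * (A + B) * U) j j).re := by
    rw [mul_add, add_mul, hAd, Matrix.add_apply, Matrix.diagonal_apply_eq, Complex.add_re,
      Complex.ofReal_re]
    have h3 := (Complex.abs_re_le_norm _).trans ((norm_diag_le (Uᴴ * B * U) j).trans hn.le)
    linarith [(abs_le.1 h3).1]
  have h4 : (Matrix.diag (Matrix.diagonal (exp fun i => (a i : ℂ))) j).re = Real.exp (a j) := by
    rw [Matrix.diag_apply, Matrix.diagonal_apply_eq, Pi.coe_exp, ← Complex.exp_eq_exp_ℂ,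
      ← Complex.ofReal_exp, Complex.ofReal_re]
  rw [h4, Matrix.diag_apply]
  calc Real.exp (a j) = Real.exp ‖B‖ * Real.exp (a j - ‖B‖) := by
        rw [← Real.exp_add]; congr 1; ring
    _ ≤ _ := mul_le_mul_of_nonneg_left ((Real.exp_le_exp.2 h2).trans h1) (Real.exp_pos _).le

end MatrixTrace

end ThermalLattice

namespace ThermalLattice

/-! ### Multiple Hölder inequality by complex interpolation. -/

section Hoelder

open scoped Matrix Matrix.Norms.L2Operator ComplexOrder
open NormedSpace (exp)

variable {ι : Type*} [Fintype ι] [DecidableEq ι]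

theorem norm_mul_list_prod_le {κ : Type*} (f : κ → Matrix ι ι ℂ) {g : κ → ℝ} (l : List κ)
    (h : ∀ k ∈ l, ‖f k‖ ≤ g k) (W : Matrix ι ι ℂ) :
    ‖W * (l.map f).prod‖ ≤ ‖W‖ * (l.map g).prod := by
  induction l generalizing W with
  | nil => simp
  | cons k l ih =>
    rw [List.map_cons, List.prod_cons, List.map_cons, List.prod_cons, ← mul_assoc, ← mul_assoc]
    refine (ih (fun k hk => h k (List.mem_cons_of_mem _ hk)) _).trans ?_
    refine mul_le_mul_of_nonneg_right ?_ ?_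
    · exact (norm_mul_le _ _).trans
        (mul_le_mul_of_nonneg_left (h k List.mem_cons_self) (norm_nonneg _))
    · refine List.prod_nonneg fun x hx => ?_
      obtain ⟨k', hk', rfl⟩ := List.mem_map.1 hx
      exact (norm_nonneg _).trans (h k' (List.mem_cons_of_mem _ hk'))

theorem differentiable_list_prod {κ : Type*} (f : κ → ℂ → Matrix ι ι ℂ)
    (h : ∀ k, Differentiable ℂ (f k)) (l : List κ) :
    Differentiable ℂ fun z => (l.map fun k => f k z).prod := by
  induction l with
  | nil => simp
  | cons k l ih =>
    simp only [List.map_cons, List.prod_cons]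
    exact (h k).mul ih

theorem exp_mul_I_mem_unitary {K : Matrix ι ι ℂ} (hK : K.IsHermitian) (y : ℝ) :
    exp ((y * Complex.I) • K) ∈ Matrix.unitaryGroup ι ℂ := by
  have h := (selfAdjoint.expUnitary (⟨y • K, by
    have : IsSelfAdjoint K := hK
    exact (IsSelfAdjoint.all y).smul this⟩ : selfAdjoint (Matrix ι ι ℂ))).2
  rw [selfAdjoint.expUnitary_coe] at h
  rw [mul_comm, mul_smul]
  exact h

theorem exp_re_add_im (K : Matrix ι ι ℂ) (x y : ℝ) :
    exp ((x + y * Complex.I) • K) = exp ((x : ℂ) • K) * exp ((y * Complex.I) • K) := by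
  rw [add_smul]
  exact Matrix.exp_add_of_commute _ _ (((Commute.refl K).smul_left _).smul_right _)

theorem norm_exp_le_exp_norm [Nonempty ι] (M : Matrix ι ι ℂ) : ‖exp M‖ ≤ Real.exp ‖M‖ := by
  have h : HasSum (fun k : ℕ => ((k.factorial : ℂ)⁻¹) • M ^ k) (exp M) :=
    NormedSpace.exp_series_hasSum_exp' M
  have h2 : HasSum (fun k : ℕ => ((k.factorial : ℝ)⁻¹) • ‖M‖ ^ k) (Real.exp ‖M‖) := by
    rw [Real.exp_eq_exp_ℝ]
    exact NormedSpace.exp_series_hasSum_exp' ‖M‖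
  refine h.tsum_eq ▸ tsum_of_norm_bounded h2 fun k => ?_
  rw [norm_smul, smul_eq_mul, norm_inv, Complex.norm_natCast]
  exact mul_le_mul_of_nonneg_left (norm_pow_le M k) (by positivity)

theorem norm_exp_le_of_isHermitian [Nonempty ι] {K : Matrix ι ι ℂ}
    (hK : K.IsHermitian) (x y : ℝ) :
    ‖exp ((x + y * Complex.I) • K)‖ ≤ Real.exp (|x| * ‖K‖) := by
  rw [exp_re_add_im]
  have h := CStarRing.norm_mul_coe_unitary (exp ((x : ℂ) • K))
    (⟨_, exp_mul_I_mem_unitary hK y⟩ : Matrix.unitaryGroup ι ℂ)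
  rw [h]
  refine (norm_exp_le_exp_norm _).trans ?_
  rw [norm_smul, Complex.norm_real, Real.norm_eq_abs]

/-- Only finiteness of the constant matters: it supplies boundedness on the strip for the three
lines theorem and does not enter the final estimate. -/
theorem exists_norm_trace_le : ∃ c : ℝ, 0 ≤ c ∧ ∀ M : Matrix ι ι ℂ, ‖M.trace‖ ≤ c * ‖M‖ := by
  refine ⟨Fintype.card ι, Nat.cast_nonneg _, fun M => ?_⟩
  refine (norm_sum_le _ _).trans ((Finset.sum_le_card_nsmul _ _ ‖M‖ fun i _ => ?_).trans ?_)
  · exact norm_diag_le M i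
  · simp

/-- The multiple Hölder inequality for the trace of a product of exponentials. -/
theorem norm_trace_prod_exp_le [Nonempty ι] {m : ℕ} (hm : 0 < m) (A K : Fin m → Matrix ι ι ℂ)
    (hK : ∀ l, (K l).IsHermitian) {Z : ℝ} (hZ : ∀ l, (exp ((m : ℂ) • K l)).trace.re ≤ Z)
    (W : Matrix ι ι ℂ) :
    ‖(W * ((List.finRange m).map fun l => A l * exp (K l)).prod).trace‖ ≤
      ‖W‖ * ((List.finRange m).map fun l => ‖A l‖).prod * Z := by
  set F : (Fin m → ℂ) → ℂ := fun z =>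
    (W * ((List.finRange m).map fun l => A l * exp (z l • K l)).prod).trace with hF
  set C := ‖W‖ * ((List.finRange m).map fun l => ‖A l‖).prod * Z with hC
  -- The real parts of exponents for which the bound holds uniformly in the imaginary parts. This
  -- set is convex by the three lines theorem and contains the points `m • e_j`, hence their
  -- barycentre `(1, …, 1)`.
  set S : Set (Fin m → ℝ) :=
    {x | ∀ y : Fin m → ℝ, ‖F fun l => x l + y l * Complex.I‖ ≤ C} with hS
  have hconv : Convex ℝ S := by
    intro x hx x' hx' a b ha hb hab y
    obtain ⟨c, hc0, hc⟩ := exists_norm_trace_le (ι := ι)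
    -- The complex line through the two points. Its imaginary direction changes only the imaginary
    -- parts of the exponents, so both edges of the strip are covered by the hypotheses at `x` and
    -- `x'`.
    set G : ℂ → Fin m → ℂ := fun w l => x l + w * (x' l - x l) + y l * Complex.I with hG
    have hGw : ∀ w : ℂ, G w = fun l => ((x l + w.re * (x' l - x l) : ℝ) : ℂ) +
        ((w.im * (x' l - x l) + y l : ℝ) : ℂ) * Complex.I := fun w => by
      funext l
      apply Complex.ext <;> simp [hG]
    have hd : Differentiable ℂ fun w => F (G w) := by
      have h1 : Differentiable ℂ fun w =>
          W * ((List.finRange m).map fun l => A l * exp (G w l • K l)).prod := by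
        refine (differentiable_const W).mul (differentiable_list_prod
          (fun l w => A l * exp (G w l • K l)) (fun l => (differentiable_const _).mul ?_) _)
        have h2 : Differentiable ℂ fun u : ℂ => exp (u • K l) := fun u =>
          (hasDerivAt_exp_smul_const (K l) u).differentiableAt
        refine h2.comp ?_
        simp only [hG]
        fun_prop
      have h3 : Differentiable ℂ fun M : Matrix ι ι ℂ => M.trace :=
        (LinearMap.toContinuousLinearMap (Matrix.traceLinearMap ι ℂ ℂ)).differentiable
      exact h3.comp h1
    have hB : BddAbove ((norm ∘ fun w => F (G w)) '' Complex.HadamardThreeLines.verticalClosedStrip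
        0 1) := by
      refine ⟨c * (‖W‖ * ((List.finRange m).map fun l =>
        ‖A l‖ * Real.exp ((|x l| + |x' l - x l|) * ‖K l‖)).prod), ?_⟩
      rintro _ ⟨w, hw, rfl⟩
      refine (hc _).trans (mul_le_mul_of_nonneg_left (norm_mul_list_prod_le _ _ ?_ _) hc0)
      intro l _
      refine (norm_mul_le _ _).trans (mul_le_mul_of_nonneg_left ?_ (norm_nonneg _))
      rw [hGw]
      refine (norm_exp_le_of_isHermitian (hK l) _ _).trans (Real.exp_le_exp.2
        (mul_le_mul_of_nonneg_right ?_ (norm_nonneg _)))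
      refine (abs_add_le _ _).trans (add_le_add_right ?_ _)
      rw [abs_mul]
      have hw' : 0 ≤ w.re ∧ w.re ≤ 1 := hw
      rw [abs_of_nonneg hw'.1]
      exact mul_le_of_le_one_left (abs_nonneg _) hw'.2
    have h0 : ∀ w ∈ Complex.re ⁻¹' {0}, ‖F (G w)‖ ≤ C := by
      intro w hw
      have hw' : w.re = 0 := hw
      rw [hGw, hw']
      simpa using hx fun l => w.im * (x' l - x l) + y l
    have h1 : ∀ w ∈ Complex.re ⁻¹' {1}, ‖F (G w)‖ ≤ C := by
      intro w hw
      have hw' : w.re = 1 := hw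
      rw [hGw, hw']
      simpa using hx' fun l => w.im * (x' l - x l) + y l
    have hb1 : b ≤ 1 := by linarith
    have := Complex.HadamardThreeLines.norm_le_interp_of_mem_verticalClosedStrip₀₁'
      (fun w => F (G w)) (z := (b : ℂ)) (a := C) (b := C) ⟨by simpa using hb, by simpa using hb1⟩
      hd.diffContOnCl hB h0 h1
    have hC0 : 0 ≤ C := (norm_nonneg _).trans (hx y)
    have hfin : C ^ (1 - (b : ℂ).re) * C ^ (b : ℂ).re = C := by
      rw [Complex.ofReal_re]
      rw [← Real.rpow_add_of_nonneg hC0 (by linarith) hb]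
      simp
    rw [hfin] at this
    obtain rfl : a = 1 - b := by linarith
    have hpt : (fun l => (((((1 - b) • x + b • x') l : ℝ) : ℂ) + y l * Complex.I)) = G b := by
      funext l
      simp [hG]
      ring
    rw [hpt]
    exact this
  -- At a vertex all exponentials other than the `j`-th are unitary. The `j`-th is a unitary times
  -- the positive matrix `exp (m • K j)`, which cyclicity moves to the end of the trace.
  have hvert : ∀ j : Fin m, Pi.single j (m : ℝ) ∈ S := by
    intro j y
    obtain ⟨s, t, hst⟩ := List.append_of_mem (List.mem_finRange j)
    have hnd : (s ++ j :: t).Nodup := hst ▸ List.nodup_finRange m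
    have hjs : j ∉ s ∧ j ∉ t := by
      rw [List.nodup_append'] at hnd
      exact ⟨fun h => hnd.2.2 h List.mem_cons_self, (List.nodup_cons.1 hnd.2.1).1⟩
    set f : Fin m → Matrix ι ι ℂ := fun l =>
      A l * exp ((((Pi.single j (m : ℝ) : Fin m → ℝ) l : ℂ) + y l * Complex.I) • K l) with hf
    have hfl : ∀ l, l ≠ j → ‖f l‖ ≤ ‖A l‖ := by
      intro l hl
      simp only [hf, Pi.single_eq_of_ne hl, Complex.ofReal_zero, zero_add]
      exact (CStarRing.norm_mul_coe_unitary (A l)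
        (⟨_, exp_mul_I_mem_unitary (hK l) (y l)⟩ : Matrix.unitaryGroup ι ℂ)).le
    have hs := norm_mul_list_prod_le f s (g := fun l => ‖A l‖)
      (fun l hl => hfl l fun h => hjs.1 (h ▸ hl))
    have ht := norm_mul_list_prod_le f t (g := fun l => ‖A l‖)
      (fun l hl => hfl l fun h => hjs.2 (h ▸ hl))
    set U := exp ((y j * Complex.I) • K j) with hU
    set P := exp ((m : ℂ) • K j) with hP
    have hfj : f j = A j * (U * P) := by
      simp only [hf, Pi.single_eq_same]
      rw [add_comm, add_smul, Matrix.exp_add_of_commute _ _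
        (((Commute.refl (K j)).smul_left _).smul_right _)]
      simp [hU, hP]
    have hPpos : P.PosSemidef := by
      refine posSemidef_exp ?_
      have := (hK j).smul (k := (m : ℂ)) (by simp [IsSelfAdjoint])
      exact this
    change ‖(W * ((List.finRange m).map f).prod).trace‖ ≤ C
    rw [hC, hst, List.map_append, List.prod_append, List.map_cons, List.prod_cons, List.map_append,
      List.prod_append, List.map_cons, List.prod_cons, hfj]
    have hcyc : (W * ((s.map f).prod * (A j * (U * P) * (t.map f).prod))).trace =
        ((((t.map f).prod * W) * (s.map f).prod * (A j * U)) * P).trace := by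
      rw [mul_assoc ((t.map f).prod), mul_assoc ((t.map f).prod), mul_assoc ((t.map f).prod),
        Matrix.trace_mul_comm (t.map f).prod]
      simp only [mul_assoc]
    rw [hcyc]
    have hn : ∀ l : List (Fin m), 0 ≤ (l.map fun l => ‖A l‖).prod := fun l =>
      List.prod_nonneg fun x hx => by
        obtain ⟨k', _, rfl⟩ := List.mem_map.1 hx
        exact norm_nonneg _
    have hUn : ‖A j * U‖ ≤ ‖A j‖ := (CStarRing.norm_mul_coe_unitary (A j)
        (⟨_, exp_mul_I_mem_unitary (hK j) (y j)⟩ : Matrix.unitaryGroup ι ℂ)).le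
    have h1 : ‖((t.map f).prod * W) * (s.map f).prod * (A j * U)‖ ≤
        ‖W‖ * ((s.map fun l => ‖A l‖).prod * (‖A j‖ * (t.map fun l => ‖A l‖).prod)) := by
      have ht1 : ‖(t.map f).prod‖ ≤ (t.map fun l => ‖A l‖).prod := by
        have := ht 1
        rwa [one_mul, norm_one, one_mul] at this
      have hs1 := (hs ((t.map f).prod * W)).trans (mul_le_mul_of_nonneg_right
        ((norm_mul_le _ _).trans (mul_le_mul_of_nonneg_right ht1 (norm_nonneg W))) (hn s))
      refine (norm_mul_le _ _).trans ((mul_le_mul hs1 hUn (norm_nonneg _)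
        ((norm_nonneg _).trans hs1)).trans (le_of_eq (by ring)))
    refine (norm_trace_mul_posSemidef_le _ hPpos).trans ?_
    have hP0 : 0 ≤ P.trace.re := (Complex.nonneg_iff.1 hPpos.trace_nonneg).1
    exact mul_le_mul h1 (hZ j) hP0 ((norm_nonneg _).trans h1)
  have hone : (fun _ => 1 : Fin m → ℝ) ∈ S := by
    have hm0 : (m : ℝ) ≠ 0 := by exact_mod_cast hm.ne'
    have := hconv.sum_mem (t := Finset.univ) (w := fun _ : Fin m => 1 / (m : ℝ))
      (z := fun j => Pi.single j (m : ℝ)) (fun _ _ => by positivity)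
      (by simp [hm0]) fun j _ => hvert j
    rw [← Finset.smul_sum, Finset.univ_sum_single (fun _ : Fin m => (m : ℝ))] at this
    rwa [show (fun _ => 1 : Fin m → ℝ) = (1 / (m : ℝ)) • fun _ => (m : ℝ) from
      funext fun l => by simp [hm0]]
  have := hone 0
  simpa [hF] using this

end Hoelder

/-! ### Trace norm of matrices and duality with the operator norm. -/

section TraceNormMatrix

open scoped Matrix Matrix.Norms.L2Operator ComplexOrder

variable {ι : Type*} [Fintype ι] [DecidableEq ι]

/-- The absolute value and the sign of a Hermitian matrix. -/
theorem exists_abs_sign {A : Matrix ι ι ℂ} (hA : A.IsHermitian) :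
    ∃ P S : Matrix ι ι ℂ, P.PosSemidef ∧ ‖S‖ ≤ 1 ∧ P = S * A ∧ A = S * P ∧ P * P = Aᴴ * A := by
  obtain ⟨U, a, hU, hUa⟩ := exists_diagonalization hA
  have hmul : ∀ f g : ι → ℝ, (U * Matrix.diagonal (fun i => (f i : ℂ)) * Uᴴ) *
      (U * Matrix.diagonal (fun i => (g i : ℂ)) * Uᴴ) =
      U * Matrix.diagonal (fun i => ((f i * g i : ℝ) : ℂ)) * Uᴴ := by
    intro f g
    rw [mul_assoc (U * _), ← mul_assoc Uᴴ, ← mul_assoc Uᴴ,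
      conjTranspose_mul_self_of_mem_unitary hU, one_mul, ← mul_assoc, mul_assoc U,
      Matrix.diagonal_mul_diagonal]
    simp only [Complex.ofReal_mul]
  refine ⟨U * Matrix.diagonal (fun i => ((|a i| : ℝ) : ℂ)) * Uᴴ,
    U * Matrix.diagonal (fun i => ((SignType.sign (a i) : ℝ) : ℂ)) * Uᴴ, ?_, ?_, ?_, ?_, ?_⟩
  · exact Matrix.PosSemidef.mul_mul_conjTranspose_same (Matrix.PosSemidef.diagonal fun i =>
      Complex.zero_le_real.2 (abs_nonneg _)) U
  · rw [show U * Matrix.diagonal (fun i => ((SignType.sign (a i) : ℝ) : ℂ)) * Uᴴ =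
      ((⟨U, hU⟩ : Matrix.unitaryGroup ι ℂ) : Matrix ι ι ℂ) *
      Matrix.diagonal (fun i => ((SignType.sign (a i) : ℝ) : ℂ)) *
      ((⟨Uᴴ, Unitary.star_mem hU⟩ : Matrix.unitaryGroup ι ℂ) : Matrix ι ι ℂ) from rfl,
      CStarRing.norm_mul_coe_unitary, CStarRing.norm_coe_unitary_mul, Matrix.l2_opNorm_diagonal]
    refine (pi_norm_le_iff_of_nonneg zero_le_one).2 fun i => ?_
    rw [Complex.norm_real]
    rcases lt_trichotomy (a i) 0 with h | h | h <;> simp [h]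
  · conv_rhs => rw [hUa]
    rw [hmul]
    simp only [sign_mul_self]
  · conv_lhs => rw [hUa]
    rw [hmul]
    simp only [sign_mul_abs]
  · rw [hA.eq]
    conv_rhs => rw [hUa]
    rw [hmul, hmul]
    simp only [abs_mul_abs_self]

theorem isPositive_toEuclideanCLM {P : Matrix ι ι ℂ} (hP : P.PosSemidef) :
    (Matrix.toEuclideanCLM (n := ι) (𝕜 := ℂ) P).IsPositive := by
  rw [← ContinuousLinearMap.isPositive_toLinearMap_iff]
  exact Matrix.isPositive_toEuclideanLin_iff.2 hP

theorem toEuclideanCLM_mul_self_eq {A P : Matrix ι ι ℂ} (h : P * P = Aᴴ * A) :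
    Matrix.toEuclideanCLM (n := ι) (𝕜 := ℂ) P * Matrix.toEuclideanCLM (n := ι) (𝕜 := ℂ) P =
      star (Matrix.toEuclideanCLM (n := ι) (𝕜 := ℂ) A) *
        Matrix.toEuclideanCLM (n := ι) (𝕜 := ℂ) A := by
  rw [← map_mul, h, map_mul, ← map_star]
  rfl

theorem trace_toEuclideanCLM_basis (P : Matrix ι ι ℂ) :
    P.trace = ∑ i, inner ℂ (EuclideanSpace.single i (1 : ℂ))
      (Matrix.toEuclideanCLM (n := ι) (𝕜 := ℂ) P (EuclideanSpace.single i 1)) := by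
  refine Finset.sum_congr rfl fun i _ => ?_
  rw [inner_toEuclideanCLM_eq]
  simp

-- With `P = star S * S`, exchanging the sums leaves Bessel's inequality for the vectors obtained by
-- applying the adjoint of `S` to the standard basis.
open scoped MatrixOrder in
theorem sum_inner_le_trace {P : Matrix ι ι ℂ} (hP : P.PosSemidef) {m : ℕ}
    {v : Fin m → EuclideanSpace ℂ ι} (hv : Orthonormal ℂ v) :
    ∑ i, (inner ℂ (v i) (Matrix.toEuclideanCLM (n := ι) (𝕜 := ℂ) P (v i))).re ≤ P.trace.re := by
  obtain ⟨S, rfl⟩ := CStarAlgebra.nonneg_iff_eq_star_mul_self.mp hP.nonneg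
  set T := Matrix.toEuclideanCLM (n := ι) (𝕜 := ℂ) S with hT
  have h1 : ∀ x, (inner ℂ x (Matrix.toEuclideanCLM (n := ι) (𝕜 := ℂ) (star S * S) x)).re =
      ‖T x‖ ^ 2 := by
    intro x
    rw [map_mul, map_star, mul_apply_eq_comp, ContinuousLinearMap.star_eq_adjoint,
      ContinuousLinearMap.adjoint_inner_right, inner_self_eq_norm_sq_to_K]
    norm_cast
  have h2 : ∀ x, ‖T x‖ ^ 2 = ∑ j, ‖inner ℂ x (ContinuousLinearMap.adjoint T
      (EuclideanSpace.single j (1 : ℂ)))‖ ^ 2 := by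
    intro x
    rw [EuclideanSpace.norm_sq_eq]
    refine Finset.sum_congr rfl fun j _ => ?_
    rw [ContinuousLinearMap.adjoint_inner_right, ← inner_conj_symm, RCLike.norm_conj,
      EuclideanSpace.inner_single_left]
    simp
  have h3 : (star S * S).trace.re = ∑ j, ‖ContinuousLinearMap.adjoint T
      (EuclideanSpace.single j (1 : ℂ))‖ ^ 2 := by
    rw [Matrix.trace_mul_comm, trace_toEuclideanCLM_basis, Complex.re_sum]
    refine Finset.sum_congr rfl fun j _ => ?_
    rw [map_mul, map_star, mul_apply_eq_comp, ContinuousLinearMap.star_eq_adjoint,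
      ← ContinuousLinearMap.adjoint_inner_left, inner_self_eq_norm_sq_to_K]
    norm_cast
  simp_rw [h1, h2]
  rw [h3, Finset.sum_comm]
  exact Finset.sum_le_sum fun j _ => hv.sum_inner_products_le _

theorem traceNorm_toEuclideanCLM_le {A P : Matrix ι ι ℂ} (hP : P.PosSemidef)
    (h : P * P = Aᴴ * A) :
    traceNorm (Matrix.toEuclideanCLM (n := ι) (𝕜 := ℂ) A) ≤ ENNReal.ofReal P.trace.re :=
  traceNorm_le_of_mul_self_eq (isPositive_toEuclideanCLM hP) (toEuclideanCLM_mul_self_eq h)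
    fun _ _ hv => sum_inner_le_trace hP hv

/-- The standard basis is one of the orthonormal families in the supremum, and its partial trace is
the full trace. -/
theorem trace_le_of_traceNorm_le {A P : Matrix ι ι ℂ} (hP : P.PosSemidef)
    (h : P * P = Aᴴ * A) {c : ℝ} (hc : 0 ≤ c)
    (hA : traceNorm (Matrix.toEuclideanCLM (n := ι) (𝕜 := ℂ) A) ≤ ENNReal.ofReal c) :
    P.trace.re ≤ c := by
  set v : Fin (Fintype.card ι) → EuclideanSpace ℂ ι := fun j =>
    EuclideanSpace.single ((Fintype.equivFin ι).symm j) 1 with hv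
  have hvo : Orthonormal ℂ v :=
    EuclideanSpace.orthonormal_single.comp _ (Fintype.equivFin ι).symm.injective
  rw [← ENNReal.ofReal_le_ofReal_iff hc]
  refine le_trans ?_ hA
  refine le_trans ?_ (le_traceNorm_of_mul_self_eq (isPositive_toEuclideanCLM hP)
    (toEuclideanCLM_mul_self_eq h) hvo)
  refine ENNReal.ofReal_le_ofReal (le_of_eq ?_)
  rw [trace_toEuclideanCLM_basis, Complex.re_sum]
  exact ((Fintype.equivFin ι).symm.sum_comp fun i => (inner ℂ (EuclideanSpace.single i (1 : ℂ))
      (Matrix.toEuclideanCLM (n := ι) (𝕜 := ℂ) P (EuclideanSpace.single i 1))).re).symm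

/-- The triangle inequality for the trace norm, with the first term estimated by duality. -/
theorem traceNorm_add_le {A B : Matrix ι ι ℂ} (hA : A.IsHermitian) (hB : B.IsHermitian)
    {c c' : ℝ} (hc' : 0 ≤ c') (h : ∀ W : Matrix ι ι ℂ, ‖W‖ ≤ 1 → ‖(W * A).trace‖ ≤ c)
    (h' : traceNorm (Matrix.toEuclideanCLM (n := ι) (𝕜 := ℂ) B) ≤ ENNReal.ofReal c') :
    traceNorm (Matrix.toEuclideanCLM (n := ι) (𝕜 := ℂ) (A + B)) ≤ ENNReal.ofReal (c + c') := by
  obtain ⟨P, S, hP, hS, hPS, _, hPP⟩ := exists_abs_sign (hA.add hB)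
  obtain ⟨Q, R, hQ, hR, _, hBR, hQQ⟩ := exists_abs_sign hB
  refine (traceNorm_toEuclideanCLM_le hP hPP).trans (ENNReal.ofReal_le_ofReal ?_)
  rw [hPS, mul_add, Matrix.trace_add, Complex.add_re]
  refine add_le_add ((Complex.re_le_norm _).trans (h S hS)) ?_
  have h1 := trace_le_of_traceNorm_le hQ hQQ hc' h'
  have h0 : 0 ≤ Q.trace.re := (Complex.nonneg_iff.1 hQ.trace_nonneg).1
  have h2 : ‖S * R‖ ≤ 1 := (norm_mul_le _ _).trans (mul_le_one₀ hS (norm_nonneg _) hR)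
  -- Writing `B` as its sign times its absolute value makes `S * R` a contraction paired with the
  -- positive matrix `Q`.
  conv_lhs => rw [hBR, ← mul_assoc]
  exact (Complex.re_le_norm _).trans ((norm_trace_mul_posSemidef_le _ hQ).trans
    ((mul_le_of_le_one_left h0 h2).trans h1))

end TraceNormMatrix

end ThermalLattice

namespace ThermalLattice

/-! ### Connected components: counting and inclusion-exclusion. -/

section Clusters

open Relation
open scoped Classical

variable {V : Type*} [Fintype V] (R : V → V → Prop)

/-- One step of `R` inside `S`. -/
def StepIn (S : Finset V) (a b : V) : Prop := R a b ∧ a ∈ S ∧ b ∈ S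

/-- The connected component of `v` in the set `S`. -/
noncomputable def component (S : Finset V) (v : V) : Finset V :=
  S.filter fun u => ReflTransGen (StepIn R S) v u

/-- A nonempty connected set. -/
def IsCluster (A : Finset V) : Prop :=
  A.Nonempty ∧ ∀ u ∈ A, ∀ v ∈ A, ReflTransGen (StepIn R A) u v

/-- The connected components of `S`. -/
noncomputable def components (S : Finset V) : Finset (Finset V) := S.image (component R S)

/-- No step leads from `S` to `S'`. -/
def Separated (S S' : Finset V) : Prop := ∀ a ∈ S, ∀ b ∈ S', ¬ R a b

/-- The points that can be reached from `S` in one step. -/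
noncomputable def nbhd (S : Finset V) : Finset V := Finset.univ.filter fun b => ∃ a ∈ S, R a b

variable {R} {S S' A : Finset V} {u v : V}

omit [Fintype V] in
theorem component_subset : component R S v ⊆ S := Finset.filter_subset _ _

omit [Fintype V] in
theorem mem_component_self (h : v ∈ S) : v ∈ component R S v :=
  Finset.mem_filter.2 ⟨h, .refl⟩

omit [Fintype V] in
theorem StepIn.mono (h : S ⊆ S') {a b : V} (hab : StepIn R S a b) : StepIn R S' a b :=
  ⟨hab.1, h hab.2.1, h hab.2.2⟩

omit [Fintype V] in
theorem reflTransGen_stepIn_symm (hR : ∀ a b, R a b → R b a)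
    (h : ReflTransGen (StepIn R S) u v) : ReflTransGen (StepIn R S) v u := by
  induction h with
  | refl => exact .refl
  | tail _ hbc ih => exact .head ⟨hR _ _ hbc.1, hbc.2.2, hbc.2.1⟩ ih

omit [Fintype V] in
theorem component_eq_of_mem (hR : ∀ a b, R a b → R b a) (h : u ∈ component R S v) :
    component R S u = component R S v := by
  have huv := (Finset.mem_filter.1 h).2
  ext w
  simp only [component, Finset.mem_filter]
  exact and_congr_right fun _ => ⟨fun h => huv.trans h,
    fun h => (reflTransGen_stepIn_symm hR huv).trans h⟩

omit [Fintype V] in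
theorem mem_component_of_step (h : u ∈ component R S v) {w : V} (hw : w ∈ S) (huw : R u w) :
    w ∈ component R S v := by
  have := Finset.mem_filter.1 h
  exact Finset.mem_filter.2 ⟨hw, this.2.tail ⟨huw, this.1, hw⟩⟩

omit [Fintype V] in
theorem isCluster_component (hR : ∀ a b, R a b → R b a) (h : v ∈ S) :
    IsCluster R (component R S v) := by
  have key : ∀ w, ReflTransGen (StepIn R S) v w →
      ReflTransGen (StepIn R (component R S v)) v w := by
    intro w hw
    induction hw with
    | refl => exact .refl
    | tail hab hbc ih =>
      refine ih.tail ⟨hbc.1, Finset.mem_filter.2 ⟨hbc.2.1, hab⟩,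
        Finset.mem_filter.2 ⟨hbc.2.2, hab.tail hbc⟩⟩
  refine ⟨⟨v, mem_component_self h⟩, fun a ha b hb => ?_⟩
  exact (reflTransGen_stepIn_symm hR (key a (Finset.mem_filter.1 ha).2)).trans
    (key b (Finset.mem_filter.1 hb).2)

-- The criterion used to recognise components: a connected subset of `S` that no step inside `S`
-- leaves.
omit [Fintype V] in
theorem component_eq (hA : IsCluster R A) (hAS : A ⊆ S)
    (hsep : ∀ a ∈ A, ∀ w ∈ S, R a w → w ∈ A) (hv : v ∈ A) : component R S v = A := by
  ext w
  constructor
  · intro hw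
    replace hw := (Finset.mem_filter.1 hw).2
    induction hw with
    | refl => exact hv
    | tail _ hbc ih => exact hsep _ ih _ hbc.2.2 hbc.1
  · intro hw
    exact Finset.mem_filter.2 ⟨hAS hw,
      ReflTransGen.mono (fun _ _ h => StepIn.mono hAS h) _ _ (hA.2 v hv w hw)⟩

omit [Fintype V] in
theorem mem_components : A ∈ components R S ↔ ∃ v ∈ S, component R S v = A := Finset.mem_image

omit [Fintype V] in
theorem component_eq_of_mem_components (hR : ∀ a b, R a b → R b a) (hA : A ∈ components R S)
    (hv : v ∈ A) : component R S v = A := by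
  obtain ⟨w, _, rfl⟩ := mem_components.1 hA
  exact component_eq_of_mem hR hv

omit [Fintype V] in
theorem isCluster_of_mem_components (hR : ∀ a b, R a b → R b a) (hA : A ∈ components R S) :
    IsCluster R A := by
  obtain ⟨w, hw, rfl⟩ := mem_components.1 hA
  exact isCluster_component hR hw

omit [Fintype V] in
theorem subset_of_mem_components (hA : A ∈ components R S) : A ⊆ S := by
  obtain ⟨w, hw, rfl⟩ := mem_components.1 hA
  exact component_subset

omit [Fintype V] in
theorem mem_of_step_of_mem_components (hA : A ∈ components R S) {a w : V} (ha : a ∈ A)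
    (hw : w ∈ S) (h : R a w) : w ∈ A := by
  obtain ⟨v, hv, rfl⟩ := mem_components.1 hA
  exact mem_component_of_step ha hw h

omit [Fintype V] in
theorem mem_components_of_isCluster (hA : IsCluster R A) (hAS : A ⊆ S)
    (hsep : ∀ a ∈ A, ∀ w ∈ S, R a w → w ∈ A) : A ∈ components R S := by
  obtain ⟨v, hv⟩ := hA.1
  exact mem_components.2 ⟨v, hAS hv, component_eq hA hAS hsep hv⟩

omit [Fintype V] in
theorem biUnion_components : (components R S).biUnion id = S := by
  ext v
  simp only [Finset.mem_biUnion, id]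
  constructor
  · rintro ⟨A, hA, hv⟩
    exact subset_of_mem_components hA hv
  · exact fun hv => ⟨_, mem_components.2 ⟨v, hv, rfl⟩, mem_component_self hv⟩

omit [Fintype V] in
theorem eq_of_mem_components (hR : ∀ a b, R a b → R b a) {A B : Finset V}
    (hA : A ∈ components R S) (hB : B ∈ components R S) {a b : V} (ha : a ∈ A) (hb : b ∈ B)
    (hab : a = b ∨ R a b) : A = B := by
  have hb' : b ∈ A := by
    rcases hab with rfl | hab
    · exact ha
    · exact mem_of_step_of_mem_components hA ha (subset_of_mem_components hB hb) hab
  rw [← component_eq_of_mem_components hR hA hb', component_eq_of_mem_components hR hB hb]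

omit [Fintype V] in
theorem pairwiseDisjoint_components (hR : ∀ a b, R a b → R b a) :
    ((components R S : Finset (Finset V)) : Set (Finset V)).PairwiseDisjoint id := by
  intro A hA B hB hAB
  refine Finset.disjoint_left.2 fun a ha hb => hAB ?_
  exact eq_of_mem_components hR hA hB ha hb (.inl rfl)

omit [Fintype V] in
theorem card_eq_sum_components (hR : ∀ a b, R a b → R b a) :
    S.card = ∑ A ∈ components R S, A.card := by
  conv_lhs => rw [← biUnion_components (R := R) (S := S)]
  exact Finset.card_biUnion (pairwiseDisjoint_components hR)

omit [Fintype V] in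
theorem components_biUnion (hR : ∀ a b, R a b → R b a) {𝒜 : Finset (Finset V)}
    (h𝒜 : 𝒜 ⊆ components R S) : components R (𝒜.biUnion id) = 𝒜 := by
  have hsub : 𝒜.biUnion id ⊆ S := by
    conv_rhs => rw [← biUnion_components (R := R) (S := S)]
    exact Finset.biUnion_subset_biUnion_of_subset_left _ h𝒜
  have hmem : ∀ A ∈ 𝒜, A ∈ components R (𝒜.biUnion id) := fun A hA =>
    mem_components_of_isCluster (isCluster_of_mem_components hR (h𝒜 hA))
      (Finset.subset_biUnion_of_mem id hA)
      fun a ha w hw h => mem_of_step_of_mem_components (h𝒜 hA) ha (hsub hw) h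
  ext A
  refine ⟨fun hA => ?_, hmem A⟩
  obtain ⟨a, ha⟩ := (isCluster_of_mem_components hR hA).1
  obtain ⟨B, hB, haB⟩ := Finset.mem_biUnion.1 (subset_of_mem_components hA ha)
  rwa [eq_of_mem_components hR hA (hmem B hB) ha haB (.inl rfl)]

/-! ### Counting clusters -/

variable (R) in
/-- The sets of points visited by walks of length `k` from `v`. -/
noncomputable def visitedSets : ℕ → V → Finset (Finset V)
  | 0, v => {{v}}
  | k + 1, v => (Finset.univ.filter (R v)).biUnion fun u => (visitedSets k u).image (insert v)

theorem card_visitedSets_le {B : ℕ} (hB : ∀ v, (Finset.univ.filter (R v)).card ≤ B) (k : ℕ)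
    (v : V) : (visitedSets R k v).card ≤ B ^ k := by
  induction k generalizing v with
  | zero => simp [visitedSets]
  | succ k ih =>
    refine Finset.card_biUnion_le.trans ((Finset.sum_le_card_nsmul _ _ (B ^ k) fun u _ =>
      Finset.card_image_le.trans (ih u)).trans ?_)
    rw [smul_eq_mul, pow_succ, mul_comm]
    exact Nat.mul_le_mul_left _ (hB v)

theorem mem_visitedSets_succ {k : ℕ} :
    A ∈ visitedSets R (k + 1) v ↔ ∃ u, R v u ∧ ∃ A' ∈ visitedSets R k u, insert v A' = A := by
  simp [visitedSets]

theorem self_mem_of_mem_visitedSets {k : ℕ} (h : A ∈ visitedSets R k v) : v ∈ A := by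
  cases k with
  | zero => simp_all [visitedSets]
  | succ k =>
    obtain ⟨u, _, A', _, rfl⟩ := mem_visitedSets_succ.1 h
    exact Finset.mem_insert_self _ _

theorem visitedSets_mono (hrefl : ∀ a, R a a) {k l : ℕ} (hkl : k ≤ l)
    (h : A ∈ visitedSets R k v) : A ∈ visitedSets R l v := by
  induction hkl with
  | refl => exact h
  | step _ ih =>
    exact mem_visitedSets_succ.2 ⟨v, hrefl v, A, ih,
      Finset.insert_eq_of_mem (self_mem_of_mem_visitedSets ih)⟩

/-- The walk makes a detour from `a` to `u` and back, which costs two steps and adds one point. -/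
theorem insert_mem_visitedSets (hR : ∀ a b, R a b → R b a) {k : ℕ} (h : A ∈ visitedSets R k v)
    {a : V} (ha : a ∈ A) (hau : R a u) : insert u A ∈ visitedSets R (k + 2) v := by
  have first : ∀ {k : ℕ} {v : V} {A : Finset V}, A ∈ visitedSets R k v → R v u →
      insert u A ∈ visitedSets R (k + 2) v := by
    intro k v A h hvu
    refine mem_visitedSets_succ.2 ⟨u, hvu, insert u A,
      mem_visitedSets_succ.2 ⟨v, hR _ _ hvu, A, h, rfl⟩, ?_⟩
    exact Finset.insert_eq_of_mem (Finset.mem_insert_of_mem (self_mem_of_mem_visitedSets h))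
  induction k generalizing v A with
  | zero =>
    obtain rfl : a = v := by simp_all [visitedSets]
    exact first h hau
  | succ k ih =>
    obtain ⟨w, hvw, A', hA', rfl⟩ := mem_visitedSets_succ.1 h
    rcases Finset.mem_insert.1 ha with rfl | ha
    · exact first h hau
    · exact mem_visitedSets_succ.2 ⟨w, hvw, _, ih hA' ha, Finset.insert_comm _ _ _⟩

/-- A connected set is grown from `v` one neighbouring point at a time, each point costing two
steps. Reflexivity of `R` lets a walk wait, so one length serves all sizes up to `m`. -/
theorem IsCluster.mem_visitedSets (hrefl : ∀ a, R a a) (hR : ∀ a b, R a b → R b a)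
    (hA : IsCluster R A) (hv : v ∈ A) {m : ℕ} (hm : A.card ≤ m) :
    A ∈ visitedSets R (2 * m) v := by
  have key : ∀ j < A.card, ∃ A' ⊆ A, A'.card = j + 1 ∧ A' ∈ visitedSets R (2 * j) v := by
    intro j
    induction j with
    | zero => exact fun _ => ⟨{v}, by simpa using hv, by simp, by simp [visitedSets]⟩
    | succ j ih =>
      intro hj
      obtain ⟨A', hsub, hcard, hmem⟩ := ih (by omega)
      obtain ⟨a, ha, u, hu, huA', hau⟩ : ∃ a ∈ A', ∃ u ∈ A, u ∉ A' ∧ R a u := by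
        by_contra! hcon
        have hAA' : A ⊆ A' := by
          intro w hw
          have hp := hA.2 v hv w hw
          clear hw
          induction hp with
          | refl => exact self_mem_of_mem_visitedSets hmem
          | tail _ hbc ih =>
            by_contra hc
            exact hcon _ ih _ hbc.2.2 hc hbc.1
        have := Finset.card_le_card hAA'
        omega
      exact ⟨insert u A', Finset.insert_subset hu hsub,
        by rw [Finset.card_insert_of_notMem huA', hcard], insert_mem_visitedSets hR hmem ha hau⟩
  have hpos := hA.1.card_pos
  obtain ⟨A', hsub, hcard, hmem⟩ := key (A.card - 1) (by omega)
  obtain rfl := Finset.eq_of_subset_of_card_le hsub (by omega)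
  exact visitedSets_mono hrefl (by omega) hmem

theorem card_clusters_le (hrefl : ∀ a, R a a) (hR : ∀ a b, R a b → R b a) {B : ℕ}
    (hB : ∀ v, (Finset.univ.filter (R v)).card ≤ B) (v : V) (m : ℕ) :
    (Finset.univ.filter fun A : Finset V => IsCluster R A ∧ v ∈ A ∧ A.card ≤ m).card ≤
      B ^ (2 * m) := by
  refine (Finset.card_le_card fun A hA => ?_).trans (card_visitedSets_le hB (2 * m) v)
  obtain ⟨-, h1, h2, h3⟩ := Finset.mem_filter.1 hA
  exact h1.mem_visitedSets hrefl hR h2 h3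

/-- At most `B ^ (2 m)` clusters of size `m` contain a given point, so size `m` contributes at most
`(B² y) ^ m ≤ 2^{-m}`; the tail beyond `L` sums to at most `2^{-L}`. Summing over the points counts
each cluster at least once. -/
theorem sum_clusters_le (hrefl : ∀ a, R a a) (hR : ∀ a b, R a b → R b a) {B : ℕ}
    (hB : ∀ v, (Finset.univ.filter (R v)).card ≤ B) {y : ℝ} (hy : 0 ≤ y)
    (hy2 : (B : ℝ) ^ 2 * y ≤ 1 / 2) (L : ℕ) :
    ∑ A ∈ Finset.univ.filter (fun A : Finset V => IsCluster R A ∧ L < A.card), y ^ A.card ≤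
      Fintype.card V * (1 / 2) ^ L := by
  have hgeom : ∀ n : ℕ, ∑ m ∈ Finset.Ioc L n, (1 / 2 : ℝ) ^ m ≤ (1 / 2) ^ L := by
    intro n
    rcases le_or_gt L n with h | h
    · suffices ∑ m ∈ Finset.Ioc L n, (1 / 2 : ℝ) ^ m = (1 / 2) ^ L - (1 / 2) ^ n by
        rw [this]; linarith [show (0 : ℝ) ≤ (1 / 2) ^ n by positivity]
      induction n, h using Nat.le_induction with
      | base => simp
      | succ n hn ih =>
        rw [Finset.sum_Ioc_succ_top hn, ih]
        ring
    · rw [Finset.Ioc_eq_empty (by omega), Finset.sum_empty]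
      positivity
  have hv : ∀ v : V, ∑ A ∈ Finset.univ.filter
      (fun A : Finset V => (IsCluster R A ∧ L < A.card) ∧ v ∈ A), y ^ A.card ≤ (1 / 2) ^ L := by
    intro v
    refine le_trans ?_ (hgeom (Fintype.card V))
    rw [← Finset.sum_fiberwise_of_maps_to (g := fun A : Finset V => A.card)
      (t := Finset.Ioc L (Fintype.card V))]
    · refine Finset.sum_le_sum fun m _ => ?_
      have h1 : ∀ A ∈ (Finset.univ.filter (fun A : Finset V =>
          (IsCluster R A ∧ L < A.card) ∧ v ∈ A)).filter (fun A => A.card = m),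
          y ^ A.card ≤ y ^ m := fun A hA => by rw [(Finset.mem_filter.1 hA).2]
      refine (Finset.sum_le_card_nsmul _ _ _ h1).trans ?_
      have h2 : ((Finset.univ.filter (fun A : Finset V =>
          (IsCluster R A ∧ L < A.card) ∧ v ∈ A)).filter (fun A => A.card = m)).card ≤
          B ^ (2 * m) := by
        refine (Finset.card_le_card fun A hA => ?_).trans (card_clusters_le hrefl hR hB v m)
        simp only [Finset.mem_filter, Finset.mem_univ, true_and] at hA ⊢
        exact ⟨hA.1.1.1, hA.1.2, hA.2.le⟩
      rw [nsmul_eq_mul]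
      calc _ ≤ ((B ^ (2 * m) : ℕ) : ℝ) * y ^ m :=
            mul_le_mul_of_nonneg_right (by exact_mod_cast h2) (by positivity)
        _ = ((B : ℝ) ^ 2 * y) ^ m := by rw [mul_pow, Nat.cast_pow, pow_mul]
        _ ≤ _ := pow_le_pow_left₀ (by positivity) hy2 m
    · intro A hA
      exact Finset.mem_Ioc.2 ⟨(Finset.mem_filter.1 hA).2.1.2, Finset.card_le_univ A⟩
  calc _ ≤ ∑ A ∈ Finset.univ.filter (fun A : Finset V => IsCluster R A ∧ L < A.card),
        ∑ v : V, if v ∈ A then y ^ A.card else 0 := by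
        refine Finset.sum_le_sum fun A hA => ?_
        obtain ⟨v, hvA⟩ := (Finset.mem_filter.1 hA).2.1.1
        have := Finset.single_le_sum (f := fun v => if v ∈ A then y ^ A.card else 0)
          (fun v _ => by split_ifs <;> positivity) (Finset.mem_univ v)
        simpa [hvA] using this
    _ = ∑ v : V, ∑ A ∈ Finset.univ.filter
          (fun A : Finset V => (IsCluster R A ∧ L < A.card) ∧ v ∈ A), y ^ A.card := by
        rw [Finset.sum_comm]
        refine Finset.sum_congr rfl fun v _ => ?_
        rw [← Finset.sum_filter, Finset.filter_filter]
    _ ≤ ∑ v : V, (1 / 2) ^ L := Finset.sum_le_sum fun v _ => hv v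
    _ = _ := by simp

variable (R) in
/-- All connected components of `S` have at most `L` points. -/
def SmallComponents (L : ℕ) (S : Finset V) : Prop := ∀ A ∈ components R S, A.card ≤ L

variable (R) in
/-- All connected components of `S` have more than `L` points. -/
def LargeComponents (L : ℕ) (S : Finset V) : Prop := ∀ A ∈ components R S, L < A.card

/-- A set is determined by its components and its weight is the product of theirs. Forgetting that
the components are separated leaves the sum over all families of large clusters, a product of
factors `1 + y ^ |A| ≤ exp (y ^ |A|)`. -/
theorem sum_largeComponents_le (hR : ∀ a b, R a b → R b a) {y : ℝ} (hy : 0 ≤ y) (L : ℕ) :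
    ∑ U ∈ Finset.univ.filter (LargeComponents R L), y ^ U.card ≤
      Real.exp (∑ A ∈ Finset.univ.filter (fun A : Finset V => IsCluster R A ∧ L < A.card),
        y ^ A.card) := by
  set 𝒞 := Finset.univ.filter (fun A : Finset V => IsCluster R A ∧ L < A.card) with h𝒞
  have h1 : ∑ U ∈ Finset.univ.filter (LargeComponents R L), y ^ U.card =
      ∑ 𝒜 ∈ (Finset.univ.filter (LargeComponents R L)).image (components R),
        ∏ A ∈ 𝒜, y ^ A.card := by
    rw [Finset.sum_image]
    · refine Finset.sum_congr rfl fun U _ => ?_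
      rw [Finset.prod_pow_eq_pow_sum, ← card_eq_sum_components hR]
    · intro U _ U' _ h
      rw [← biUnion_components (R := R) (S := U), ← biUnion_components (R := R) (S := U')]
      rw [h]
  rw [h1, Real.exp_sum]
  calc _ ≤ ∑ 𝒜 ∈ 𝒞.powerset, ∏ A ∈ 𝒜, y ^ A.card := by
        refine Finset.sum_le_sum_of_subset_of_nonneg ?_ fun _ _ _ => by positivity
        intro 𝒜 h
        obtain ⟨U, hU, rfl⟩ := Finset.mem_image.1 h
        refine Finset.mem_powerset.2 fun A hA => Finset.mem_filter.2 ⟨Finset.mem_univ _,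
          isCluster_of_mem_components hR hA, (Finset.mem_filter.1 hU).2 A hA⟩
    _ = ∏ A ∈ 𝒞, (1 + y ^ A.card) := (Finset.prod_one_add 𝒞).symm
    _ ≤ _ := by
        refine Finset.prod_le_prod (fun _ _ => by positivity) fun A _ => ?_
        rw [add_comm]
        exact Real.add_one_le_exp _

omit [Fintype V] in
/-- Inclusion-exclusion over the large components of a set. -/
theorem sum_neg_one_pow_card_components (hR : ∀ a b, R a b → R b a) (L : ℕ) (S : Finset V) :
    ∑ U ∈ S.powerset.filter (fun U => LargeComponents R L U ∧ Separated R U (S \ U)),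
      (-1 : ℤ) ^ (components R U).card = if SmallComponents R L S then 1 else 0 := by
  set 𝒞 := (components R S).filter fun A => L < A.card with h𝒞
  have h1 : ∑ U ∈ S.powerset.filter (fun U => LargeComponents R L U ∧ Separated R U (S \ U)),
      (-1 : ℤ) ^ (components R U).card = ∑ 𝒜 ∈ 𝒞.powerset, (-1 : ℤ) ^ 𝒜.card := by
    -- Separation of `U` from the rest of `S` says precisely that the components of `U` are
    -- components of `S`, so `U` corresponds to a family of large components.
    refine Finset.sum_nbij' (components R) (fun 𝒜 => 𝒜.biUnion id) ?_ ?_ ?_ ?_ ?_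
    · intro U hU
      obtain ⟨h1, h2, h3⟩ := Finset.mem_filter.1 hU
      rw [Finset.mem_powerset] at h1
      refine Finset.mem_powerset.2 fun A hA => Finset.mem_filter.2 ⟨?_, h2 A hA⟩
      refine mem_components_of_isCluster (isCluster_of_mem_components hR hA)
        ((subset_of_mem_components hA).trans h1) fun a ha w hw haw => ?_
      have haU := subset_of_mem_components hA ha
      by_cases hwU : w ∈ U
      · exact mem_of_step_of_mem_components hA ha hwU haw
      · exact absurd haw (h3 a haU w (Finset.mem_sdiff.2 ⟨hw, hwU⟩))
    · intro 𝒜 h𝒜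
      rw [Finset.mem_powerset] at h𝒜
      have hsub : 𝒜 ⊆ components R S := h𝒜.trans (Finset.filter_subset _ _)
      refine Finset.mem_filter.2 ⟨Finset.mem_powerset.2 ?_, ?_, ?_⟩
      · conv_rhs => rw [← biUnion_components (R := R) (S := S)]
        exact Finset.biUnion_subset_biUnion_of_subset_left _ hsub
      · intro A hA
        rw [components_biUnion hR hsub] at hA
        exact (Finset.mem_filter.1 (h𝒜 hA)).2
      · intro a ha b hb hab
        obtain ⟨A, hA, haA⟩ := Finset.mem_biUnion.1 ha
        obtain ⟨hbS, hbn⟩ := Finset.mem_sdiff.1 hb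
        exact hbn (Finset.mem_biUnion.2 ⟨A, hA,
          mem_of_step_of_mem_components (hsub hA) haA hbS hab⟩)
    · exact fun U _ => biUnion_components
    · intro 𝒜 h𝒜
      rw [Finset.mem_powerset] at h𝒜
      exact components_biUnion hR (h𝒜.trans (Finset.filter_subset _ _))
    · exact fun _ _ => rfl
  rw [h1, Finset.sum_powerset_neg_one_pow_card]
  refine if_congr ?_ rfl rfl
  rw [h𝒞, Finset.filter_eq_empty_iff]
  simp only [not_lt]
  rfl

/-- A function that factorizes over separated sets, summed over the sets with small components. -/
theorem sum_smallComponents {𝔸 : Type*} [Ring 𝔸] (hR : ∀ a b, R a b → R b a)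
    (hrefl : ∀ a, R a a) (f : Finset V → 𝔸)
    (hf : ∀ S S', Separated R S S' → f (S ∪ S') = f S * f S') (L : ℕ) :
    ∑ S ∈ Finset.univ.filter (SmallComponents R L), f S =
      ∑ U ∈ Finset.univ.filter (LargeComponents R L),
        (-1 : ℤ) ^ (components R U).card • (f U * ∑ S ∈ (nbhd R U)ᶜ.powerset, f S) := by
  have h1 : ∑ S ∈ Finset.univ.filter (SmallComponents R L), f S =
      ∑ S : Finset V, ∑ U : Finset V,
        if U ⊆ S ∧ LargeComponents R L U ∧ Separated R U (S \ U) then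
          (-1 : ℤ) ^ (components R U).card • f S else 0 := by
    rw [Finset.sum_filter]
    refine Finset.sum_congr rfl fun S _ => ?_
    have := sum_neg_one_pow_card_components (R := R) hR L S
    rw [← Finset.sum_filter, ← Finset.sum_smul]
    have hfil : (Finset.univ.filter fun U => U ⊆ S ∧ LargeComponents R L U ∧
        Separated R U (S \ U)) =
        S.powerset.filter (fun U => LargeComponents R L U ∧ Separated R U (S \ U)) := by
      ext U; simp
    rw [hfil, this]
    split_ifs <;> simp
  rw [h1, Finset.sum_comm, Finset.sum_filter]
  refine Finset.sum_congr rfl fun U _ => ?_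
  split_ifs with hU
  · rw [Finset.mul_sum, Finset.smul_sum, ← Finset.sum_filter]
    have hdisj : ∀ S' ⊆ (nbhd R U)ᶜ, Separated R U S' := fun S' h a ha b hb hab =>
      Finset.mem_compl.1 (h hb) (Finset.mem_filter.2 ⟨Finset.mem_univ _, a, ha, hab⟩)
    -- For fixed `U`, removing `U` identifies the admissible `S` with all subsets of the complement
    -- of the neighbourhood. The remaining sum is therefore unrestricted.
    refine Finset.sum_nbij' (fun S => S \ U) (fun S' => U ∪ S') ?_ ?_ ?_ ?_ ?_
    · intro S hS
      obtain ⟨-, h1, h2, h3⟩ := Finset.mem_filter.1 hS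
      refine Finset.mem_powerset.2 fun b hb => Finset.mem_compl.2 fun hbU => ?_
      obtain ⟨-, a, ha, hab⟩ := Finset.mem_filter.1 hbU
      exact h3 a ha b hb hab
    · intro S' hS'
      rw [Finset.mem_powerset] at hS'
      refine Finset.mem_filter.2 ⟨Finset.mem_univ _, Finset.subset_union_left, hU, ?_⟩
      refine hdisj _ (subset_trans ?_ hS')
      intro x hx
      simp only [Finset.mem_sdiff, Finset.mem_union] at hx
      tauto
    · intro S hS
      exact Finset.union_sdiff_of_subset (Finset.mem_filter.1 hS).2.1
    · intro S' hS'
      rw [Finset.mem_powerset] at hS'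
      rw [Finset.union_sdiff_left, Finset.sdiff_eq_self_iff_disjoint]
      exact Finset.disjoint_right.2 fun a ha ha' => hdisj S' hS' a ha a ha' (hrefl a)
    · intro S hS
      obtain ⟨-, h1, h2, h3⟩ := Finset.mem_filter.1 hS
      rw [← hf _ _ h3, Finset.union_sdiff_of_subset h1]
  · refine Finset.sum_eq_zero fun S _ => if_neg fun h => hU h.2.1

end Clusters

end ThermalLattice

namespace ThermalLattice

/-! ### Möbius inversion over finite sets. -/

section AlternatingSum

open scoped Classical

variable {V M : Type*} [AddCommGroup M]

/-- The alternating sum of `g` over the subsets of `S`. -/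
noncomputable def altSum (g : Finset V → M) (S : Finset V) : M :=
  ∑ T ∈ S.powerset, (-1 : ℤ) ^ (S \ T).card • g T

theorem altSum_empty (g : Finset V → M) : altSum g ∅ = g ∅ := by simp [altSum]

theorem altSum_insert (g : Finset V → M) {S : Finset V} {x : V} (hx : x ∉ S) :
    altSum g (insert x S) = altSum (fun T => g (insert x T)) S - altSum g S := by
  rw [altSum, Finset.sum_powerset_insert hx, altSum, altSum, sub_eq_neg_add,
    ← Finset.sum_neg_distrib]
  congr 1
  · refine Finset.sum_congr rfl fun T hT => ?_
    have hxT : x ∉ T := fun h => hx (Finset.mem_powerset.1 hT h)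
    rw [Finset.insert_sdiff_of_notMem _ hxT, Finset.card_insert_of_notMem
      (fun h => hx (Finset.mem_sdiff.1 h).1), pow_succ, mul_neg_one, neg_smul]
  · refine Finset.sum_congr rfl fun T hT => ?_
    have : insert x S \ insert x T = S \ T := by
      ext z
      simp only [Finset.mem_sdiff, Finset.mem_insert]
      by_cases hz : z = x
      · subst hz; simp [hx]
      · simp [hz]
    rw [this]

/-- Möbius inversion over the subsets of `W`. -/
theorem sum_altSum (g : Finset V → M) (W : Finset V) : ∑ S ∈ W.powerset, altSum g S = g W := by
  induction W using Finset.induction_on generalizing g with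
  | empty => simp [altSum_empty]
  | insert x W hx ih =>
    have : ∑ S ∈ W.powerset, altSum g (insert x S) =
        ∑ S ∈ W.powerset, (altSum (fun T => g (insert x T)) S - altSum g S) :=
      Finset.sum_congr rfl fun S hS =>
        altSum_insert g fun h => hx (Finset.mem_powerset.1 hS h)
    rw [Finset.sum_powerset_insert hx, this, Finset.sum_sub_distrib, ih, ih]
    abel

/-- Adding one point to `S'` takes a difference in the second factor only, so factorization passes
through the induction. -/
theorem altSum_union {𝔸 : Type*} [Ring 𝔸] {S S' : Finset V} (hd : Disjoint S S')
    (g g₁ g₂ : Finset V → 𝔸) (h : ∀ T ⊆ S, ∀ T' ⊆ S', g (T ∪ T') = g₁ T * g₂ T') :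
    altSum g (S ∪ S') = altSum g₁ S * altSum g₂ S' := by
  induction S' using Finset.induction_on generalizing g g₂ with
  | empty =>
    rw [altSum_empty, Finset.union_empty, altSum, altSum, Finset.sum_mul]
    refine Finset.sum_congr rfl fun T hT => ?_
    have := h T (Finset.mem_powerset.1 hT) ∅ subset_rfl
    rw [Finset.union_empty] at this
    rw [this, smul_mul_assoc]
  | insert x S' hx ih =>
    rw [Finset.disjoint_insert_right] at hd
    rw [Finset.union_insert, altSum_insert g (by simp [hx, hd.1]), altSum_insert g₂ hx, mul_sub,
      ih hd.2 (fun T => g (insert x T)) (fun T => g₂ (insert x T)), ih hd.2 g g₂]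
    · exact fun T hT T' hT' => h T hT T' (hT'.trans (Finset.subset_insert _ _))
    · intro T hT T' hT'
      rw [← Finset.union_insert]
      exact h T hT _ (Finset.insert_subset_insert _ hT')

theorem sum_filter_mem_eq (g : Finset V → M) {S : Finset V} {i : V} (hi : i ∈ S) :
    ∑ T ∈ S.powerset.filter (fun T => i ∈ T), (-1 : ℤ) ^ (S \ T).card • g T =
      altSum g S + altSum g (S.erase i) := by
  have h1 := Finset.sum_filter_add_sum_filter_not S.powerset (fun T => i ∈ T)
    fun T => (-1 : ℤ) ^ (S \ T).card • g T
  have h2 : ∑ T ∈ S.powerset.filter (fun T => i ∉ T), (-1 : ℤ) ^ (S \ T).card • g T =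
      - altSum g (S.erase i) := by
    rw [altSum, ← Finset.sum_neg_distrib]
    have : S.powerset.filter (fun T => i ∉ T) = (S.erase i).powerset := by
      ext T
      simp only [Finset.mem_filter, Finset.mem_powerset, Finset.subset_erase]
    rw [this]
    refine Finset.sum_congr rfl fun T hT => ?_
    rw [Finset.mem_powerset, Finset.subset_erase] at hT
    have h3 : S \ T = insert i (S.erase i \ T) := by
      ext z
      simp only [Finset.mem_sdiff, Finset.mem_insert, Finset.mem_erase]
      by_cases hz : z = i
      · subst hz; simp [hi, hT.2]
      · simp [hz]
    rw [h3, Finset.card_insert_of_notMem (by simp), pow_succ, mul_neg_one, neg_smul]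
  rw [h2] at h1
  rw [altSum, ← h1]
  abel

/-- The alternating sum of the power is the sum over words of letters `a i` in which every point of
`S` occurs. After a first letter `i`, the rest of the word uses all of `S` or exactly `S.erase i`.
-/
theorem altSum_pow_succ {𝔸 : Type*} [Ring 𝔸] (a : V → 𝔸) (m : ℕ) (S : Finset V) :
    altSum (fun T => (∑ i ∈ T, a i) ^ (m + 1)) S =
      ∑ i ∈ S, a i * (altSum (fun T => (∑ i ∈ T, a i) ^ m) S +
        altSum (fun T => (∑ i ∈ T, a i) ^ m) (S.erase i)) := by
  have h1 : ∀ T ∈ S.powerset, (-1 : ℤ) ^ (S \ T).card • (∑ i ∈ T, a i) ^ (m + 1) =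
      ∑ i ∈ S, if i ∈ T then a i * ((-1 : ℤ) ^ (S \ T).card • (∑ i ∈ T, a i) ^ m) else 0 := by
    intro T hT
    rw [← Finset.sum_filter, pow_succ', Finset.sum_mul, Finset.smul_sum]
    have : S.filter (fun i => i ∈ T) = T := by
      rw [Finset.filter_mem_eq_inter, Finset.inter_eq_right.2 (Finset.mem_powerset.1 hT)]
    rw [this]
    exact Finset.sum_congr rfl fun i _ => (mul_smul_comm _ _ _).symm
  rw [altSum, Finset.sum_congr rfl h1, Finset.sum_comm]
  refine Finset.sum_congr rfl fun i hi => ?_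
  rw [← sum_filter_mem_eq _ hi, Finset.mul_sum, ← Finset.sum_filter]

/-- The recursion on words has no minus signs, so the triangle inequality compares it with the same
recursion for the scalar `t`. Estimating the alternating sum directly would lose the cancellation.
-/
theorem norm_altSum_pow_le {𝔸 : Type*} [NormedRing 𝔸] [NormOneClass 𝔸] {a : V → 𝔸} {t : ℝ}
    (ha : ∀ i, ‖a i‖ ≤ t) (m : ℕ) (S : Finset V) :
    ‖altSum (fun T => (∑ i ∈ T, a i) ^ m) S‖ ≤ altSum (fun T => (∑ _i ∈ T, t) ^ m) S := by
  induction m generalizing S with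
  | zero =>
    induction S using Finset.induction_on with
    | empty => simp [altSum_empty]
    | insert x S hx _ =>
      simp only [pow_zero]
      rw [altSum_insert _ hx, altSum_insert _ hx, sub_self, sub_self, norm_zero]
  | succ m ih =>
    rw [altSum_pow_succ, altSum_pow_succ]
    refine (norm_sum_le _ _).trans (Finset.sum_le_sum fun i _ => (norm_mul_le _ _).trans ?_)
    exact mul_le_mul (ha i) ((norm_add_le _ _).trans (add_le_add (ih _) (ih _))) (norm_nonneg _)
      ((norm_nonneg _).trans (ha i))

end AlternatingSum

/-! ### The cluster expansion and its truncation error. -/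

section ClusterExpansion

open scoped Matrix Matrix.Norms.L2Operator ComplexOrder
open scoped Classical
open NormedSpace (exp)

variable {ι : Type*} [Fintype ι] [DecidableEq ι] {V : Type*}

/-- The term of the cluster expansion of `exp (∑ a i)` that belongs to the set `S`. -/
noncomputable def clusterTerm (a : V → Matrix ι ι ℂ) (S : Finset V) : Matrix ι ι ℂ :=
  altSum (fun T => exp (∑ i ∈ T, a i)) S

theorem sum_clusterTerm (a : V → Matrix ι ι ℂ) (W : Finset V) :
    ∑ S ∈ W.powerset, clusterTerm a S = exp (∑ i ∈ W, a i) := sum_altSum _ W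

theorem clusterTerm_empty (a : V → Matrix ι ι ℂ) : clusterTerm a ∅ = 1 := by
  simp [clusterTerm, altSum_empty]

/-- Terms belonging to separated sets commute, so the exponentials factorize for all pairs of
subsets and `altSum_union` applies. -/
theorem clusterTerm_union {a : V → Matrix ι ι ℂ} {R : V → V → Prop} (hrefl : ∀ i, R i i)
    (hcomm : ∀ i j, ¬ R i j → Commute (a i) (a j)) {S S' : Finset V} (h : Separated R S S') :
    clusterTerm a (S ∪ S') = clusterTerm a S * clusterTerm a S' := by
  have hd : Disjoint S S' := Finset.disjoint_left.2 fun x hx hx' => h x hx x hx' (hrefl x)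
  refine altSum_union hd _ _ _ fun T hT T' hT' => ?_
  rw [Finset.sum_union (Finset.disjoint_of_subset_left hT (Finset.disjoint_of_subset_right hT' hd))]
  refine Matrix.exp_add_of_commute _ _ ?_
  exact Commute.sum_left _ _ _ fun i hi => Commute.sum_right _ _ _ fun j hj =>
    hcomm i j (h i (hT hi) j (hT' hj))

theorem isHermitian_clusterTerm {a : V → Matrix ι ι ℂ} (ha : ∀ i, (a i).IsHermitian)
    (S : Finset V) : (clusterTerm a S).IsHermitian := by
  rw [clusterTerm, altSum, Matrix.IsHermitian, Matrix.conjTranspose_sum]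
  refine Finset.sum_congr rfl fun T _ => ?_
  have h : (exp (∑ i ∈ T, a i)).IsHermitian := by
    refine Matrix.IsHermitian.exp ?_
    rw [Matrix.IsHermitian, Matrix.conjTranspose_sum]
    exact Finset.sum_congr rfl fun i _ => ha i
  rw [Matrix.conjTranspose_smul, h.eq]
  simp

/-- The exponential series reduces this to powers, where `norm_altSum_pow_le` replaces each `a i` by
`t`; the scalar alternating sum is the binomial expansion of `(e^t - 1) ^ |S|`. -/
theorem norm_clusterTerm_le [Nonempty ι] {a : V → Matrix ι ι ℂ} {t : ℝ} (ha : ∀ i, ‖a i‖ ≤ t)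
    (S : Finset V) : ‖clusterTerm a S‖ ≤ (Real.exp t - 1) ^ S.card := by
  have h1 : HasSum (fun m : ℕ => ((m.factorial : ℂ)⁻¹) •
      altSum (fun T => (∑ i ∈ T, a i) ^ m) S) (clusterTerm a S) := by
    have : HasSum (fun m : ℕ => ∑ T ∈ S.powerset, (-1 : ℤ) ^ (S \ T).card •
        (((m.factorial : ℂ)⁻¹) • (∑ i ∈ T, a i) ^ m)) (clusterTerm a S) :=
      hasSum_sum fun T _ => (NormedSpace.exp_series_hasSum_exp' (∑ i ∈ T, a i)).const_smul _
    convert this using 2 with m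
    rw [altSum, Finset.smul_sum]
    exact Finset.sum_congr rfl fun T _ => smul_comm _ _ _
  have h2 : HasSum (fun m : ℕ => ((m.factorial : ℝ)⁻¹) •
      altSum (fun T => (∑ _i ∈ T, t) ^ m) S)
      (altSum (fun T => Real.exp (∑ _i ∈ T, t)) S) := by
    have : HasSum (fun m : ℕ => ∑ T ∈ S.powerset, (-1 : ℤ) ^ (S \ T).card •
        (((m.factorial : ℝ)⁻¹) • (∑ _i ∈ T, t) ^ m))
        (altSum (fun T => Real.exp (∑ _i ∈ T, t)) S) := by
      refine hasSum_sum fun T _ => ?_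
      rw [Real.exp_eq_exp_ℝ]
      exact (NormedSpace.exp_series_hasSum_exp' (∑ _i ∈ T, t)).const_smul _
    convert this using 2 with m
    rw [altSum, Finset.smul_sum]
    exact Finset.sum_congr rfl fun T _ => smul_comm _ _ _
  have h3 : altSum (fun T => Real.exp (∑ _i ∈ T, t)) S = (Real.exp t - 1) ^ S.card := by
    rw [sub_eq_add_neg, ← Finset.sum_pow_mul_eq_add_pow, altSum]
    refine Finset.sum_congr rfl fun T hT => ?_
    rw [Finset.sum_const, nsmul_eq_mul, Real.exp_nat_mul,
      Finset.card_sdiff_of_subset (Finset.mem_powerset.1 hT), zsmul_eq_mul, mul_comm]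
    push_cast
    rfl
  rw [← h3, ← h1.tsum_eq]
  refine tsum_of_norm_bounded h2 fun m => ?_
  rw [norm_smul, norm_inv, Complex.norm_natCast, smul_eq_mul]
  exact mul_le_mul_of_nonneg_left (norm_altSum_pow_le ha m S) (by positivity)

theorem sum_pow_eq_sum_list_prod {𝔸 κ : Type*} [Semiring 𝔸] [Fintype κ] (g : κ → 𝔸) (m : ℕ) :
    (∑ u, g u) ^ m = ∑ p : Fin m → κ, ((List.finRange m).map fun l => g (p l)).prod := by
  induction m with
  | zero => simp
  | succ m ih =>
    rw [pow_succ', ih, Finset.sum_mul_sum, ← Finset.sum_product', Finset.univ_product_univ]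
    refine Fintype.sum_equiv (Fin.consEquiv fun _ => κ) _ _ fun x => ?_
    rw [List.finRange_succ, List.map_cons, List.prod_cons, List.map_map]
    rfl

omit [Fintype ι] [DecidableEq ι] in
theorem isHermitian_sum {a : V → Matrix ι ι ℂ} (ha : ∀ i, (a i).IsHermitian) (T : Finset V) :
    (∑ i ∈ T, a i).IsHermitian := by
  rw [Matrix.IsHermitian, Matrix.conjTranspose_sum]
  exact Finset.sum_congr rfl fun i _ => ha i

variable [Fintype V]

/-- The cluster expansion of `exp (∑ a i)` without the clusters of more than `L` points. -/
noncomputable def truncatedExp (R : V → V → Prop) (a : V → Matrix ι ι ℂ) (L : ℕ) : Matrix ι ι ℂ :=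
  ∑ S ∈ Finset.univ.filter (SmallComponents R L), clusterTerm a S

theorem isHermitian_truncatedExp {R : V → V → Prop} {a : V → Matrix ι ι ℂ}
    (ha : ∀ i, (a i).IsHermitian) (L : ℕ) : (truncatedExp R a L).IsHermitian := by
  rw [truncatedExp, Matrix.IsHermitian, Matrix.conjTranspose_sum]
  exact Finset.sum_congr rfl fun S _ => isHermitian_clusterTerm ha S

/-- The powers of the truncated cluster expansion approximate those of the exponential in trace
norm, relative to the partition function. -/
theorem norm_trace_truncatedExp_pow_sub_le [Nonempty ι] {R : V → V → Prop} (hrefl : ∀ i, R i i)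
    (hR : ∀ i j, R i j → R j i) {B : ℕ} (hB : ∀ v, (Finset.univ.filter (R v)).card ≤ B)
    {a : V → Matrix ι ι ℂ} (ha : ∀ i, (a i).IsHermitian) {t : ℝ} (hat : ∀ i, ‖a i‖ ≤ t)
    (ht : 0 ≤ t) (hcomm : ∀ i j, ¬ R i j → Commute (a i) (a j))
    (ht2 : (B : ℝ) ^ 2 * ((Real.exp t - 1) * Real.exp (t * B)) ≤ 1 / 2) (L : ℕ) {m : ℕ}
    (hm : 0 < m) (W : Matrix ι ι ℂ) :
    ‖(W * (truncatedExp R a L ^ m - exp ((m : ℂ) • ∑ i, a i))).trace‖ ≤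
      ‖W‖ * ((Real.exp (m * (Fintype.card V * (1 / 2) ^ L)) - 1) *
        (exp ((m : ℂ) • ∑ i, a i)).trace.re) := by
  set Z := (exp ((m : ℂ) • ∑ i, a i)).trace.re with hZ
  set y := (Real.exp t - 1) * Real.exp (t * B) with hy
  have hm1 : 0 ≤ Real.exp t - 1 := sub_nonneg.2 (Real.one_le_exp ht)
  have hy0 : 0 ≤ y := mul_nonneg hm1 (Real.exp_pos _).le
  have hsmul : ∀ (c : ℝ) {K : Matrix ι ι ℂ}, K.IsHermitian → ((c : ℂ) • K).IsHermitian :=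
    fun c K hK => by
      rw [Matrix.IsHermitian, Matrix.conjTranspose_smul, hK.eq, Complex.star_def,
        Complex.conj_ofReal]
  let κ := {U : Finset V // LargeComponents R L U}
  -- This bounds the norm of the terms deleted near `U`. Shifting it from the exponent `K U` into
  -- the coefficient `A U` makes all the exponentials have trace at most `Z`, at the price of the
  -- factor `Real.exp (t * B)` per point in `y`.
  let s : κ → ℝ := fun U => t * B * U.1.card
  let A : κ → Matrix ι ι ℂ := fun U =>
    (Real.exp (s U) : ℂ) • ((-1 : ℤ) ^ (components R U.1).card • clusterTerm a U.1)
  let K : κ → Matrix ι ι ℂ := fun U => ∑ i ∈ (nbhd R U.1)ᶜ, a i - (s U : ℂ) • 1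
  have hexp : ∀ (c : ℝ) (M : Matrix ι ι ℂ), exp (M - (c : ℂ) • 1) = (Real.exp (-c) : ℂ) • exp M := by
    intro c M
    have h1 : M - (c : ℂ) • (1 : Matrix ι ι ℂ) = M + ((-c : ℝ) : ℂ) • 1 := by
      push_cast; rw [neg_smul, sub_eq_add_neg]
    have h2 : exp (((-c : ℝ) : ℂ) • (1 : Matrix ι ι ℂ)) = (Real.exp (-c) : ℂ) • 1 := by
      rw [Matrix.smul_one_eq_diagonal, Matrix.exp_diagonal, Matrix.smul_one_eq_diagonal]
      congr 1
      ext i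
      rw [Pi.coe_exp, ← Complex.exp_eq_exp_ℂ, Complex.ofReal_exp]
    rw [h1, Matrix.exp_add_of_commute _ _ ((Commute.one_right M).smul_right _), h2,
      mul_smul_comm, mul_one]
  have hnb : ∀ U : Finset V, ((nbhd R U).card : ℝ) ≤ B * U.card := by
    intro U
    have : nbhd R U ⊆ U.biUnion fun a => Finset.univ.filter (R a) := by
      intro b hb
      obtain ⟨-, a, ha, hab⟩ := Finset.mem_filter.1 hb
      exact Finset.mem_biUnion.2 ⟨a, ha, Finset.mem_filter.2 ⟨Finset.mem_univ _, hab⟩⟩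
    have h2 := (Finset.card_le_card this).trans
      (Finset.card_biUnion_le_card_mul U _ B fun v _ => hB v)
    rw [mul_comm]
    exact_mod_cast h2
  have hX : truncatedExp R a L = ∑ U : κ, A U * exp (K U) := by
    rw [truncatedExp, sum_smallComponents hR hrefl _
      (fun S S' h => clusterTerm_union hrefl hcomm h) L]
    rw [← Finset.sum_subtype_eq_sum_filter, Finset.subtype_univ]
    refine Finset.sum_congr rfl fun U _ => ?_
    rw [sum_clusterTerm, hexp, smul_mul_assoc, mul_smul_comm, smul_smul, ← Complex.ofReal_mul,
      ← Real.exp_add, add_neg_cancel, Real.exp_zero, Complex.ofReal_one, one_smul, smul_mul_assoc]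
  have hAn : ∀ U : κ, ‖A U‖ ≤ y ^ U.1.card := by
    intro U
    have h1 : ‖(-1 : ℤ) ^ (components R U.1).card • clusterTerm a U.1‖ = ‖clusterTerm a U.1‖ := by
      rcases neg_one_pow_eq_or ℤ (components R U.1).card with h | h <;> simp [h]
    rw [norm_smul, h1, Complex.norm_real, Real.norm_of_nonneg (Real.exp_pos _).le, hy, mul_pow,
      mul_comm, ← Real.exp_nat_mul, mul_comm (U.1.card : ℝ)]
    exact mul_le_mul_of_nonneg_right (norm_clusterTerm_le hat _) (Real.exp_pos _).le
  have hKH : ∀ U, (K U).IsHermitian := fun U =>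
    (isHermitian_sum ha _).sub (hsmul _ Matrix.isHermitian_one)
  -- Restoring the deleted terms costs at most `exp (m * s U)` by `trace_exp_le`, exactly
  -- compensated by the shift.
  have hKZ : ∀ U, (exp ((m : ℂ) • K U)).trace.re ≤ Z := by
    intro U
    have h1 : (m : ℂ) • K U = (m : ℂ) • ∑ i ∈ (nbhd R U.1)ᶜ, a i - ((m * s U : ℝ) : ℂ) • 1 := by
      simp only [K, smul_sub, smul_smul]
      push_cast
      rfl
    rw [h1, hexp, Matrix.trace_smul, smul_eq_mul, Complex.re_ofReal_mul]
    have h2 := trace_exp_le (A := (m : ℂ) • ∑ i ∈ (nbhd R U.1)ᶜ, a i)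
      (B := (m : ℂ) • ∑ i ∈ nbhd R U.1, a i) (hsmul m (isHermitian_sum ha _))
      (hsmul m (isHermitian_sum ha _))
    rw [← smul_add, Finset.sum_compl_add_sum] at h2
    have h3 : ‖(m : ℂ) • ∑ i ∈ nbhd R U.1, a i‖ ≤ m * s U := by
      rw [norm_smul, Complex.norm_natCast]
      refine mul_le_mul_of_nonneg_left ?_ (Nat.cast_nonneg _)
      refine (norm_sum_le _ _).trans ((Finset.sum_le_card_nsmul _ _ t fun i _ => hat i).trans ?_)
      rw [nsmul_eq_mul, mul_comm]
      simp only [s, mul_assoc]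
      exact mul_le_mul_of_nonneg_left (hnb U.1) ht
    have hZ0 : 0 ≤ Z :=
      (Complex.nonneg_iff.1 (posSemidef_exp (hsmul m (isHermitian_sum ha _))).trace_nonneg).1
    have h4 := h2.trans (mul_le_mul_of_nonneg_right (Real.exp_le_exp.2 h3) hZ0)
    have hE : Real.exp (-(m * s U)) * Real.exp (m * s U) = 1 := by
      rw [← Real.exp_add, neg_add_cancel, Real.exp_zero]
    refine (mul_le_mul_of_nonneg_left h4 (Real.exp_pos (-(m * s U))).le).trans (le_of_eq ?_)
    change _ * (_ * Z) = Z
    rw [← mul_assoc, hE, one_mul]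
  have hempty : LargeComponents R L (∅ : Finset V) := by
    intro A hA
    simp [components] at hA
  -- The empty set is the main term: the word consisting only of it is the exact exponential, so the
  -- error is the sum over all other words.
  let e : κ := ⟨∅, hempty⟩
  have hnb0 : nbhd R (∅ : Finset V) = ∅ := by simp [nbhd]
  have he : A e * exp (K e) = exp (∑ i, a i) := by
    simp [A, K, e, s, clusterTerm_empty, components, hnb0]
  have hbase : exp ((m : ℂ) • ∑ i, a i) =
      ((List.finRange m).map fun _ => A e * exp (K e)).prod := by
    rw [he, List.map_const', List.prod_replicate, List.length_finRange, ← Matrix.exp_nsmul,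
      Nat.cast_smul_eq_nsmul]
  have hterm : ∀ p : Fin m → κ,
      ‖(W * ((List.finRange m).map fun l => A (p l) * exp (K (p l))).prod).trace‖ ≤
        ‖W‖ * ((List.finRange m).map fun l => y ^ (p l).1.card).prod * Z := by
    intro p
    have hZ0 : 0 ≤ Z :=
      (Complex.nonneg_iff.1 (posSemidef_exp (hsmul m (isHermitian_sum ha _))).trace_nonneg).1
    refine (norm_trace_prod_exp_le hm (fun l => A (p l)) (fun l => K (p l)) (fun l => hKH _)
      (fun l => hKZ _) W).trans ?_
    refine mul_le_mul_of_nonneg_right (mul_le_mul_of_nonneg_left ?_ (norm_nonneg _)) hZ0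
    exact List.prod_map_le_prod_map₀ _ _ (fun l _ => norm_nonneg _) fun l _ => hAn _
  have hZ0 : 0 ≤ Z :=
    (Complex.nonneg_iff.1 (posSemidef_exp (hsmul m (isHermitian_sum ha _))).trace_nonneg).1
  have hsum : ∑ U : κ, y ^ U.1.card ≤ Real.exp (Fintype.card V * (1 / 2) ^ L) := by
    have h1 := sum_largeComponents_le hR hy0 L
    rw [← Finset.sum_subtype_eq_sum_filter, Finset.subtype_univ] at h1
    exact h1.trans (Real.exp_le_exp.2 (sum_clusters_le hrefl hR hB hy0 ht2 L))
  rw [hX, sum_pow_eq_sum_list_prod]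
  rw [← Finset.add_sum_erase _ _ (Finset.mem_univ fun _ : Fin m => e), ← hbase, add_sub_cancel_left,
    Finset.mul_sum, Matrix.trace_sum]
  have hpow := sum_pow_eq_sum_list_prod (fun U : κ => y ^ U.1.card) m
  rw [← Finset.add_sum_erase _ _ (Finset.mem_univ fun _ : Fin m => e)] at hpow
  have hone : ((List.finRange m).map fun _ => y ^ e.1.card).prod = 1 := by simp [e]
  rw [hone] at hpow
  calc _ ≤ ∑ p ∈ Finset.univ.erase (fun _ : Fin m => e),
        ‖W‖ * ((List.finRange m).map fun l => y ^ (p l).1.card).prod * Z :=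
        (norm_sum_le _ _).trans (Finset.sum_le_sum fun p _ => hterm p)
    _ = ‖W‖ * (((∑ U : κ, y ^ U.1.card) ^ m - 1) * Z) := by
        rw [hpow, add_sub_cancel_left, ← Finset.sum_mul, ← Finset.mul_sum, mul_assoc]
    _ ≤ _ := by
        refine mul_le_mul_of_nonneg_left (mul_le_mul_of_nonneg_right (sub_le_sub_right ?_ 1) hZ0)
          (norm_nonneg _)
        rw [Real.exp_nat_mul]
        exact pow_le_pow_left₀ (Finset.sum_nonneg fun U _ => by positivity) hsum m

end ClusterExpansion

end ThermalLattice

namespace ThermalLattice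

/-! ### Constructions of projected entangled pair operators. -/

section PEPO

open scoped Classical

variable {d n q : ℕ}

theorem exists_injOn_fin {Y : Type*} (s : Finset Y) {D : ℕ} (hD : 0 < D) (h : s.card ≤ D) :
    ∃ enc : Y → Fin D, Set.InjOn enc s := by
  refine ⟨fun y => if hy : y ∈ s then Fin.castLE h (s.equivFin ⟨y, hy⟩) else ⟨0, hD⟩, ?_⟩
  intro y hy z hz hyz
  rw [Finset.mem_coe] at hy hz
  simp only [dif_pos hy, dif_pos hz] at hyz
  have := s.equivFin.injective (Fin.castLE_injective h hyz)
  exact congrArg Subtype.val this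

/-- A sum over local states at the sites that agree along the edges is a projected entangled
pair operator. -/
theorem isPEPO_of_localStates {X Y : Type*} {D : ℕ} (hD : 0 < D) (𝒳 : Site d n → Finset X)
    (w : Site d n → X → Matrix (Fin q) (Fin q) ℂ) (φ : Sym2 (Site d n) → X → Y)
    (𝓛 : Sym2 (Site d n) → Finset Y) (hcard : ∀ e ∈ (latticeGraph d n).edgeSet, (𝓛 e).card ≤ D)
    (hφ : ∀ i, ∀ x ∈ 𝒳 i, ∀ e ∈ (latticeGraph d n).incidenceSet i, φ e x ∈ 𝓛 e)
    {M : SpinMatrix d n q}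
    (hM : ∀ s t, M s t = ∑ x ∈ (Fintype.piFinset 𝒳).filter
      (fun x => ∀ i j, (latticeGraph d n).Adj i j → φ s(i, j) (x i) = φ s(i, j) (x j)),
        ∏ i, w i (x i) (s i) (t i)) : IsPEPO D M := by
  choose enc henc using fun e : (latticeGraph d n).edgeSet =>
    exists_injOn_fin (𝓛 e.1) hD (hcard e.1 e.2)
  -- The tensor at a site sums over those local states whose edge labels are the given bond indices;
  -- `enc` turns labels into indices.
  refine ⟨fun i c => ∑ x ∈ 𝒳 i, if ∀ e : (latticeGraph d n).incidenceSet i,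
    enc ⟨e.1, (latticeGraph d n).incidenceSet_subset i e.2⟩ (φ e.1 x) = c e then w i x else 0, ?_⟩
  ext s t
  rw [hM, pepo]
  have h1 : ∀ (b : (latticeGraph d n).edgeSet → Fin D),
      (∏ i, (∑ x ∈ 𝒳 i, if ∀ e : (latticeGraph d n).incidenceSet i,
        enc ⟨e.1, (latticeGraph d n).incidenceSet_subset i e.2⟩ (φ e.1 x) =
          b ⟨e.1, (latticeGraph d n).incidenceSet_subset i e.2⟩ then w i x else 0 :
          Matrix (Fin q) (Fin q) ℂ) (s i) (t i)) =
      ∑ x ∈ Fintype.piFinset 𝒳, if ∀ i, ∀ e : (latticeGraph d n).incidenceSet i,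
        enc ⟨e.1, (latticeGraph d n).incidenceSet_subset i e.2⟩ (φ e.1 (x i)) =
          b ⟨e.1, (latticeGraph d n).incidenceSet_subset i e.2⟩ then
        ∏ i, w i (x i) (s i) (t i) else 0 := by
    intro b
    simp_rw [Matrix.sum_apply]
    rw [Finset.prod_univ_sum]
    refine Finset.sum_congr rfl fun x _ => ?_
    have h2 : ∀ i, (if ∀ e : (latticeGraph d n).incidenceSet i,
        enc ⟨e.1, (latticeGraph d n).incidenceSet_subset i e.2⟩ (φ e.1 (x i)) =
          b ⟨e.1, (latticeGraph d n).incidenceSet_subset i e.2⟩ then w i (x i) else 0 :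
          Matrix (Fin q) (Fin q) ℂ) (s i) (t i) = if ∀ e : (latticeGraph d n).incidenceSet i,
        enc ⟨e.1, (latticeGraph d n).incidenceSet_subset i e.2⟩ (φ e.1 (x i)) =
          b ⟨e.1, (latticeGraph d n).incidenceSet_subset i e.2⟩ then w i (x i) (s i) (t i)
          else 0 := fun i => by split_ifs <;> rfl
    simp_rw [h2]
    rw [Finset.prod_ite_zero]
    simp only [Finset.mem_univ, true_imp_iff]
  simp_rw [h1]
  rw [Finset.sum_comm, Finset.sum_filter]
  refine Finset.sum_congr rfl fun x hx => ?_
  rw [Fintype.mem_piFinset] at hx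
  have hinc : ∀ {i j}, (h : (latticeGraph d n).Adj i j) →
      s(i, j) ∈ (latticeGraph d n).incidenceSet i ∧ s(i, j) ∈ (latticeGraph d n).incidenceSet j :=
    fun h => ⟨⟨h, Sym2.mem_mk_left _ _⟩, ⟨h, Sym2.mem_mk_right _ _⟩⟩
  split_ifs with hc
  · have hex : ∀ e : (latticeGraph d n).edgeSet, ∃ i, i ∈ e.1 := fun e =>
      ⟨_, Sym2.out_fst_mem e.1⟩
    choose pt hpt using hex
    -- When the states agree along the edges, exactly one bond assignment is compatible, read off at
    -- either end. Otherwise there is none, since `enc` is injective on the labels that occur.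
    rw [Finset.sum_eq_single fun e => enc e (φ e.1 (x (pt e)))]
    · rw [if_pos]
      intro i e
      congr 1
      obtain ⟨e, he⟩ := e
      have hp := hpt ⟨e, (latticeGraph d n).incidenceSet_subset i he⟩
      by_cases hi : i = pt ⟨e, (latticeGraph d n).incidenceSet_subset i he⟩
      · rw [← hi]
      · have : e = s(i, pt ⟨e, (latticeGraph d n).incidenceSet_subset i he⟩) :=
          (Sym2.mem_and_mem_iff hi).1 ⟨he.2, hp⟩
        have hadj : (latticeGraph d n).Adj i
            (pt ⟨e, (latticeGraph d n).incidenceSet_subset i he⟩) := by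
          have h3 := he.1
          rw [this] at h3
          exact h3
        have h4 := hc _ _ hadj
        rwa [← this] at h4
    · intro b _ hb
      refine if_neg fun hall => hb ?_
      funext e
      exact (hall (pt e) ⟨e.1, e.2, hpt e⟩).symm
    · exact fun h => absurd (Finset.mem_univ _) h
  · refine (Finset.sum_eq_zero fun b _ => if_neg fun hall => hc fun i j hij => ?_).symm
    have h1 := hall i ⟨_, (hinc hij).1⟩
    have h2 := hall j ⟨_, (hinc hij).2⟩
    exact henc ⟨s(i, j), hij⟩ (hφ i _ (hx i) _ (hinc hij).1) (hφ j _ (hx j) _ (hinc hij).2)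
      (h1.trans h2.symm)

theorem IsPEPO.mul {D D' : ℕ} {M M' : SpinMatrix d n q} (h : IsPEPO D M) (h' : IsPEPO D' M') :
    IsPEPO (D * D') (M * M') := by
  obtain ⟨A, rfl⟩ := h
  obtain ⟨A', rfl⟩ := h'
  refine ⟨fun i c => A i (fun e => (finProdFinEquiv.symm (c e)).1) *
    A' i (fun e => (finProdFinEquiv.symm (c e)).2), ?_⟩
  ext s t
  have h1 : pepo (fun i c => A i (fun e => (finProdFinEquiv.symm (c e)).1) *
    A' i (fun e => (finProdFinEquiv.symm (c e)).2)) s t =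
      ∑ b : (latticeGraph d n).edgeSet → Fin (D * D'), ∑ u : Site d n → Fin q,
        (∏ i, A i (fun e => (finProdFinEquiv.symm
          (b ⟨e.1, (latticeGraph d n).incidenceSet_subset i e.2⟩)).1) (s i) (u i)) *
        ∏ i, A' i (fun e => (finProdFinEquiv.symm
          (b ⟨e.1, (latticeGraph d n).incidenceSet_subset i e.2⟩)).2) (u i) (t i) := by
    rw [pepo]
    refine Finset.sum_congr rfl fun b _ => ?_
    simp_rw [Matrix.mul_apply, ← Finset.prod_mul_distrib]
    rw [Finset.prod_univ_sum, Fintype.piFinset_univ]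
  rw [h1, Finset.sum_comm, Matrix.mul_apply]
  refine Finset.sum_congr rfl fun u _ => ?_
  rw [pepo, pepo, Finset.sum_mul_sum, ← Finset.sum_product', Finset.univ_product_univ]
  refine Fintype.sum_equiv ((Equiv.arrowProdEquivProdArrow _ (fun _ => Fin D)
    (fun _ => Fin D')).symm.trans (Equiv.arrowCongr (Equiv.refl _) finProdFinEquiv)) _ _ fun x => ?_
  simp [Equiv.arrowProdEquivProdArrow]

/-- The scalar is put into the tensor of one site, which is why a site must exist. -/
theorem IsPEPO.smul {D : ℕ} {M : SpinMatrix d n q} (h : IsPEPO D M) [Nonempty (Site d n)]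
    (c : ℂ) : IsPEPO D (c • M) := by
  obtain ⟨A, rfl⟩ := h
  obtain ⟨i₀⟩ := ‹Nonempty (Site d n)›
  refine ⟨fun i b => (if i = i₀ then c else 1) • A i b, ?_⟩
  ext s t
  rw [Matrix.smul_apply, pepo, pepo, smul_eq_mul, Finset.mul_sum]
  refine Finset.sum_congr rfl fun b _ => ?_
  simp_rw [Matrix.smul_apply, smul_eq_mul, Finset.prod_mul_distrib]
  rw [Finset.prod_ite_eq' Finset.univ i₀ fun _ => c, if_pos (Finset.mem_univ _)]

theorem isPEPO_one : IsPEPO 1 (1 : SpinMatrix d n q) := by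
  refine ⟨fun _ _ => 1, ?_⟩
  ext s t
  rw [pepo, Fintype.sum_unique]
  simp only [Matrix.one_apply]
  rw [Finset.prod_ite_zero]
  simp only [Finset.mem_univ, true_imp_iff, Finset.prod_const_one]
  exact if_congr funext_iff rfl rfl

theorem isPEPO_zero [Nonempty (Site d n)] : IsPEPO 1 (0 : SpinMatrix d n q) := by
  have := (isPEPO_one (d := d) (n := n) (q := q)).smul 0
  rwa [zero_smul] at this

theorem IsPEPO.pow {D : ℕ} {M : SpinMatrix d n q} (h : IsPEPO D M) (m : ℕ) :
    IsPEPO (D ^ m) (M ^ m) := by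
  induction m with
  | zero => exact isPEPO_one
  | succ m ih =>
    rw [pow_succ, pow_succ]
    exact ih.mul h

end PEPO

/-! ### Matrices acting on a set of sites. -/

section Locality

variable {V κ : Type*} [Fintype V] [Fintype κ] [DecidableEq V] [DecidableEq κ]

/-- `M` acts only on the sites of `S`, in terms of its matrix elements. -/
def LocalOn (S : Finset V) (M : Matrix (V → κ) (V → κ) ℂ) : Prop :=
  (∀ s t, M s t ≠ 0 → ∀ i, i ∉ S → s i = t i) ∧
  ∀ s t s' t' : V → κ, (∀ i, i ∉ S → s i = t i) → (∀ i, i ∉ S → s' i = t' i) →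
    (∀ i ∈ S, s i = s' i) → (∀ i ∈ S, t i = t' i) → M s t = M s' t'

variable {S S' : Finset V} {M M' : Matrix (V → κ) (V → κ) ℂ}

omit [Fintype V] [Fintype κ] [DecidableEq V] [DecidableEq κ] in
theorem LocalOn.apply_eq_zero (h : LocalOn S M) {s t : V → κ} (hst : ¬ ∀ i, i ∉ S → s i = t i) :
    M s t = 0 := by
  by_contra hne
  exact hst (h.1 s t hne)

omit [Fintype κ] in
theorem localOn_one : LocalOn S (1 : Matrix (V → κ) (V → κ) ℂ) := by
  constructor
  · intro s t h i _
    by_contra hne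
    exact h (Matrix.one_apply_ne fun hst => hne (congrFun hst i))
  · intro s t s' t' h h' hs ht
    have : s = t ↔ s' = t' := by
      constructor
      · rintro rfl
        funext i
        by_cases hi : i ∈ S
        · rw [← hs i hi, ← ht i hi]
        · exact h' i hi
      · rintro rfl
        funext i
        by_cases hi : i ∈ S
        · rw [hs i hi, ht i hi]
        · exact h i hi
    rw [Matrix.one_apply, Matrix.one_apply]
    exact if_congr this rfl rfl

omit [Fintype V] [Fintype κ] [DecidableEq V] [DecidableEq κ] in
theorem LocalOn.add (h : LocalOn S M) (h' : LocalOn S M') : LocalOn S (M + M') := by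
  constructor
  · intro s t hne
    by_contra hc
    exact hne (by rw [Matrix.add_apply, h.apply_eq_zero hc, h'.apply_eq_zero hc, add_zero])
  · intro s t s' t' a b c e
    rw [Matrix.add_apply, Matrix.add_apply, h.2 s t s' t' a b c e, h'.2 s t s' t' a b c e]

omit [Fintype V] [Fintype κ] [DecidableEq V] [DecidableEq κ] in
theorem LocalOn.smul (h : LocalOn S M) (c : ℂ) : LocalOn S (c • M) := by
  constructor
  · intro s t hne
    by_contra hc
    exact hne (by rw [Matrix.smul_apply, h.apply_eq_zero hc, smul_zero])
  · intro s t s' t' a b c e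
    rw [Matrix.smul_apply, Matrix.smul_apply, h.2 s t s' t' a b c e]

omit [Fintype V] [Fintype κ] [DecidableEq V] [DecidableEq κ] in
theorem localOn_zero : LocalOn S (0 : Matrix (V → κ) (V → κ) ℂ) :=
  ⟨fun _ _ h => absurd rfl h, fun _ _ _ _ _ _ _ _ => rfl⟩

omit [Fintype V] [Fintype κ] [DecidableEq V] [DecidableEq κ] in
theorem LocalOn.sum {α : Type*} {f : α → Matrix (V → κ) (V → κ) ℂ} {T : Finset α}
    (h : ∀ x ∈ T, LocalOn S (f x)) : LocalOn S (∑ x ∈ T, f x) :=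
  Finset.sum_induction _ _ (fun _ _ => LocalOn.add) localOn_zero h

omit [Fintype V] [Fintype κ] [DecidableEq V] [DecidableEq κ] in
theorem LocalOn.mono (h : LocalOn S M) (hS : S ⊆ S') : LocalOn S' M := by
  constructor
  · exact fun s t hne i hi => h.1 s t hne i fun hi' => hi (hS hi')
  · intro s t s' t' a b c e
    by_cases hst : ∀ i, i ∉ S → s i = t i
    · refine h.2 s t s' t' hst (fun i hi => ?_) (fun i hi => c i (hS hi)) fun i hi => e i (hS hi)
      by_cases hi' : i ∈ S'
      · rw [← c i hi', ← e i hi']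
        exact hst i hi
      · exact b i hi'
    · rw [h.apply_eq_zero hst, h.apply_eq_zero fun hst' => hst fun i hi => ?_]
      by_cases hi' : i ∈ S'
      · rw [c i hi', e i hi']
        exact hst' i hi
      · exact a i hi'

omit [Fintype V] [Fintype κ] [DecidableEq V] [DecidableEq κ] in
theorem LocalOn.conjTranspose (h : LocalOn S M) : LocalOn S M.conjTranspose := by
  constructor
  · intro s t hne i hi
    refine (h.1 t s (fun h0 => hne ?_) i hi).symm
    rw [Matrix.conjTranspose_apply, h0, star_zero]
  · intro s t s' t' a b c e
    rw [Matrix.conjTranspose_apply, Matrix.conjTranspose_apply,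
      h.2 t s t' s' (fun i hi => (a i hi).symm) (fun i hi => (b i hi).symm) e c]

/-- The product of two matrices acting on disjoint sets of sites. -/
theorem LocalOn.mul_apply_of_disjoint (h : LocalOn S M) (h' : LocalOn S' M')
    (hd : Disjoint S S') (s t : V → κ) :
    (M * M') s t = if ∀ i, i ∉ S ∪ S' → s i = t i then
      M s (S.piecewise t s) * M' s (S'.piecewise t s) else 0 := by
  have hS' : ∀ i ∈ S, i ∉ S' := fun i hi => Finset.disjoint_left.1 hd hi
  rw [Matrix.mul_apply]
  -- Only one intermediate configuration contributes: the first matrix changes `s` on `S` only, and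
  -- the second leaves `S` alone, so the values there are already those of `t`.
  have key : ∀ u, M s u * M' u t ≠ 0 → (∀ i, i ∉ S ∪ S' → s i = t i) ∧ u = S.piecewise t s := by
    intro u hu
    have h1 := h.1 s u (left_ne_zero_of_mul hu)
    have h2 := h'.1 u t (right_ne_zero_of_mul hu)
    refine ⟨fun i hi => ?_, funext fun i => ?_⟩
    · rw [Finset.mem_union, not_or] at hi
      rw [h1 i hi.1, h2 i hi.2]
    · by_cases hi : i ∈ S
      · rw [Finset.piecewise_eq_of_mem _ _ _ hi]
        exact h2 i (hS' i hi)
      · rw [Finset.piecewise_eq_of_notMem _ _ _ hi]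
        exact (h1 i hi).symm
  split_ifs with hst
  · rw [Finset.sum_eq_single (S.piecewise t s)]
    · congr 1
      refine h'.2 _ _ _ _ (fun i hi => ?_) (fun i hi => ?_) (fun i hi => ?_) fun i hi => ?_
      · by_cases hi' : i ∈ S
        · simp [hi']
        · simp only [hi', not_false_eq_true, Finset.piecewise_eq_of_notMem]
          exact hst i (by simp [hi, hi'])
      · simp [hi]
      · simp [Finset.disjoint_right.1 hd hi]
      · simp [hi]
    · intro u _ hu
      by_contra hne
      exact hu (key u hne).2
    · exact fun h => absurd (Finset.mem_univ _) h
  · refine Finset.sum_eq_zero fun u _ => ?_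
    by_contra hne
    exact hst (key u hne).1

theorem LocalOn.mul (h : LocalOn S M) (h' : LocalOn S M') : LocalOn S (M * M') := by
  constructor
  · intro s t hne i hi
    rw [Matrix.mul_apply] at hne
    obtain ⟨u, _, hu⟩ := Finset.exists_ne_zero_of_sum_ne_zero hne
    rw [h.1 s u (left_ne_zero_of_mul hu) i hi, h'.1 u t (right_ne_zero_of_mul hu) i hi]
  · intro s t s' t' a b c e
    have restrict : ∀ s t : V → κ, (M * M') s t =
        ∑ u ∈ Finset.univ.filter (fun u : V → κ => ∀ i, i ∉ S → s i = u i), M s u * M' u t := by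
      intro s t
      rw [Matrix.mul_apply]
      refine (Finset.sum_subset (Finset.filter_subset _ _) fun u _ hu => ?_).symm
      rw [h.apply_eq_zero fun hall => hu (Finset.mem_filter.2 ⟨Finset.mem_univ _, hall⟩), zero_mul]
    rw [restrict, restrict]
    -- An intermediate configuration is free on `S` and fixed elsewhere by the first matrix;
    -- changing its outside values from those of `s` to those of `s'` matches the sums.
    refine Finset.sum_nbij' (fun u => S.piecewise u s') (fun u => S.piecewise u s) ?_ ?_ ?_ ?_ ?_
    · intro u _
      exact Finset.mem_filter.2 ⟨Finset.mem_univ _, fun i hi => by simp [hi]⟩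
    · intro u _
      exact Finset.mem_filter.2 ⟨Finset.mem_univ _, fun i hi => by simp [hi]⟩
    · intro u hu
      have hu := (Finset.mem_filter.1 hu).2
      funext i
      by_cases hi : i ∈ S
      · simp [hi]
      · simp [hi, hu i hi]
    · intro u hu
      have hu := (Finset.mem_filter.1 hu).2
      funext i
      by_cases hi : i ∈ S
      · simp [hi]
      · simp [hi, hu i hi]
    · intro u hu
      have hu := (Finset.mem_filter.1 hu).2
      rw [h.2 s u s' (S.piecewise u s') hu (fun i hi => by simp [hi]) c fun i hi => by simp [hi]]
      rw [h'.2 u t (S.piecewise u s') t' (fun i hi => by rw [← hu i hi, a i hi])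
        (fun i hi => by simp [hi, b i hi]) (fun i hi => by simp [hi]) e]

theorem LocalOn.pow (h : LocalOn S M) (m : ℕ) : LocalOn S (M ^ m) := by
  induction m with
  | zero => exact localOn_one
  | succ m ih => rw [pow_succ]; exact ih.mul h

theorem LocalOn.commute_of_disjoint (h : LocalOn S M) (h' : LocalOn S' M')
    (hd : Disjoint S S') : Commute M M' := by
  ext s t
  rw [h.mul_apply_of_disjoint h' hd, h'.mul_apply_of_disjoint h hd.symm, Finset.union_comm,
    mul_comm]

open scoped Matrix.Norms.L2Operator in
theorem LocalOn.exp (h : LocalOn S M) : LocalOn S (NormedSpace.exp M) := by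
  have hs : HasSum (fun m : ℕ => ((m.factorial : ℂ)⁻¹) • M ^ m) (NormedSpace.exp M) :=
    NormedSpace.exp_series_hasSum_exp' M
  have hst : ∀ s t, HasSum (fun m : ℕ => (((m.factorial : ℂ)⁻¹) • M ^ m) s t)
      (NormedSpace.exp M s t) := fun s t => Pi.hasSum.1 (Pi.hasSum.1 hs s) t
  have hl : ∀ m : ℕ, LocalOn S (((m.factorial : ℂ)⁻¹) • M ^ m) := fun m => (h.pow m).smul _
  constructor
  · intro s t hne
    by_contra hc
    refine hne ((hst s t).unique ?_)
    simp_rw [fun m => (hl m).apply_eq_zero hc]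
    exact hasSum_zero
  · intro s t s' t' a b c e
    refine (hst s t).unique ?_
    simp_rw [fun m => (hl m).2 s t s' t' a b c e]
    exact hst s' t'

end Locality

end ThermalLattice

namespace ThermalLattice

/-! ### Encoding sets with small components by local states. -/

section ClusterStates

open scoped Classical
open Relation

variable {V κ : Type*} [Fintype V] [Fintype κ] (T : V → V → Prop)

/-- The points related to some point of `S`. -/
noncomputable def hull (S : Finset V) : Finset V := Finset.univ.filter fun j => ∃ i ∈ S, T i j

/-- Two points are related to a common point. -/
def Overlap (i j : V) : Prop := ∃ k, T i k ∧ T j k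

variable {T} {S S' A : Finset V}

theorem mem_hull {j : V} : j ∈ hull T S ↔ ∃ i ∈ S, T i j := by simp [hull]

theorem hull_union : hull T (S ∪ S') = hull T S ∪ hull T S' := by
  ext j
  simp only [mem_hull, Finset.mem_union]
  grind

theorem hull_mono (h : S ⊆ S') : hull T S ⊆ hull T S' := by
  intro j hj
  obtain ⟨i, hi, hij⟩ := mem_hull.1 hj
  exact mem_hull.2 ⟨i, h hi, hij⟩

theorem subset_hull (hT : ∀ i, T i i) : S ⊆ hull T S := fun i hi => mem_hull.2 ⟨i, hi, hT i⟩

omit [Fintype V] in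
theorem Overlap.symm (i j : V) (h : Overlap T i j) : Overlap T j i := by
  obtain ⟨k, hi, hj⟩ := h
  exact ⟨k, hj, hi⟩

theorem disjoint_hull (h : Separated (Overlap T) S S') : Disjoint (hull T S) (hull T S') := by
  refine Finset.disjoint_left.2 fun k hk hk' => ?_
  obtain ⟨i, hi, hik⟩ := mem_hull.1 hk
  obtain ⟨j, hj, hjk⟩ := mem_hull.1 hk'
  exact h i hi j hj ⟨k, hik, hjk⟩

/-- Points whose neighbourhoods meet overlap, hence lie in one component. So each site is covered by
at most one component, and a single label per site suffices. -/
theorem eq_of_mem_hull_components {A B : Finset V} (hA : A ∈ components (Overlap T) S)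
    (hB : B ∈ components (Overlap T) S) {k : V} (hk : k ∈ hull T A) (hk' : k ∈ hull T B) :
    A = B := by
  obtain ⟨i, hi, hik⟩ := mem_hull.1 hk
  obtain ⟨j, hj, hjk⟩ := mem_hull.1 hk'
  exact eq_of_mem_components Overlap.symm hA hB hi hj (.inr ⟨k, hik, hjk⟩)

/-- The matrix elements of a multiplicative family of local matrices factor over the
components. -/
theorem apply_eq_prod_components {f : Finset V → Matrix (V → κ) (V → κ) ℂ} (hf0 : f ∅ = 1)
    (hf : ∀ S S', Separated (Overlap T) S S' → f (S ∪ S') = f S * f S')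
    (hloc : ∀ S, LocalOn (hull T S) (f S)) (S : Finset V) {s t : V → κ}
    (hst : ∀ i, i ∉ hull T S → s i = t i) :
    f S s t = ∏ A ∈ components (Overlap T) S, f A s ((hull T A).piecewise t s) := by
  have key : ∀ 𝒜 ⊆ components (Overlap T) S, ∀ t : V → κ,
      (∀ i, i ∉ hull T (𝒜.biUnion id) → s i = t i) →
      f (𝒜.biUnion id) s t = ∏ A ∈ 𝒜, f A s ((hull T A).piecewise t s) := by
    intro 𝒜
    induction 𝒜 using Finset.induction_on with
    | empty =>
      intro _ t ht
      have : s = t := funext fun i => ht i (by simp [mem_hull])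
      rw [Finset.biUnion_empty, hf0, Finset.prod_empty, this, Matrix.one_apply_eq]
    | insert A 𝒜 hA ih =>
      intro h𝒜 t ht
      have h𝒜' : 𝒜 ⊆ components (Overlap T) S := fun B hB => h𝒜 (Finset.mem_insert_of_mem hB)
      have hAc := h𝒜 (Finset.mem_insert_self A 𝒜)
      have hsep : Separated (Overlap T) A (𝒜.biUnion id) := by
        intro a ha b hb hab
        obtain ⟨B, hB, hbB⟩ := Finset.mem_biUnion.1 hb
        have := eq_of_mem_components Overlap.symm hAc (h𝒜' hB) ha hbB (.inr hab)
        exact hA (this ▸ hB)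
      rw [Finset.biUnion_insert] at ht ⊢
      rw [hull_union] at ht
      rw [id] at ht
      rw [id, hf _ _ hsep, (hloc A).mul_apply_of_disjoint (hloc _) (disjoint_hull hsep),
        if_pos ht, Finset.prod_insert hA, ih h𝒜' _ fun i hi => by simp [hi]]
      congr 1
      refine Finset.prod_congr rfl fun B hB => ?_
      congr 1
      funext i
      by_cases hi : i ∈ hull T B
      · have : i ∈ hull T (𝒜.biUnion id) :=
          hull_mono (Finset.subset_biUnion_of_mem id hB) hi
        simp [hi, this]
      · simp [hi]
  have h := key _ subset_rfl t
  rw [biUnion_components] at h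
  exact h hst

variable (T) (L : ℕ) (o : V → κ)

/-- The label of a cluster: the two configurations, cut off outside the hull. -/
noncomputable def clusterLabel (s t : V → κ) (A : Finset V) : Finset V × (V → κ) × (V → κ) :=
  (A, (hull T A).piecewise s o, (hull T A).piecewise t o)

/-- The labels of the clusters of at most `L` points whose hull contains `i`. -/
noncomputable def clusterStates (i : V) : Finset (Option (Finset V × (V → κ) × (V → κ))) :=
  Finset.univ.filter fun x => ∀ γ, x = some γ → (IsCluster (Overlap T) γ.1 ∧ γ.1.card ≤ L) ∧
    i ∈ hull T γ.1 ∧ (∀ j, j ∉ hull T γ.1 → γ.2.1 j = o j) ∧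
      ∀ j, j ∉ hull T γ.1 → γ.2.2 j = o j

/-- The part of the local state that is passed along the edge `e`. -/
noncomputable def edgeState {X : Type*} (e : Sym2 V) (x : Option (Finset V × X)) :
    Option (Finset V × X) :=
  x.bind fun γ => if ∀ v ∈ e, v ∈ hull T γ.1 then some γ else none

/-- The local states of the clusters of `S`. -/
noncomputable def clusterConfig (s t : V → κ) (S : Finset V) (i : V) :
    Option (Finset V × (V → κ) × (V → κ)) :=
  if h : ∃ A ∈ components (Overlap T) S, i ∈ hull T A then some (clusterLabel T o s t h.choose)
  else none

/-- The local weights; the weight of a cluster is put at one point of its hull. -/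
noncomputable def clusterWeight (f : Finset V → Matrix (V → κ) (V → κ) ℂ) (root : Finset V → V)
    (i : V) : Option (Finset V × (V → κ) × (V → κ)) → Matrix κ κ ℂ
  | none => 1
  | some γ => Matrix.of fun a b => if a = γ.2.1 i ∧ b = γ.2.2 i then
    (if i = root γ.1 then f γ.1 γ.2.1 γ.2.2 else 1) else 0

variable {T L o} {s t : V → κ}

omit [Fintype κ] in
theorem clusterConfig_eq_some (hA : A ∈ components (Overlap T) S) {i : V} (hi : i ∈ hull T A) :
    clusterConfig T o s t S i = some (clusterLabel T o s t A) := by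
  have h : ∃ A ∈ components (Overlap T) S, i ∈ hull T A := ⟨A, hA, hi⟩
  rw [clusterConfig, dif_pos h,
    eq_of_mem_hull_components h.choose_spec.1 hA h.choose_spec.2 hi]

omit [Fintype κ] in
theorem clusterConfig_eq_none {i : V} (hi : i ∉ hull T S) : clusterConfig T o s t S i = none := by
  rw [clusterConfig, dif_neg]
  rintro ⟨A, hA, hiA⟩
  exact hi (hull_mono (subset_of_mem_components hA) hiA)

theorem exists_mem_components_of_mem_hull {i : V} (hi : i ∈ hull T S) :
    ∃ A ∈ components (Overlap T) S, i ∈ hull T A := by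
  obtain ⟨j, hj, hji⟩ := mem_hull.1 hi
  rw [← biUnion_components (R := Overlap T) (S := S)] at hj
  obtain ⟨A, hA, hjA⟩ := Finset.mem_biUnion.1 hj
  exact ⟨A, hA, mem_hull.2 ⟨j, hjA, hji⟩⟩

omit [Fintype κ] in
theorem exists_of_clusterConfig_eq_some {i : V} {γ}
    (h : clusterConfig T o s t S i = some γ) :
    ∃ A ∈ components (Overlap T) S, i ∈ hull T A ∧ γ = clusterLabel T o s t A := by
  by_cases hi : i ∈ hull T S
  · obtain ⟨A, hA, hiA⟩ := exists_mem_components_of_mem_hull hi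
    rw [clusterConfig_eq_some hA hiA, Option.some_inj] at h
    exact ⟨A, hA, hiA, h.symm⟩
  · rw [clusterConfig_eq_none hi] at h
    cases h

omit [Fintype κ] in
theorem edgeState_eq_some_iff {X : Type*} {e : Sym2 V} {x : Option (Finset V × X)}
    {γ : Finset V × X} :
    edgeState T e x = some γ ↔ x = some γ ∧ ∀ v ∈ e, v ∈ hull T γ.1 := by
  rw [edgeState, Option.bind_eq_some_iff]
  constructor
  · rintro ⟨γ', h, h'⟩
    split_ifs at h' with hv
    cases h'
    exact ⟨h, hv⟩
  · rintro ⟨h, hv⟩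
    exact ⟨γ, h, if_pos hv⟩

-- An edge transmits a label only if both of its ends lie in the hull of that cluster; in that case
-- both ends store this same label.
omit [Fintype κ] in
theorem edgeState_clusterConfig (i j : V) : edgeState T s(i, j) (clusterConfig T o s t S i) =
    edgeState T s(i, j) (clusterConfig T o s t S j) := by
  have key : ∀ i j γ, edgeState T s(i, j) (clusterConfig T o s t S i) = some γ →
      edgeState T s(i, j) (clusterConfig T o s t S j) = some γ := by
    intro i j γ h
    rw [edgeState_eq_some_iff] at h ⊢
    obtain ⟨A, hA, hi, rfl⟩ := exists_of_clusterConfig_eq_some h.1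
    exact ⟨clusterConfig_eq_some hA (h.2 j (Sym2.mem_mk_right _ _)), h.2⟩
  refine Option.ext fun γ => ⟨key i j γ, fun h => ?_⟩
  rw [Sym2.eq_swap] at h ⊢
  exact key j i γ h

theorem edgeState_mem_clusterStates {i j : V} {x : Option (Finset V × (V → κ) × (V → κ))}
    (hx : x ∈ clusterStates T L o i) {e : Sym2 V} (hj : j ∈ e) :
    edgeState T e x ∈ clusterStates T L o j := by
  refine Finset.mem_filter.2 ⟨Finset.mem_univ _, fun γ hγ => ?_⟩
  obtain ⟨h, he⟩ := edgeState_eq_some_iff.1 hγ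
  have h1 := (Finset.mem_filter.1 hx).2 γ h
  exact ⟨h1.1, he j hj, h1.2.2⟩

theorem clusterConfig_mem (hS : SmallComponents (Overlap T) L S) (i : V) :
    clusterConfig T o s t S i ∈ clusterStates T L o i := by
  refine Finset.mem_filter.2 ⟨Finset.mem_univ _, fun γ hγ => ?_⟩
  obtain ⟨A, hA, hi, rfl⟩ := exists_of_clusterConfig_eq_some hγ
  exact ⟨⟨isCluster_of_mem_components Overlap.symm hA, hS A hA⟩, hi,
    fun j hj => Finset.piecewise_eq_of_notMem _ _ _ hj,
    fun j hj => Finset.piecewise_eq_of_notMem _ _ _ hj⟩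

variable {f : Finset V → Matrix (V → κ) (V → κ) ℂ} {root : Finset V → V}

/-- Each local weight is a product over the components that is trivial except at a root, so
exchanging the two products leaves one factor per component. -/
theorem prod_clusterWeight_clusterConfig (hf0 : f ∅ = 1)
    (hf : ∀ S S', Separated (Overlap T) S S' → f (S ∪ S') = f S * f S')
    (hloc : ∀ S, LocalOn (hull T S) (f S))
    (hroot : ∀ A, IsCluster (Overlap T) A → root A ∈ hull T A)
    (hst : ∀ i, i ∉ hull T S → s i = t i) :
    f S s t = ∏ i, clusterWeight f root i (clusterConfig T o s t S i) (s i) (t i) := by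
  have hw : ∀ i, clusterWeight f root i (clusterConfig T o s t S i) (s i) (t i) =
      ∏ A ∈ components (Overlap T) S,
        if i = root A then f A s ((hull T A).piecewise t s) else 1 := by
    intro i
    by_cases hi : i ∈ hull T S
    · obtain ⟨A, hA, hiA⟩ := exists_mem_components_of_mem_hull hi
      rw [clusterConfig_eq_some hA hiA, Finset.prod_eq_single A]
      · simp only [clusterWeight, clusterLabel, Matrix.of_apply,
          Finset.piecewise_eq_of_mem _ _ _ hiA, and_self, if_true]
        refine if_congr Iff.rfl ((hloc A).2 _ _ _ _ ?_ ?_ ?_ ?_) rfl <;> intro j hj <;> simp [hj]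
      · intro B hB hBA
        refine if_neg fun hr => hBA ?_
        refine eq_of_mem_hull_components hB hA (hr ▸ hroot B ?_) hiA
        exact isCluster_of_mem_components Overlap.symm hB
      · exact fun h => absurd hA h
    · rw [clusterConfig_eq_none hi, Finset.prod_eq_one]
      · rw [clusterWeight, hst i hi, Matrix.one_apply_eq]
      · intro A hA
        refine if_neg fun hr => hi (hull_mono (subset_of_mem_components hA) ?_)
        rw [hr]
        exact hroot A (isCluster_of_mem_components Overlap.symm hA)
  simp_rw [hw]
  rw [Finset.prod_comm, apply_eq_prod_components hf0 hf hloc S hst]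
  refine Finset.prod_congr rfl fun A _ => ?_
  rw [Finset.prod_ite_eq' Finset.univ (root A), if_pos (Finset.mem_univ _)]

/-- Local states that agree along the edges of the graph and have nonzero weight come from a set
with small components. -/
theorem exists_eq_clusterConfig {G : SimpleGraph V}
    (hconn : ∀ A, IsCluster (Overlap T) A → ∀ u ∈ hull T A, ∀ v ∈ hull T A,
      ReflTransGen (StepIn G.Adj (hull T A)) u v)
    {x : V → Option (Finset V × (V → κ) × (V → κ))} (hx : ∀ i, x i ∈ clusterStates T L o i)
    (hG : ∀ i j, G.Adj i j → edgeState T s(i, j) (x i) = edgeState T s(i, j) (x j))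
    (hne : ∀ i, clusterWeight f root i (x i) (s i) (t i) ≠ 0) :
    ∃ S, SmallComponents (Overlap T) L S ∧ (∀ i, i ∉ hull T S → s i = t i) ∧
      x = clusterConfig T o s t S := by
  have hx' := fun i => (Finset.mem_filter.1 (hx i)).2
  -- Agreement along edges propagates a label through the whole hull of its cluster, because the
  -- hull is connected in the graph.
  have spread : ∀ i γ, x i = some γ → ∀ j ∈ hull T γ.1, x j = some γ := by
    intro i γ hi j hj
    have h := hconn γ.1 (hx' i γ hi).1.1 i (hx' i γ hi).2.1 j hj
    induction h with
    | refl => exact hi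
    | tail _ hbc ih =>
      have hb := ih hbc.2.1
      have h1 := hG _ _ hbc.1
      rw [edgeState_eq_some_iff.2 ⟨hb, ?_⟩] at h1
      · exact (edgeState_eq_some_iff.1 h1.symm).1
      · intro v hv
        rcases Sym2.mem_iff.1 hv with rfl | rfl
        exacts [hbc.2.1, hbc.2.2]
  set 𝒜 : Finset (Finset V) := Finset.univ.filter fun A => ∃ i γ, x i = some γ ∧ γ.1 = A with h𝒜
  have mem𝒜 : ∀ {A}, A ∈ 𝒜 ↔ ∃ i γ, x i = some γ ∧ γ.1 = A := by simp [h𝒜]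
  -- Two recorded clusters with intersecting hulls would put two labels on one site. Hence distinct
  -- clusters do not overlap, and they are the components of their union.
  have uniq : ∀ A ∈ 𝒜, ∀ B ∈ 𝒜, ∀ k, k ∈ hull T A → k ∈ hull T B → A = B := by
    intro A hA B hB k hkA hkB
    obtain ⟨i, γ, hi, rfl⟩ := mem𝒜.1 hA
    obtain ⟨j, γ', hj, rfl⟩ := mem𝒜.1 hB
    have := (spread i γ hi k hkA).symm.trans (spread j γ' hj k hkB)
    rw [Option.some_inj.1 this]
  have hmem : ∀ A ∈ 𝒜, A ∈ components (Overlap T) (𝒜.biUnion id) := by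
    intro A hA
    obtain ⟨i, γ, hi, rfl⟩ := mem𝒜.1 hA
    refine mem_components_of_isCluster (hx' i γ hi).1.1 (Finset.subset_biUnion_of_mem id hA) ?_
    intro a ha w hw haw
    obtain ⟨B, hB, hwB⟩ := Finset.mem_biUnion.1 hw
    obtain ⟨k, hak, hwk⟩ := haw
    rw [uniq _ hA B hB k (mem_hull.2 ⟨a, ha, hak⟩) (mem_hull.2 ⟨w, hwB, hwk⟩)]
    exact hwB
  have hcomp : ∀ A ∈ components (Overlap T) (𝒜.biUnion id), A ∈ 𝒜 := by
    intro A hA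
    obtain ⟨v, hv, hvA⟩ := mem_components.1 hA
    have hvA : v ∈ A := hvA ▸ mem_component_self hv
    obtain ⟨B, hB, hvB⟩ := Finset.mem_biUnion.1 hv
    rw [eq_of_mem_components Overlap.symm hA (hmem B hB) hvA hvB (.inl rfl)]
    exact hB
  -- Nonzero weights force the stored configurations to be `s` and `t` on the hull; outside it they
  -- are the default `o`, so the label carries no other information.
  have label : ∀ i γ, x i = some γ → γ = clusterLabel T o s t γ.1 := by
    intro i γ hi
    have hw : ∀ j ∈ hull T γ.1, s j = γ.2.1 j ∧ t j = γ.2.2 j := by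
      intro j hj
      have h := hne j
      rw [spread i γ hi j hj] at h
      by_contra hc
      exact h (if_neg hc)
    have ho := (hx' i γ hi).2.2
    refine Prod.ext rfl (Prod.ext (funext fun j => ?_) (funext fun j => ?_))
    · by_cases hj : j ∈ hull T γ.1
      · simp [clusterLabel, hj, (hw j hj).1]
      · simp [clusterLabel, hj, ho.1 j hj]
    · by_cases hj : j ∈ hull T γ.1
      · simp [clusterLabel, hj, (hw j hj).2]
      · simp [clusterLabel, hj, ho.2 j hj]
  refine ⟨𝒜.biUnion id, fun A hA => ?_, fun i hi => ?_, funext fun i => ?_⟩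
  · obtain ⟨i, γ, hi, rfl⟩ := mem𝒜.1 (hcomp A hA)
    exact (hx' i γ hi).1.2
  · cases hxi : x i with
    | none =>
      have h := hne i
      rw [hxi] at h
      by_contra hst
      exact h (Matrix.one_apply_ne hst)
    | some γ =>
      exact absurd (hull_mono (Finset.subset_biUnion_of_mem id (mem𝒜.2 ⟨i, γ, hxi, rfl⟩))
        (hx' i γ hxi).2.1) hi
  · cases hxi : x i with
    | none =>
      refine (clusterConfig_eq_none fun hi => ?_).symm
      obtain ⟨A, hA, hiA⟩ := exists_mem_components_of_mem_hull hi
      obtain ⟨j, γ, hj, rfl⟩ := mem𝒜.1 (hcomp A hA)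
      rw [spread j γ hj i hiA] at hxi
      cases hxi
    | some γ =>
      rw [clusterConfig_eq_some (hmem γ.1 (mem𝒜.2 ⟨i, γ, hxi, rfl⟩)) (hx' i γ hxi).2.1,
        ← label i γ hxi]

/-- The sum over the sets with small components, as a sum over local states. -/
theorem sum_smallComponents_apply [decV : DecidableEq V] [decκ : DecidableEq κ] {G : SimpleGraph V} (hT : ∀ i, T i i)
    (hconn : ∀ A, IsCluster (Overlap T) A → ∀ u ∈ hull T A, ∀ v ∈ hull T A,
      ReflTransGen (StepIn G.Adj (hull T A)) u v) (hf0 : f ∅ = 1)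
    (hf : ∀ S S', Separated (Overlap T) S S' → f (S ∪ S') = f S * f S')
    (hloc : ∀ S, LocalOn (hull T S) (f S))
    (hroot : ∀ A, IsCluster (Overlap T) A → root A ∈ hull T A) (s t : V → κ) :
    (∑ S ∈ Finset.univ.filter (SmallComponents (Overlap T) L), f S) s t =
      ∑ x ∈ (Fintype.piFinset (clusterStates T L o)).filter
        (fun x => ∀ i j, G.Adj i j → edgeState T s(i, j) (x i) = edgeState T s(i, j) (x j)),
          ∏ i, clusterWeight f root i (x i) (s i) (t i) := by
  obtain rfl : decV = fun a b => Classical.propDecidable _ := Subsingleton.elim _ _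
  obtain rfl : decκ = fun a b => Classical.propDecidable _ := Subsingleton.elim _ _
  rw [Matrix.sum_apply]
  have hoff : ∀ S, f S s t ≠ 0 → ∀ i, i ∉ hull T S → s i = t i := fun S h => (hloc S).1 s t h
  refine Finset.sum_bij_ne_zero (fun S _ _ => clusterConfig T o s t S) ?_ ?_ ?_ ?_
  · intro S hS _
    exact Finset.mem_filter.2 ⟨Fintype.mem_piFinset.2
      (clusterConfig_mem (Finset.mem_filter.1 hS).2), fun i j _ => edgeState_clusterConfig i j⟩
  · have key : ∀ S S', clusterConfig T o s t S = clusterConfig T o s t S' → S ⊆ S' := by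
      intro S S' h i hi
      obtain ⟨A, hA, hiA⟩ := Finset.mem_biUnion.1
        ((biUnion_components (R := Overlap T) (S := S)).symm ▸ hi)
      have h1 := clusterConfig_eq_some (o := o) (s := s) (t := t) hA (subset_hull hT hiA)
      rw [h] at h1
      obtain ⟨B, hB, _, hAB⟩ := exists_of_clusterConfig_eq_some h1
      have : A = B := congrArg Prod.fst hAB
      exact subset_of_mem_components hB (this ▸ hiA)
    intro S _ _ S' _ _ h
    exact (key S S' h).antisymm (key S' S h.symm)
  · intro x hx hne
    obtain ⟨hx, hG⟩ := Finset.mem_filter.1 hx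
    obtain ⟨S, hS, hst, rfl⟩ := exists_eq_clusterConfig hconn (Fintype.mem_piFinset.1 hx) hG
      fun i => Finset.prod_ne_zero_iff.1 hne i (Finset.mem_univ i)
    exact ⟨S, Finset.mem_filter.2 ⟨Finset.mem_univ _, hS⟩,
      (prod_clusterWeight_clusterConfig hf0 hf hloc hroot hst).trans_ne hne, rfl⟩
  · intro S _ hne
    exact prod_clusterWeight_clusterConfig hf0 hf hloc hroot (hoff S hne)

omit [Fintype κ] in
theorem card_hull_le {v : ℕ} (hv : ∀ i, (Finset.univ.filter (T i)).card ≤ v) :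
    (hull T A).card ≤ A.card * v := by
  have : hull T A = A.biUnion fun i => Finset.univ.filter (T i) := by
    ext j
    simp [mem_hull]
  rw [this]
  exact Finset.card_biUnion_le_card_mul _ _ _ fun i _ => hv i

theorem card_filter_eq_off (S : Finset V) (o : V → κ) :
    (Finset.univ.filter fun a : V → κ => ∀ j, j ∉ S → a j = o j).card =
      Fintype.card κ ^ S.card := by
  have : (Finset.univ.filter fun a : V → κ => ∀ j, j ∉ S → a j = o j) =
      Fintype.piFinset fun j => if j ∈ S then Finset.univ else {o j} := by
    ext a
    simp only [Finset.mem_filter, Finset.mem_univ, true_and, Fintype.mem_piFinset]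
    refine forall_congr' fun j => ?_
    by_cases hj : j ∈ S <;> simp [hj]
  rw [this, Fintype.card_piFinset, ← Finset.prod_subset (Finset.subset_univ S)]
  · rw [Finset.prod_congr rfl (g := fun _ => Fintype.card κ) fun j hj => by simp [hj],
      Finset.prod_const]
  · intro j _ hj
    simp [hj]

/-- Some point of the cluster is one of the at most `v` points related to `i`, and
`card_clusters_le` counts the clusters through it. The hull has at most `L * v` sites, on which two
configurations are free; the extra `1` is the empty state. -/
theorem card_clusterStates_le (hT : ∀ i, T i i) (hTs : ∀ i j, T i j → T j i) {v B : ℕ}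
    (hv : ∀ i, (Finset.univ.filter (T i)).card ≤ v)
    (hB : ∀ i, (Finset.univ.filter (Overlap T i)).card ≤ B) (hκ : 0 < Fintype.card κ) (i : V) :
    (clusterStates T L o i).card ≤
      1 + v * B ^ (2 * L) * (Fintype.card κ ^ (L * v) * Fintype.card κ ^ (L * v)) := by
  set off : Finset V → Finset (V → κ) := fun A =>
    Finset.univ.filter fun a => ∀ j, j ∉ hull T A → a j = o j
  set cl : Finset (Finset V) := (Finset.univ.filter (T i)).biUnion fun u =>
    Finset.univ.filter fun A => IsCluster (Overlap T) A ∧ u ∈ A ∧ A.card ≤ L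
  have hsub : clusterStates T L o i ⊆
      {none} ∪ cl.biUnion fun A => (off A ×ˢ off A).image fun p => some (A, p) := by
    intro x hx
    cases x with
    | none => simp
    | some γ =>
      obtain ⟨h1, h2, h3, h4⟩ := (Finset.mem_filter.1 hx).2 γ rfl
      obtain ⟨u, hu, hui⟩ := mem_hull.1 h2
      refine Finset.mem_union_right _ (Finset.mem_biUnion.2 ⟨γ.1, ?_, ?_⟩)
      · exact Finset.mem_biUnion.2 ⟨u, Finset.mem_filter.2 ⟨Finset.mem_univ _, hTs _ _ hui⟩,
          Finset.mem_filter.2 ⟨Finset.mem_univ _, h1.1, hu, h1.2⟩⟩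
      · exact Finset.mem_image.2 ⟨γ.2, Finset.mem_product.2
          ⟨Finset.mem_filter.2 ⟨Finset.mem_univ _, h3⟩,
            Finset.mem_filter.2 ⟨Finset.mem_univ _, h4⟩⟩, rfl⟩
  have hcl : cl.card ≤ v * B ^ (2 * L) :=
    (Finset.card_biUnion_le_card_mul _ _ _ fun u _ => card_clusters_le
      (fun a => ⟨a, hT a, hT a⟩) Overlap.symm hB u L).trans (Nat.mul_le_mul_right _ (hv i))
  refine (Finset.card_le_card hsub).trans ((Finset.card_union_le _ _).trans ?_)
  rw [Finset.card_singleton]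
  refine Nat.add_le_add_left ((Finset.card_biUnion_le_card_mul _ _
    (Fintype.card κ ^ (L * v) * Fintype.card κ ^ (L * v)) fun A hA => ?_).trans
      (Nat.mul_le_mul_right _ hcl)) 1
  obtain ⟨u, _, hA⟩ := Finset.mem_biUnion.1 hA
  have hAL := (Finset.mem_filter.1 hA).2.2.2
  have hoff : (off A).card ≤ Fintype.card κ ^ (L * v) := by
    rw [card_filter_eq_off]
    exact Nat.pow_le_pow_right hκ ((card_hull_le hv).trans (Nat.mul_le_mul_right _ hAL))
  refine Finset.card_image_le.trans ?_
  rw [Finset.card_product]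
  exact Nat.mul_le_mul hoff hoff

end ClusterStates

/-! ### Truncated multiplicative sums as tensor networks. -/

section ClusterPEPO

open scoped Classical
open Relation

variable {d n q : ℕ}

/-- The sum of a multiplicative family of local matrices over the sets with small components is a
projected entangled pair operator. -/
theorem isPEPO_sum_smallComponents [Nonempty (Site d n)] {T : Site d n → Site d n → Prop} (hT : ∀ i, T i i)
    (hTs : ∀ i j, T i j → T j i) {v B : ℕ} (hv : ∀ i, (Finset.univ.filter (T i)).card ≤ v)
    (hB : ∀ i, (Finset.univ.filter (Overlap T i)).card ≤ B) (hq : 0 < q)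
    (hconn : ∀ A, IsCluster (Overlap T) A → ∀ u ∈ hull T A, ∀ v ∈ hull T A,
      ReflTransGen (StepIn (latticeGraph d n).Adj (hull T A)) u v)
    {f : Finset (Site d n) → SpinMatrix d n q} (hf0 : f ∅ = 1)
    (hf : ∀ S S', Separated (Overlap T) S S' → f (S ∪ S') = f S * f S')
    (hloc : ∀ S, LocalOn (hull T S) (f S)) (L : ℕ) :
    IsPEPO (1 + v * B ^ (2 * L) * (q ^ (L * v) * q ^ (L * v)))
      (∑ S ∈ Finset.univ.filter (SmallComponents (Overlap T) L), f S) := by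
  have hroot : ∀ A, ∃ i, IsCluster (Overlap T) A → i ∈ hull T A := by
    intro A
    by_cases hA : IsCluster (Overlap T) A
    · obtain ⟨i, hi⟩ := hA.1
      exact ⟨i, fun _ => subset_hull hT hi⟩
    · exact ⟨Classical.arbitrary _, fun h => absurd h hA⟩
  choose root hroot using hroot
  let o : Site d n → Fin q := fun _ => ⟨0, hq⟩
  -- Labels on an edge are counted through the states at one chosen end; a transmitted label belongs
  -- to the states of both ends.
  refine isPEPO_of_localStates (Nat.add_pos_left one_pos _) (clusterStates T L o)
    (clusterWeight f root) (edgeState T) (fun e => clusterStates T L o (Quot.out e).1)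
    ?_ ?_ fun s t =>
      (sum_smallComponents_apply (o := o) (L := L) hT hconn hf0 hf hloc hroot s t).trans
        (Finset.sum_congr (Finset.ext fun x => by simp only [Finset.mem_filter]) fun _ _ => rfl)
  · intro e _
    have h := card_clusterStates_le (L := L) (o := o) hT hTs hv hB
      (by rw [Fintype.card_fin]; exact hq) (Quot.out e).1
    rw [Fintype.card_fin] at h
    exact h
  · exact fun i x hx e _ => edgeState_mem_clusterStates hx (Sym2.out_fst_mem e)

end ClusterPEPO

end ThermalLattice

namespace ThermalLattice

/-! ### Spectral data of a Hermitian matrix as a thermal Hamiltonian. -/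

section SpinHamiltonian

open scoped Matrix Matrix.Norms.L2Operator ComplexOrder
open NormedSpace (exp)

variable {d n q : ℕ} {H : SpinMatrix d n q}

theorem mem_eigenspace_toHam {lam : ℝ} {x : SpinSpace d n q} :
    x ∈ eigenspace (toHam H) lam ↔ toOp H x = (lam : ℂ) • x := by
  rw [mem_eigenspace]
  exact ⟨fun ⟨_, h⟩ => h, fun h => ⟨Submodule.mem_top, h⟩⟩

theorem toOp_eigenvectorBasis (hH : H.IsHermitian) (j : Site d n → Fin q) :
    toOp H (hH.eigenvectorBasis j) = (hH.eigenvalues j : ℂ) • hH.eigenvectorBasis j := by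
  refine WithLp.ofLp_injective 2 ?_
  rw [toOp, Matrix.ofLp_toEuclideanCLM, hH.mulVec_eigenvectorBasis]
  rfl

theorem exp_smul_eq (hH : H.IsHermitian) (c : ℝ) :
    exp ((c : ℂ) • H) = (hH.eigenvectorUnitary : SpinMatrix d n q) *
      Matrix.diagonal (fun j => (Real.exp (c * hH.eigenvalues j) : ℂ)) *
      (hH.eigenvectorUnitary : SpinMatrix d n q)ᴴ := by
  have h := hH.spectral_theorem
  rw [Unitary.conjStarAlgAut_apply] at h
  have h1 : (c : ℂ) • H = (hH.eigenvectorUnitary : SpinMatrix d n q) *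
      Matrix.diagonal (fun j => ((c * hH.eigenvalues j : ℝ) : ℂ)) *
      (hH.eigenvectorUnitary : SpinMatrix d n q)ᴴ := by
    have h2 : Matrix.diagonal (fun j => ((c * hH.eigenvalues j : ℝ) : ℂ)) =
        (c : ℂ) • Matrix.diagonal (RCLike.ofReal ∘ hH.eigenvalues) := by
      rw [← Matrix.diagonal_smul]
      congr 1
      funext j
      simp
    rw [h2, mul_smul_comm, smul_mul_assoc]
    congr 1
  rw [h1, exp_unitary_conj hH.eigenvectorUnitary.2, Matrix.exp_diagonal]
  congr 3
  funext j
  rw [Pi.coe_exp, ← Complex.exp_eq_exp_ℂ, ← Complex.ofReal_exp]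

theorem toOp_exp_smul_eigenvectorBasis (hH : H.IsHermitian) (c : ℝ) (j : Site d n → Fin q) :
    toOp (exp ((c : ℂ) • H)) (hH.eigenvectorBasis j) =
      (Real.exp (c * hH.eigenvalues j) : ℂ) • hH.eigenvectorBasis j := by
  refine WithLp.ofLp_injective 2 ?_
  rw [toOp, Matrix.ofLp_toEuclideanCLM, exp_smul_eq hH, ← Matrix.mulVec_mulVec,
    ← Matrix.mulVec_mulVec, ← Matrix.star_eq_conjTranspose, hH.star_eigenvectorUnitary_mulVec,
    Matrix.diagonal_mulVec_single, mul_one, ← mul_one (Real.exp _ : ℂ), ← smul_eq_mul,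
    Pi.single_smul, Matrix.mulVec_smul, hH.eigenvectorUnitary_mulVec, smul_eq_mul, mul_one]
  rfl

theorem trace_exp_smul (hH : H.IsHermitian) (c : ℝ) :
    (exp ((c : ℂ) • H)).trace = ∑ j, (Real.exp (c * hH.eigenvalues j) : ℂ) := by
  rw [exp_smul_eq hH, Matrix.trace_mul_comm, ← mul_assoc,
    conjTranspose_mul_self_of_mem_unitary hH.eigenvectorUnitary.2, one_mul, Matrix.trace_diagonal]

theorem eigenspace_toHam (hH : H.IsHermitian) (lam : ℝ) :
    eigenspace (toHam H) lam = Submodule.span ℂ (Set.range fun j : {j // hH.eigenvalues j = lam} =>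
      hH.eigenvectorBasis j.1) := by
  refine le_antisymm (fun x hx => ?_) (Submodule.span_le.2 ?_)
  · rw [mem_eigenspace_toHam] at hx
    have hx' : ∀ j, hH.eigenvalues j ≠ lam → hH.eigenvectorBasis.repr x j = 0 := by
      intro j hj
      have h1 := congrArg (fun y => inner ℂ (hH.eigenvectorBasis j) y) hx
      have h2 : inner ℂ (hH.eigenvectorBasis j) (toOp H x) =
          inner ℂ (toOp H (hH.eigenvectorBasis j)) x := by
        have := (Matrix.isSymmetric_toEuclideanLin_iff.2 hH) (hH.eigenvectorBasis j) x
        exact this.symm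
      simp only [h2, toOp_eigenvectorBasis, inner_smul_left, inner_smul_right,
        Complex.conj_ofReal] at h1
      rw [hH.eigenvectorBasis.repr_apply_apply]
      have h3 : ((hH.eigenvalues j : ℂ) - lam) * inner ℂ (hH.eigenvectorBasis j) x = 0 := by
        rw [sub_mul, h1, sub_self]
      refine (mul_eq_zero.1 h3).resolve_left ?_
      exact fun h => hj (Complex.ofReal_injective (sub_eq_zero.1 h))
    rw [← hH.eigenvectorBasis.sum_repr x]
    refine Submodule.sum_mem _ fun j _ => ?_
    by_cases hj : hH.eigenvalues j = lam
    · exact Submodule.smul_mem _ _ (Submodule.subset_span ⟨⟨j, hj⟩, rfl⟩)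
    · rw [hx' j hj, zero_smul]
      exact Submodule.zero_mem _
  · rintro _ ⟨⟨j, rfl⟩, rfl⟩
    exact mem_eigenspace_toHam.2 (toOp_eigenvectorBasis hH j)

theorem degeneracy_toHam (hH : H.IsHermitian) (lam : ℝ) :
    degeneracy (toHam H) lam = (Finset.univ.filter fun j => hH.eigenvalues j = lam).card := by
  rw [degeneracy, eigenspace_toHam hH, finrank_span_eq_card, Fintype.card_subtype]
  exact hH.eigenvectorBasis.orthonormal.linearIndependent.comp _ Subtype.val_injective

theorem support_degeneracy_toHam (hH : H.IsHermitian) (g : ℝ → ℝ) (lam : ℝ)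
    (h : lam ∉ Finset.univ.image hH.eigenvalues) : (degeneracy (toHam H) lam : ℝ) * g lam = 0 := by
  rw [degeneracy_toHam hH, Finset.card_eq_zero.2, Nat.cast_zero, zero_mul]
  refine Finset.filter_eq_empty_iff.2 fun j _ hj => h ?_
  exact Finset.mem_image.2 ⟨j, Finset.mem_univ _, hj⟩

theorem isThermalHamiltonian_toHam (hH : H.IsHermitian) : IsThermalHamiltonian (toHam H) where
  selfAdjoint := by
    rw [LinearPMap.isSelfAdjoint_def, toHam,
      ContinuousLinearMap.toPMap_adjoint_eq_adjoint_toPMap_of_dense]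
    · have : ContinuousLinearMap.adjoint (toOp H) = toOp H := by
        have h := map_star (Matrix.toEuclideanCLM (n := Site d n → Fin q) (𝕜 := ℂ)) H
        rw [Matrix.star_eq_conjTranspose, hH] at h
        exact h.symm
      rw [this]
    · exact dense_univ
  total := by
    rw [eq_top_iff]
    refine le_trans ?_ (Submodule.le_topologicalClosure _)
    rw [← hH.eigenvectorBasis.toBasis.span_eq, Submodule.span_le]
    rintro _ ⟨j, rfl⟩
    refine Submodule.mem_iSup_of_mem (hH.eigenvalues j) ?_
    rw [OrthonormalBasis.coe_toBasis, mem_eigenspace_toHam]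
    exact toOp_eigenvectorBasis hH j
  finite := fun lam => inferInstance
  summable := fun T _ => summable_of_ne_finset_zero (support_degeneracy_toHam hH _)

theorem partitionFn_toHam (hH : H.IsHermitian) (T : ℝ) :
    (partitionFn (toHam H) T : ℂ) = (exp (((-(1 / T) : ℝ) : ℂ) • H)).trace := by
  rw [trace_exp_smul hH, partitionFn, tsum_eq_sum (support_degeneracy_toHam hH _)]
  push_cast
  rw [← Finset.sum_fiberwise_of_maps_to (s := Finset.univ)
    (t := Finset.univ.image hH.eigenvalues) fun j hj => Finset.mem_image_of_mem _ hj]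
  refine Finset.sum_congr rfl fun lam _ => ?_
  rw [Finset.sum_congr rfl (g := fun _ => Complex.exp (-lam / T)) fun j hj => ?_,
    Finset.sum_const, degeneracy_toHam hH, nsmul_eq_mul]
  rw [(Finset.mem_filter.1 hj).2]
  congr 1
  ring

/-- Both operators act on the orthonormal eigenbasis by the same scalars. This connects the spectral
definition with the matrix exponential to which the cluster expansion applies. -/
theorem thermalState_toHam (hH : H.IsHermitian) (T : ℝ) :
    thermalState (toHam H) T = toOp (((partitionFn (toHam H) T : ℂ)⁻¹) •
      exp (((-(1 / T) : ℝ) : ℂ) • H)) := by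
  have hth := isThermalHamiltonian_toHam hH
  refine ContinuousLinearMap.coe_injective (hH.eigenvectorBasis.toBasis.ext fun j => ?_)
  have hz : ∀ lam ∉ Finset.univ.image hH.eigenvalues,
      ((Real.exp (-lam / T) / partitionFn (toHam H) T : ℝ) : ℂ) • spectralProj (toHam H) lam = 0 := by
    intro lam h
    have h0 := support_degeneracy_toHam hH (fun _ => 1) lam h
    rw [mul_one, Nat.cast_eq_zero, hth.degeneracy_eq_zero_iff] at h0
    have : spectralProj (toHam H) lam = 0 := by
      ext1 x
      have := hth.spectralProj_mem lam x
      rw [h0] at this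
      exact (Submodule.mem_bot ℂ).1 this
    rw [this, smul_zero]
  have hj := mem_eigenspace_toHam.2 (toOp_eigenvectorBasis hH j)
  rw [thermalState, tsum_eq_sum hz, OrthonormalBasis.coe_toBasis,
    ContinuousLinearMap.coe_coe, ContinuousLinearMap.coe_coe, _root_.sum_apply,
    Finset.sum_eq_single (hH.eigenvalues j)]
  · rw [_root_.smul_apply, hth.spectralProj_eq_self hj, toOp, map_smul,
      _root_.smul_apply]
    have := toOp_exp_smul_eigenvectorBasis hH (-(1 / T)) j
    rw [toOp] at this
    rw [this, smul_smul]
    congr 1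
    push_cast
    rw [div_eq_inv_mul]
    congr 2
    ring
  · intro lam _ hlam
    rw [_root_.smul_apply, hth.spectralProj_eq_zero hlam hj, smul_zero]
  · exact fun h => absurd (Finset.mem_image_of_mem _ (Finset.mem_univ _)) h

theorem exists_groundState_toHam (H : SpinMatrix d n q) :
    ∃ G : SpinMatrix d n q, G.IsHermitian ∧ groundState (toHam H) = toOp G := by
  obtain ⟨G, hG⟩ : ∃ G, toOp G = groundState (toHam H) :=
    EquivLike.surjective (Matrix.toEuclideanCLM (n := Site d n → Fin q) (𝕜 := ℂ)) _
  refine ⟨G, EquivLike.injective (Matrix.toEuclideanCLM (n := Site d n → Fin q) (𝕜 := ℂ)) ?_,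
    hG.symm⟩
  have h := map_star (Matrix.toEuclideanCLM (n := Site d n → Fin q) (𝕜 := ℂ)) G
  refine h.trans ?_
  change star (toOp G) = toOp G
  rw [hG, groundState, star_smul, (isPositive_spectralProj _).isSelfAdjoint.star_eq]
  congr 1
  simp

end SpinHamiltonian

end ThermalLattice

namespace ThermalLattice

/-! ### Balls and connectedness in the lattice. -/

section Geometry

open scoped Classical
open Relation

variable {d n : ℕ}

theorem manhattan_self (i : Site d n) : manhattan i i = 0 := by simp [manhattan]

theorem manhattan_comm (i j : Site d n) : manhattan i j = manhattan j i :=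
  Finset.sum_congr rfl fun _ _ => Nat.dist_comm _ _

theorem manhattan_triangle (i j k : Site d n) : manhattan i k ≤ manhattan i j + manhattan j k := by
  rw [manhattan, manhattan, manhattan, ← Finset.sum_add_distrib]
  exact Finset.sum_le_sum fun a _ => Nat.dist.triangle_inequality _ _ _

theorem card_manhattan_le (r : ℕ) (i : Site d n) :
    (Finset.univ.filter fun j => manhattan i j ≤ r).card ≤ (2 * r + 1) ^ d := by
  have hsub : (Finset.univ.filter fun j => manhattan i j ≤ r) ⊆
      Fintype.piFinset fun a => Finset.univ.filter fun x : Fin n => Nat.dist (i a) x ≤ r := by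
    intro j hj
    refine Fintype.mem_piFinset.2 fun a => Finset.mem_filter.2 ⟨Finset.mem_univ _, ?_⟩
    exact (Finset.single_le_sum (f := fun a => Nat.dist (i a) (j a))
      (fun _ _ => Nat.zero_le _) (Finset.mem_univ a)).trans (Finset.mem_filter.1 hj).2
  refine (Finset.card_le_card hsub).trans ?_
  rw [Fintype.card_piFinset]
  refine (Finset.prod_le_pow_card _ _ (2 * r + 1) fun a _ => ?_).trans (by simp)
  rw [← Finset.card_map Fin.valEmbedding]
  refine (Finset.card_le_card (t := Finset.Icc (i a - r : ℕ) (i a + r)) fun x hx => ?_).trans ?_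
  · obtain ⟨y, hy, rfl⟩ := Finset.mem_map.1 hx
    have := (Finset.mem_filter.1 hy).2
    rw [Nat.dist] at this
    rw [Finset.mem_Icc, Fin.valEmbedding_apply]
    omega
  · rw [Nat.card_Icc]
    omega

/-- A site other than `i` has a neighbour that is closer to `i`. -/
theorem exists_adj_of_manhattan_eq_succ {i j : Site d n} {m : ℕ} (h : manhattan i j = m + 1) :
    ∃ k, manhattan i k = m ∧ (latticeGraph d n).Adj k j := by
  obtain ⟨a, ha⟩ : ∃ a, i a ≠ j a := by
    by_contra! hc
    rw [funext hc, manhattan_self] at h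
    omega
  obtain ⟨y, hy1, hy2⟩ : ∃ y : Fin n, Nat.dist (i a) y + 1 = Nat.dist (i a) (j a) ∧
      Nat.dist y (j a) = 1 := by
    have ha' : (i a : ℕ) ≠ j a := fun h => ha (Fin.ext h)
    rcases lt_or_gt_of_ne ha' with hlt | hlt
    · refine ⟨⟨j a - 1, by omega⟩, ?_, ?_⟩ <;> simp only [Nat.dist] <;> omega
    · refine ⟨⟨j a + 1, by omega⟩, ?_, ?_⟩ <;> simp only [Nat.dist] <;> omega
  refine ⟨Function.update j a y, ?_, ?_⟩
  · have h1 : manhattan i (Function.update j a y) + 1 = manhattan i j := by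
      rw [manhattan, manhattan, ← Finset.add_sum_erase _ _ (Finset.mem_univ a),
        ← Finset.add_sum_erase (a := a) _ (fun b => Nat.dist (i b) (j b)) (Finset.mem_univ a),
        Function.update_self, ← hy1, add_right_comm]
      congr 1
      refine Finset.sum_congr rfl fun b hb => ?_
      rw [Function.update_of_ne (Finset.ne_of_mem_erase hb)]
    omega
  · change manhattan _ _ = 1
    rw [manhattan, Finset.sum_eq_single a]
    · rw [Function.update_self, hy2]
    · intro b _ hb
      rw [Function.update_of_ne hb, Nat.dist_self]
    · exact fun h => absurd (Finset.mem_univ _) h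

/-- Two balls of radius `r` meet only if their centres are within distance `2 r`. -/
theorem card_overlap_le (r : ℕ) (i : Site d n) :
    (Finset.univ.filter (Overlap (fun i j : Site d n => manhattan i j ≤ r) i)).card ≤
      (4 * r + 1) ^ d := by
  refine (Finset.card_le_card fun j hj => ?_).trans
    ((card_manhattan_le (2 * r) i).trans_eq (by ring_nf))
  obtain ⟨k, hk, hk'⟩ := (Finset.mem_filter.1 hj).2
  refine Finset.mem_filter.2 ⟨Finset.mem_univ _, ?_⟩
  have := manhattan_triangle i k j
  rw [manhattan_comm j k] at hk'
  omega

/-- A shortest path from the centre stays in the ball, since the distance to `i` drops by one at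
each step back from `j`. -/
theorem reflTransGen_of_manhattan_le {r : ℕ} {A : Finset (Site d n)} {i j : Site d n}
    (hi : i ∈ A) (hij : manhattan i j ≤ r) :
    ReflTransGen (StepIn (latticeGraph d n).Adj (hull (fun i j => manhattan i j ≤ r) A)) i j := by
  have hmem : ∀ k, manhattan i k ≤ r → k ∈ hull (fun i j => manhattan i j ≤ r) A :=
    fun k hk => mem_hull.2 ⟨i, hi, hk⟩
  generalize hm : manhattan i j = m
  induction m generalizing j with
  | zero =>
    have : i = j := by
      funext a
      have h := (Finset.sum_eq_zero_iff.1 hm) a (Finset.mem_univ a)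
      exact Fin.ext (Nat.eq_of_dist_eq_zero h)
    rw [this]
  | succ m ih =>
    obtain ⟨k, hk, hkj⟩ := exists_adj_of_manhattan_eq_succ hm
    exact (ih (by omega) hk).tail ⟨hkj, hmem k (by omega), hmem j hij⟩

/-- The union of the balls about the points of a cluster is connected in the lattice. -/
theorem reflTransGen_hull {r : ℕ} {A : Finset (Site d n)}
    (hA : IsCluster (Overlap fun i j : Site d n => manhattan i j ≤ r) A) {u v : Site d n}
    (hu : u ∈ hull (fun i j => manhattan i j ≤ r) A)
    (hv : v ∈ hull (fun i j => manhattan i j ≤ r) A) :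
    ReflTransGen (StepIn (latticeGraph d n).Adj (hull (fun i j => manhattan i j ≤ r) A)) u v := by
  obtain ⟨i, hi, hiu⟩ := mem_hull.1 hu
  obtain ⟨j, hj, hjv⟩ := mem_hull.1 hv
  have hsymm : ∀ a b, (latticeGraph d n).Adj a b → (latticeGraph d n).Adj b a :=
    fun a b h => h.symm
  refine (reflTransGen_stepIn_symm hsymm (reflTransGen_of_manhattan_le hi hiu)).trans
    (ReflTransGen.trans ?_ (reflTransGen_of_manhattan_le hj hjv))
  have h := hA.2 i hi j hj
  clear hjv hj
  induction h with
  | refl => exact .refl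
  | tail _ hbc ih =>
    obtain ⟨⟨k, hbk, hck⟩, hb, hc⟩ := hbc
    exact ih.trans ((reflTransGen_of_manhattan_le hb hbk).trans
      (reflTransGen_stepIn_symm hsymm (reflTransGen_of_manhattan_le hc hck)))

end Geometry

/-! ### Locality and commutation of the cluster terms. -/

section LocalTerms

variable {d n q : ℕ}

open scoped Matrix Matrix.Norms.L2Operator

theorem ActsOn.localOn {S : Finset (Site d n)} {M : SpinMatrix d n q} {S' : Set (Site d n)}
    (h : ActsOn S' M) (hS : ∀ i, i ∈ S ↔ i ∈ S') : LocalOn S M := by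
  obtain ⟨B, hB⟩ := h
  simp_rw [← hS] at hB
  constructor
  · intro s t hne
    rw [hB] at hne
    by_contra hc
    exact hne (if_neg hc)
  · intro s t s' t' hst hst' hs ht
    rw [hB, hB, if_pos hst, if_pos hst']
    congr 1
    · funext i
      exact hs i ((hS _).2 i.2)
    · funext i
      exact ht i ((hS _).2 i.2)

theorem localOn_clusterTerm {T : Site d n → Site d n → Prop} {a : Site d n → SpinMatrix d n q}
    (ha : ∀ i, LocalOn (hull T {i}) (a i)) (S : Finset (Site d n)) :
    LocalOn (hull T S) (clusterTerm a S) := by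
  rw [clusterTerm, altSum]
  refine LocalOn.sum fun U hU => ?_
  rw [← Int.cast_smul_eq_zsmul ℂ]
  refine LocalOn.smul (LocalOn.exp (LocalOn.sum fun i hi => (ha i).mono ?_)) _
  exact hull_mono (Finset.singleton_subset_iff.2 (Finset.mem_powerset.1 hU hi))

theorem commute_of_not_overlap {T : Site d n → Site d n → Prop} {a : Site d n → SpinMatrix d n q}
    (ha : ∀ i, LocalOn (hull T {i}) (a i)) {i j : Site d n} (h : ¬ Overlap T i j) :
    Commute (a i) (a j) :=
  (ha i).commute_of_disjoint (ha j) (disjoint_hull fun a ha b hb => by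
    rw [Finset.mem_singleton.1 ha, Finset.mem_singleton.1 hb]
    exact h)

open scoped Classical in
/-- The truncated cluster expansion of a local Hamiltonian is a projected entangled pair
operator. -/
theorem isPEPO_truncatedExp [Nonempty (Site d n)] (hq : 0 < q) {r : ℕ}
    {a : Site d n → SpinMatrix d n q}
    (ha : ∀ i, LocalOn (hull (fun i j => manhattan i j ≤ r) {i}) (a i)) (L : ℕ) :
    IsPEPO (1 + (2 * r + 1) ^ d * ((4 * r + 1) ^ d) ^ (2 * L) *
      (q ^ (L * (2 * r + 1) ^ d) * q ^ (L * (2 * r + 1) ^ d)))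
      (truncatedExp (Overlap fun i j : Site d n => manhattan i j ≤ r) a L) := by
  have hT : ∀ i : Site d n, manhattan i i ≤ r := fun i => by simp [manhattan_self]
  refine isPEPO_sum_smallComponents (T := fun i j : Site d n => manhattan i j ≤ r) hT
    (fun i j h => by rwa [manhattan_comm]) (fun i => ?_) (fun i => ?_) hq
    (fun A hA u hu v hv => reflTransGen_hull hA hu hv) (clusterTerm_empty a) (fun S S' h => ?_)
    (localOn_clusterTerm ha) L
  · convert card_manhattan_le r i
  · convert card_overlap_le r i
  · convert clusterTerm_union (R := Overlap fun i j : Site d n => manhattan i j ≤ r) (fun i => ⟨i, hT i, hT i⟩)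
      (fun i j => commute_of_not_overlap ha) h

end LocalTerms

end ThermalLattice

namespace ThermalLattice

/-! ### Choice of the step size, the cutoff and the bond dimension exponent. -/

section Constants

/-- The left side is continuous in `τ` and vanishes at zero. The threshold depends on `B` and `J`
alone, which keeps the final exponent independent of `n` and of the Hamiltonian. -/
theorem exists_step (B J : ℝ) : ∃ τ₀ : ℝ, 0 < τ₀ ∧ ∀ τ : ℝ, 0 < τ → τ ≤ τ₀ →
    B ^ 2 * ((Real.exp (τ * J) - 1) * Real.exp (τ * J * B)) ≤ 1 / 2 := by
  have hc : Continuous fun τ : ℝ =>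
      B ^ 2 * ((Real.exp (τ * J) - 1) * Real.exp (τ * J * B)) := by fun_prop
  have h := hc.tendsto 0
  have h0 : B ^ 2 * ((Real.exp (0 * J) - 1) * Real.exp (0 * J * B)) = 0 := by simp
  rw [h0] at h
  obtain ⟨η, hη, hball⟩ := Metric.eventually_nhds_iff.1
    (h.eventually (gt_mem_nhds (by norm_num : (0 : ℝ) < 1 / 2)))
  refine ⟨η / 2, by positivity, fun τ hτ hτ' => (hball ?_).le⟩
  rw [Real.dist_eq, sub_zero, abs_of_pos hτ]
  linarith

theorem exists_bondDim_exponent (d : ℕ) {K c : ℝ} (hK : 1 ≤ K) (hc : 0 < c) :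
    ∃ C : ℝ, 0 ≤ C ∧ ∀ (n m L : ℕ) (ε : ℝ), 2 ≤ n → 0 < m → 0 < ε → ε ≤ 1 →
      (m : ℝ) ≤ c * Real.log n → (L : ℝ) ≤ Real.log (2 * m * n ^ d / ε) / Real.log 2 + 1 →
      (K ^ (L + 1)) ^ m ≤ ((n : ℝ) / ε) ^ (C * Real.log n) := by
  have hl2 : 0 < Real.log 2 := Real.log_pos one_lt_two
  have hlK : 0 ≤ Real.log K := Real.log_nonneg hK
  -- In units of `x = log (n / ε)`: the summands `1`, `c / log 2 + 1` and `d` account for `log 2`,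
  -- `log m - log ε` and `d log n`, and `2 / log 2` for rounding `L` up and for `L + 1`.
  set c₂ : ℝ := (1 + c / Real.log 2 + 1 + d) / Real.log 2 + 2 / Real.log 2 with hc₂
  have hc₂0 : 0 ≤ c₂ := by positivity
  refine ⟨c * c₂ * Real.log K, by positivity, fun n m L ε hn hm hε hε1 hmc hL => ?_⟩
  have hn' : (2 : ℝ) ≤ n := by exact_mod_cast hn
  have hm' : (0 : ℝ) < m := by exact_mod_cast hm
  have hn0 : (0 : ℝ) < n := by linarith
  have hln : Real.log 2 ≤ Real.log n := Real.log_le_log two_pos hn'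
  have hln0 : 0 < Real.log n := hl2.trans_le hln
  have hlε : Real.log ε ≤ 0 := Real.log_nonpos hε.le hε1
  set x := Real.log (n / ε) with hx
  have hxe : x = Real.log n - Real.log ε := Real.log_div hn0.ne' hε.ne'
  have hxn : Real.log n ≤ x := by rw [hxe]; linarith
  have hx0 : 0 < x := hln0.trans_le hxn
  have h1x : 1 ≤ x / Real.log 2 := by
    rw [le_div_iff₀ hl2]
    linarith
  have hlogm : Real.log m ≤ c + Real.log n := by
    refine (Real.log_le_log hm' hmc).trans ?_
    rw [Real.log_mul hc.ne' hln0.ne']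
    have h1 := Real.log_le_sub_one_of_pos hc
    have h2 := Real.log_le_sub_one_of_pos hln0
    linarith
  have hbig : Real.log (2 * m * n ^ d / ε) ≤ (1 + c / Real.log 2 + 1 + d) * x := by
    rw [Real.log_div (by positivity) hε.ne', Real.log_mul (by positivity) (by positivity),
      Real.log_mul two_ne_zero hm'.ne', Real.log_pow]
    have h1 : c ≤ c / Real.log 2 * x := by
      calc c = c * 1 := (mul_one c).symm
        _ ≤ c * (x / Real.log 2) := mul_le_mul_of_nonneg_left h1x hc.le
        _ = c / Real.log 2 * x := by ring
    have h2 : (d : ℝ) * Real.log n ≤ d * x := mul_le_mul_of_nonneg_left hxn d.cast_nonneg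
    nlinarith
  have hL1 : (L : ℝ) + 1 ≤ c₂ * x := by
    have h3 : Real.log (2 * m * n ^ d / ε) / Real.log 2 ≤
        (1 + c / Real.log 2 + 1 + d) * x / Real.log 2 := div_le_div_of_nonneg_right hbig hl2.le
    have h4 : c₂ * x = (1 + c / Real.log 2 + 1 + d) * x / Real.log 2 + 2 * (x / Real.log 2) := by
      rw [hc₂]
      ring
    rw [h4]
    linarith
  rw [Real.rpow_def_of_pos (by positivity), ← pow_mul, ← Real.exp_log (by positivity :
    (0 : ℝ) < K ^ ((L + 1) * m)), Real.log_pow]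
  refine Real.exp_le_exp.2 ?_
  push_cast
  have h5 : ((L : ℝ) + 1) * m ≤ (c₂ * x) * (c * Real.log n) :=
    mul_le_mul hL1 hmc hm'.le (by positivity)
  calc ((L : ℝ) + 1) * m * Real.log K ≤ (c₂ * x) * (c * Real.log n) * Real.log K :=
        mul_le_mul_of_nonneg_right h5 hlK
    _ = x * (c * c₂ * Real.log K * Real.log n) := by ring

/-- The exponent `L + 1` rather than `L` absorbs the prefactor `1 + v`, also when `L = 0`. -/
theorem one_add_mul_pow_le (v B q L : ℕ) (hB : 0 < B) (hq : 0 < q) :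
    1 + v * B ^ (2 * L) * (q ^ (L * v) * q ^ (L * v)) ≤
      ((1 + v) * (B ^ 2 * (q ^ v * q ^ v))) ^ (L + 1) := by
  have h1 : 1 ≤ (B ^ 2 * (q ^ v * q ^ v)) := Nat.succ_le_of_lt (by positivity)
  have h2 : v * B ^ (2 * L) * (q ^ (L * v) * q ^ (L * v)) =
      v * (B ^ 2 * (q ^ v * q ^ v)) ^ L := by
    rw [mul_comm L v]
    ring
  rw [h2]
  calc 1 + v * (B ^ 2 * (q ^ v * q ^ v)) ^ L
      ≤ (1 + v) * (B ^ 2 * (q ^ v * q ^ v)) ^ L := by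
        rw [add_mul, one_mul]
        exact Nat.add_le_add_right (Nat.one_le_pow _ _ h1) _
    _ ≤ (1 + v) ^ (L + 1) * (B ^ 2 * (q ^ v * q ^ v)) ^ (L + 1) :=
        Nat.mul_le_mul (Nat.le_self_pow (by omega) _) (Nat.pow_le_pow_right h1 (by omega))
    _ = _ := (mul_pow _ _ _).symm

/-- The cutoff makes the exponent at most `ε / 2`, and `e^x - 1 ≤ x + x²` there. -/
theorem exp_sub_one_le_of_le {m L : ℕ} {N ε : ℝ} (hN : 0 < N) (hm : 0 < m) (hε : 0 < ε)
    (hε1 : ε ≤ 1) (hL : Real.log (2 * m * N / ε) / Real.log 2 ≤ L) :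
    Real.exp (m * (N * (1 / 2) ^ L)) - 1 ≤ ε := by
  have hm' : (0 : ℝ) < m := by exact_mod_cast hm
  have h1 : 2 * m * N / ε ≤ 2 ^ L := by
    rw [div_le_iff₀ (Real.log_pos one_lt_two), ← Real.log_pow] at hL
    exact (Real.log_le_log_iff (by positivity) (by positivity)).1 hL
  have h2 : m * (N * (1 / 2) ^ L) ≤ ε / 2 := by
    rw [div_le_iff₀ hε] at h1
    rw [one_div, inv_pow, ← div_eq_mul_inv, ← mul_div_assoc, div_le_iff₀ (by positivity)]
    linarith
  have h3 := Real.abs_exp_sub_one_sub_id_le (x := ε / 2) (by rw [abs_of_pos] <;> linarith)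
  have h4 := (abs_le.1 h3).2
  have h5 := Real.exp_le_exp.2 h2
  nlinarith

end Constants

/-! ### Approximation of thermal and ground states. -/

section Approximation

variable {d n q : ℕ}

open scoped Matrix Matrix.Norms.L2Operator ComplexOrder
open NormedSpace (exp)

/-- The Hermitian part of a matrix. -/
noncomputable def hermPart (M : SpinMatrix d n q) : SpinMatrix d n q := (1 / 2 : ℂ) • (M + Mᴴ)

theorem isHermitian_hermPart (M : SpinMatrix d n q) : (hermPart M).IsHermitian := by
  rw [hermPart, Matrix.IsHermitian, Matrix.conjTranspose_smul, Matrix.conjTranspose_add,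
    Matrix.conjTranspose_conjTranspose, add_comm]
  congr 1
  simp

theorem norm_hermPart_le (M : SpinMatrix d n q) : ‖hermPart M‖ ≤ ‖M‖ := by
  have h : ‖Mᴴ‖ = ‖M‖ := Matrix.l2_opNorm_conjTranspose M
  rw [hermPart, norm_smul]
  have := norm_add_le M Mᴴ
  rw [h] at this
  norm_num
  linarith

theorem LocalOn.hermPart {S : Finset (Site d n)} {M : SpinMatrix d n q} (h : LocalOn S M) :
    LocalOn S (hermPart M) := (h.add h.conjTranspose).smul _

/-- Only the total Hamiltonian is assumed Hermitian, while the cluster expansion needs Hermitian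
terms. Taking Hermitian parts changes neither the sum nor the locality, and does not increase the
norms. -/
theorem sum_hermPart {h : Site d n → SpinMatrix d n q} (hh : (∑ i, h i).IsHermitian) :
    ∑ i, hermPart (h i) = ∑ i, h i := by
  simp_rw [hermPart]
  rw [← Finset.smul_sum, Finset.sum_add_distrib, ← Matrix.conjTranspose_sum, hh.eq, ← two_smul ℂ,
    smul_smul]
  norm_num

/-- The thermal states of a local Hamiltonian are approximated by projected entangled pair
operators. -/
theorem exists_isPEPO_thermal (d q r : ℕ) (J δ : ℝ) (hq : 1 ≤ q) (hδ : 0 < δ) :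
    ∃ C : ℝ, 0 ≤ C ∧ ∀ n : ℕ, 2 ≤ n → ∀ h : Site d n → SpinMatrix d n q,
      (∀ i, LocalOn (hull (fun i j => manhattan i j ≤ r) {i}) (h i)) →
      (∀ i, (h i).IsHermitian) → (∀ i, ‖h i‖ ≤ J) → ∀ ε : ℝ, 0 < ε → ε ≤ 1 →
      ∃ (D : ℕ) (X : SpinMatrix d n q), 1 ≤ D ∧ (D : ℝ) ≤ ((n : ℝ) / ε) ^ (C * Real.log n) ∧
        IsPEPO D X ∧ X.IsHermitian ∧ ∀ W : SpinMatrix d n q, ‖W‖ ≤ 1 →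
          ‖(W * (X - exp (((-(1 / (δ / Real.log n)) : ℝ) : ℂ) • ∑ i, h i))).trace‖ ≤
            ε * (exp (((-(1 / (δ / Real.log n)) : ℝ) : ℂ) • ∑ i, h i)).trace.re := by
  classical
  set v : ℕ := (2 * r + 1) ^ d with hv
  set B : ℕ := (4 * r + 1) ^ d with hB
  have hB0 : 0 < B := by positivity
  obtain ⟨τ₀, hτ₀, hstep⟩ := exists_step B J
  have hl2 : 0 < Real.log 2 := Real.log_pos one_lt_two
  set c : ℝ := 1 / (δ * τ₀) + 1 / Real.log 2 with hc
  have hK : 1 ≤ (1 + v) * (B ^ 2 * (q ^ v * q ^ v)) := Nat.succ_le_of_lt (by positivity)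
  obtain ⟨C, hC, hbond⟩ := exists_bondDim_exponent d
    (K := (((1 + v) * (B ^ 2 * (q ^ v * q ^ v)) : ℕ) : ℝ)) (c := c)
    (by exact_mod_cast hK) (by positivity)
  refine ⟨C, hC, fun n hn h hloc hherm hJ ε hε hε1 => ?_⟩
  have : NeZero n := ⟨by omega⟩
  have : NeZero q := ⟨by omega⟩
  have hn' : (2 : ℝ) ≤ n := by exact_mod_cast hn
  have hln : Real.log 2 ≤ Real.log n := Real.log_le_log two_pos hn'
  have hln0 : 0 < Real.log n := hl2.trans_le hln
  have hJ0 : 0 ≤ J := (norm_nonneg _).trans (hJ fun _ => 0)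
  set β : ℝ := Real.log n / δ with hβ
  have hβ0 : 0 < β := by positivity
  have hβ' : -(1 / (δ / Real.log n)) = -β := by rw [one_div_div]
  -- The number of factors: large enough for the step `β / m` to be at most `τ₀`, yet of order `log
  -- n`.
  set m : ℕ := ⌈β / τ₀⌉₊ with hm
  have hm0 : 0 < m := Nat.ceil_pos.2 (by positivity)
  have hm' : (0 : ℝ) < m := by exact_mod_cast hm0
  have hmc : (m : ℝ) ≤ c * Real.log n := by
    refine (Nat.ceil_lt_add_one (by positivity)).le.trans ?_
    have h1 : 1 ≤ 1 / Real.log 2 * Real.log n := by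
      rw [one_div, inv_mul_eq_div, le_div_iff₀ hl2]
      linarith
    have h2 : β / τ₀ = 1 / (δ * τ₀) * Real.log n := by
      rw [hβ]
      field_simp
    rw [hc, add_mul, ← h2]
    linarith
  set τ : ℝ := β / m with hτ
  have hτ0 : 0 < τ := by positivity
  have hττ₀ : τ ≤ τ₀ := by
    rw [hτ, div_le_iff₀ hm', ← div_le_iff₀' hτ₀]
    exact Nat.le_ceil _
  -- The least cutoff with `2 ^ L ≥ 2 m n ^ d / ε`.
  set L : ℕ := ⌈Real.log (2 * m * n ^ d / ε) / Real.log 2⌉₊ with hL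
  set a : Site d n → SpinMatrix d n q := fun i => ((-τ : ℝ) : ℂ) • h i with ha
  have haherm : ∀ i, (a i).IsHermitian := by
    intro i
    rw [ha, Matrix.IsHermitian, Matrix.conjTranspose_smul, (hherm i).eq]
    congr 1
    exact Complex.conj_ofReal _
  have halocal : ∀ i, LocalOn (hull (fun i j => manhattan i j ≤ r) {i}) (a i) :=
    fun i => (hloc i).smul _
  have hanorm : ∀ i, ‖a i‖ ≤ τ * J := by
    intro i
    rw [ha, norm_smul, Complex.norm_real, norm_neg, Real.norm_of_nonneg hτ0.le]
    exact mul_le_mul_of_nonneg_left (hJ i) hτ0.le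
  have hsum : (m : ℂ) • ∑ i, a i = ((-β : ℝ) : ℂ) • ∑ i, h i := by
    rw [ha, ← Finset.smul_sum, smul_smul, hτ]
    congr 1
    push_cast
    field_simp
  have hT : ∀ i : Site d n, manhattan i i ≤ r := fun i => by simp [manhattan_self]
  have hcard : (Fintype.card (Site d n) : ℝ) = (n : ℝ) ^ d := by simp
  have hLε : Real.exp (m * (Fintype.card (Site d n) * (1 / 2) ^ L)) - 1 ≤ ε := by
    rw [hcard]
    exact exp_sub_one_le_of_le (by positivity) hm0 hε hε1 (Nat.le_ceil _)
  have hPEPO := (isPEPO_truncatedExp (r := r) (Nat.pos_of_ne_zero (NeZero.ne q)) halocal L).pow m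
  refine ⟨_, _, Nat.one_le_pow _ _ (Nat.le_add_right 1 _), ?_, hPEPO,
    (isHermitian_truncatedExp haherm L).pow m, fun W hW => ?_⟩
  · refine le_trans ?_ (hbond n m L ε hn hm0 hε hε1 hmc (Nat.ceil_lt_add_one ?_).le)
    · have := Nat.pow_le_pow_left (one_add_mul_pow_le v B q L hB0 (by omega)) m
      exact_mod_cast this
    · refine div_nonneg (Real.log_nonneg ?_) hl2.le
      rw [one_le_div hε]
      have h1 : (1 : ℝ) ≤ n ^ d := one_le_pow₀ (by linarith)
      have h2 : (1 : ℝ) ≤ m := by exact_mod_cast hm0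
      nlinarith
  · rw [hβ', ← hsum]
    have hpos : 0 ≤ (exp ((m : ℂ) • ∑ i, a i)).trace.re := by
      refine (Complex.nonneg_iff.1 (posSemidef_exp ?_).trace_nonneg).1
      rw [Matrix.IsHermitian, Matrix.conjTranspose_smul, (isHermitian_sum haherm _).eq]
      congr 1
      simp
    refine (norm_trace_truncatedExp_pow_sub_le (fun i => ⟨i, hT i, hT i⟩) Overlap.symm
      (B := B) (fun i => ?_) haherm hanorm (by positivity)
      (fun i j => commute_of_not_overlap halocal) (hstep τ hτ0 hττ₀) L hm0 W).trans ?_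
    · convert card_overlap_le r i
    · have h1 : 0 ≤ Real.exp (m * (Fintype.card (Site d n) * (1 / 2) ^ L)) - 1 := by
        rw [sub_nonneg]
        exact Real.one_le_exp (by positivity)
      calc _ ≤ 1 * ((Real.exp (m * (Fintype.card (Site d n) * (1 / 2) ^ L)) - 1) *
            (exp ((m : ℂ) • ∑ i, a i)).trace.re) :=
            mul_le_mul_of_nonneg_right hW (mul_nonneg h1 hpos)
        _ ≤ _ := by
            rw [one_mul]
            exact mul_le_mul_of_nonneg_right hLε hpos

/-- The ground states of local Hamiltonians of low specific heat are approximated by projected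
entangled pair operators. -/
theorem exists_isPEPO_groundState (d q r : ℕ) (J δ : ℝ) (hq : 1 ≤ q) (hδ : 0 < δ) (hδ1 : δ ≤ 1) :
    ∃ C : ℝ, ∀ n : ℕ, 2 ≤ n →
      ∀ h : Site d n → SpinMatrix d n q,
      (∀ i, ActsOn (ball r i) (h i)) → (∀ i, ‖toOp (h i)‖ ≤ J) → (∑ i, h i).IsHermitian →
      ∀ k Δ ν : ℝ, 0 < k → 0 < Δ →
      (∀ T : ℝ, 0 < T → T ≤ 1 / Real.log n →
        specificHeat (n ^ d) (toHam (∑ i, h i)) T ≤ k * T ^ (-ν) * Real.exp (-Δ / T)) →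
      ν * δ ≤ Δ * Real.log n →
      ∀ ε : ℝ, 0 < ε → ε ≤ n →
      ∃ (D : ℕ) (P : SpinMatrix d n q),
        1 ≤ D ∧ (D : ℝ) ≤ ((n : ℝ) / ε) ^ (C * Real.log n) ∧ IsPEPO D P ∧
        traceNorm (toOp P - groundState (toHam (∑ i, h i)))
          ≤ ENNReal.ofReal (ε + etaErr d n k Δ ν δ) := by
  obtain ⟨C, hC, hmain⟩ := exists_isPEPO_thermal d q r J δ hq hδ
  refine ⟨C, fun n hn h hact hJ hH k Δ ν hk hΔ hc hν ε hε hεn => ?_⟩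
  have : NeZero n := ⟨by omega⟩
  have : NeZero q := ⟨by omega⟩
  have hln0 : 0 < Real.log n := Real.log_pos (by exact_mod_cast hn)
  set T : ℝ := δ / Real.log n with hT
  have hT0 : 0 < T := by positivity
  set H := ∑ i, h i with hHdef
  have hth := isThermalHamiltonian_toHam hH
  have hpart1 := hth.traceNorm_thermalState_sub_le_etaErr hn hk hΔ hδ hδ1 hc hν hT0 le_rfl
  set E : SpinMatrix d n q := exp (((-(1 / T) : ℝ) : ℂ) • H) with hE
  have hZ : (partitionFn (toHam H) T : ℂ) = E.trace := partitionFn_toHam hH T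
  set Z := partitionFn (toHam H) T with hZdef
  have hZ0 : 0 < Z := hth.partitionFn_pos hT0
  have hZre : E.trace.re = Z := by rw [← hZ, Complex.ofReal_re]
  have hcH : (((-(1 / T) : ℝ) : ℂ) • H).IsHermitian := by
    rw [Matrix.IsHermitian, Matrix.conjTranspose_smul, hH.eq]
    congr 1
    exact Complex.conj_ofReal _
  have hEpos : E.PosSemidef := posSemidef_exp hcH
  have hsmul : ∀ {M : SpinMatrix d n q}, M.IsHermitian → ((Z : ℂ)⁻¹ • M).IsHermitian := by
    intro M hM
    rw [Matrix.IsHermitian, Matrix.conjTranspose_smul, hM.eq]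
    congr 1
    rw [← Complex.ofReal_inv]
    exact Complex.conj_ofReal _
  obtain ⟨G, hG, hGeq⟩ := exists_groundState_toHam H
  have hη : 0 ≤ etaErr d n k Δ ν δ := by
    rw [etaErr]
    positivity
  have hB : traceNorm (Matrix.toEuclideanCLM (n := Site d n → Fin q) (𝕜 := ℂ)
      ((Z : ℂ)⁻¹ • E - G)) ≤ ENNReal.ofReal (etaErr d n k Δ ν δ) := by
    rw [map_sub]
    rw [thermalState_toHam hH, hGeq] at hpart1
    exact hpart1
  have hscale : ∀ (X W : SpinMatrix d n q),
      ‖(W * ((Z : ℂ)⁻¹ • X - (Z : ℂ)⁻¹ • E)).trace‖ = Z⁻¹ * ‖(W * (X - E)).trace‖ := by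
    intro X W
    rw [← smul_sub, mul_smul_comm, Matrix.trace_smul, norm_smul, norm_inv, Complex.norm_real,
      Real.norm_of_nonneg hZ0.le]
  have conclude : ∀ X : SpinMatrix d n q, X.IsHermitian →
      (∀ W : SpinMatrix d n q, ‖W‖ ≤ 1 → ‖(W * (X - E)).trace‖ ≤ ε * E.trace.re) →
      traceNorm (toOp ((Z : ℂ)⁻¹ • X) - groundState (toHam H)) ≤
        ENNReal.ofReal (ε + etaErr d n k Δ ν δ) := by
    -- Dividing by `Z` turns the relative error into `ε`; the thermal state at `T = δ / log n` then
    -- lies within `etaErr` of the ground state.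
    intro X hX hXE
    have h1 := traceNorm_add_le ((hsmul hX).sub (hsmul hEpos.isHermitian))
      ((hsmul hEpos.isHermitian).sub hG) hη (c := ε) (fun W hW => ?_) hB
    · rw [sub_add_sub_cancel, map_sub] at h1
      rw [hGeq]
      exact h1
    · rw [hscale, inv_mul_le_iff₀ hZ0, mul_comm, ← hZre]
      exact hXE W hW
  rcases le_or_gt ε 1 with hε1 | hε1
  · have hloc : ∀ i, LocalOn (hull (fun i j => manhattan i j ≤ r) {i}) (h i) := fun i =>
      (hact i).localOn fun j => by simp [mem_hull, ball]
    obtain ⟨D, X, hD, hDle, hXP, hXH, hXE⟩ := hmain n hn (fun i => hermPart (h i))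
      (fun i => (hloc i).hermPart) (fun i => isHermitian_hermPart _)
      (fun i => (norm_hermPart_le _).trans (hJ i)) ε hε hε1
    rw [sum_hermPart hH] at hXE
    exact ⟨D, _, hD, hDle, hXP.smul _, conclude X hXH hXE⟩
  -- For `ε > 1` the zero operator already works, since the thermal state has trace one; `ε ≤ n`
  -- keeps the permitted bond dimension at least `1`.
  · refine ⟨1, _, le_rfl, ?_, isPEPO_zero.smul _, conclude 0 Matrix.isHermitian_zero
      fun W hW => ?_⟩
    · rw [Nat.cast_one]
      exact Real.one_le_rpow ((one_le_div hε).2 hεn) (by positivity)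
    · rw [zero_sub, mul_neg, Matrix.trace_neg, norm_neg]
      refine (norm_trace_mul_posSemidef_le W hEpos).trans ?_
      have : 0 ≤ E.trace.re := hZre ▸ hZ0.le
      exact mul_le_mul_of_nonneg_right (hW.trans hε1.le) this

end Approximation

end ThermalLattice

theorem mainTheorem4 :
    (∀ (E : Type*) [NormedAddCommGroup E] [InnerProductSpace ℂ E] [CompleteSpace E] [Nontrivial E]
      (H : E →ₗ.[ℂ] E) (d n : ℕ) (k Δ ν δ : ℝ),
      IsThermalHamiltonian H → 2 ≤ n → 0 < k → 0 < Δ → 0 ≤ ν → 0 < δ → δ ≤ 1 →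
      (∀ T : ℝ, 0 < T → T ≤ 1 / Real.log n →
        specificHeat (n ^ d) H T ≤ k * T ^ (-ν) * Real.exp (-Δ / T)) →
      ν * δ ≤ Δ * Real.log n →
      ∀ T : ℝ, 0 < T → T ≤ δ / Real.log n →
        traceNorm (thermalState H T - groundState H) ≤ ENNReal.ofReal (etaErr d n k Δ ν δ))
    ∧
    (∀ (d q r : ℕ) (J δ : ℝ), 1 ≤ q → 0 < δ → δ ≤ 1 →
      ∃ C : ℝ, ∀ n : ℕ, 2 ≤ n →
        ∀ h : Site d n → SpinMatrix d n q,
        (∀ i, ActsOn (ball r i) (h i)) → (∀ i, ‖toOp (h i)‖ ≤ J) → (∑ i, h i).IsHermitian →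
        ∀ k Δ ν : ℝ, 0 < k → 0 < Δ → 0 ≤ ν →
        (∀ T : ℝ, 0 < T → T ≤ 1 / Real.log n →
          specificHeat (n ^ d) (toHam (∑ i, h i)) T ≤ k * T ^ (-ν) * Real.exp (-Δ / T)) →
        ν * δ ≤ Δ * Real.log n →
        ∀ ε : ℝ, 0 < ε → ε ≤ n →
        ∃ (D : ℕ) (P : SpinMatrix d n q),
          1 ≤ D ∧ (D : ℝ) ≤ ((n : ℝ) / ε) ^ (C * Real.log n) ∧ IsPEPO D P ∧
          traceNorm (toOp P - groundState (toHam (∑ i, h i)))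
            ≤ ENNReal.ofReal (ε + etaErr d n k Δ ν δ)) := by
  constructor
  · intro E _ _ _ _ H d n k Δ ν δ hH hn hk hΔ _ hδ hδ1 hc hν T hT hT1
    exact hH.traceNorm_thermalState_sub_le_etaErr hn hk hΔ hδ hδ1 hc hν hT hT1
  · intro d q r J δ hq hδ hδ1
    obtain ⟨C, hC⟩ := exists_isPEPO_groundState d q r J δ hq hδ hδ1
    exact ⟨C, fun n hn h hact hJ hH k Δ ν hk hΔ _ hc hν ε hε hεn =>
      hC n hn h hact hJ hH k Δ ν hk hΔ hc hν ε hε hεn⟩
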